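/- **Setting.** Let $\delta\in\mathbb R$, $q_0>0$, $q_\pm\in\mathbb C$ with $|q_\pm|=q_0$. Let $q:\mathbb R\times\mathbb R\to\mathbb C$ be a classical solution (six continuous $x$-derivatives, jointly continuous in $(x,t)$; differentiable in $t$) of the sextic nonlinear Schrödinger equation $$\begin{aligned}&iq_t+\tfrac12q_{xx}+q(|q|^2-q_0^2)+20\delta q(|q|^6-q_0^6)+\delta q_{xxxxxx}+\delta[60q^*|q_x|^2+50(q^*)^2q_{xx}+2q^*_{xxxx}]q^2\\&+\delta q[12q^*q_{xxxx}+8q_xq^*_{xxx}+22|q_{xx}|^2]+\delta q[18q_{xxx}q_x^*+70(q^*)^2q_x^2]+20\delta q_x^2q^*_{xx}\\&+10\delta q_x[5q_{xx}q^*_x+3q^*q_{xxx}]+20\delta q^*q_{xx}^2+10\delta q^3[(q_x^*)^2+2q^*q^*_{xx}]=0\end{aligned}$$ such that, as $x\to\pm\infty$ and locally uniformly in $t$, $q\to q_\pm$ and $\partial_x^nq\to0$ for $1\le n\le5$, and such that for every $t$ the function $q-q_+$ is integrable on $[0,\infty)$, $q-q_-$ is integrable on $(-\infty,0]$ and $q_x$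 is integrable on $\mathbb R$. **Notation.** $\sigma_3=\mathrm{diag}(1,-1)$, $Q=\begin{pmatrix}0&iq^*\\iq&0\end{pmatrix}$, $Q_\pm=\begin{pmatrix}0&iq_\pm^*\\iq_\pm&0\end{pmatrix}$; $k=\frac12(z-q_0^2/z)$, $\lambda=\frac12(z+q_0^2/z)$; $D^\pm=\{z:\pm(|z|^2-q_0^2)\,\mathrm{Im}\,z>0\}$; $\Sigma=\mathbb R\cup\{|z|=q_0\}$ and $\Sigma'=\Sigma\setminus\{0,\pm iq_0\}$; $Y_\pm=I+\frac iz\sigma_3Q_\pm$, $\gamma=\det Y_\pm=1+q_0^2/z^2$; $\theta=\lambda\,[x+(32\delta k^5-16\delta q_0^2k^3+12\delta q_0^4k+k)t]$. The columns $\mu_{\pm,j}$ of the (modified) Jost matrices $\mu_\pm(x,t;z)$ are the columns satisfying, at each $t$, $\mu_x=(ik\sigma_3+Q)\mu-i\lambda\mu\sigma_3$ and $\mu_\pm\to Y_\pm$ as $x\to\pm\infty$; and $\psi_\pm=\mu_\pm e^{i\theta\sigma_3}$. With $W$ the Wronskian (determinant) of two columns, $s_{11}=W(\psi_{+,1},\psi_{-,2})/\gamma$,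 $s_{12}=W(\psi_{+,2},\psi_{-,2})/\gamma$, $s_{21}=W(\psi_{-,1},\psi_{+,1})/\gamma$, $s_{22}=W(\psi_{-,1},\psi_{+,2})/\gamma$, $S=(s_{ij})$, $\rho=s_{21}/s_{11}$, $\tilde\rho=s_{12}/s_{22}$. Define $M(x,t;z)$ for $z\notin\Sigma$ by $$M^+=\Big(\frac{\mu_{+,1}}{s_{11}},\,\mu_{-,2}\Big)\ \text{for } z\in D^+,\qquad M^-=\Big(\mu_{-,1},\,\frac{\mu_{+,2}}{s_{22}}\Big)\ \text{for } z\in D^-,$$ and use the same formulas for $M^\pm$ at points of $\Sigma'$ where $s_{11}\ne0$, respectively $s_{22}\neq0$. **Claim.** The construction is well defined: $\mu_{+,1},\mu_{-,2}$ exist and are unique for $z\in D^+\cup\Sigma'$, $\mu_{-,1},\mu_{+,2}$ exist and are unique for $z\in D^-\cup\Sigma'$, and the corresponding columns of $\psi_\pm$ solve both equations of the Lax pair $\psi_x=(ik\sigma_3+Q)\psi$, $\psi_t=T\psi$ of the equation, where $T=\begin{pmatrix}T_{11}&T_{12}\\T_{21}&-T_{11}\end{pmatrix}$ with $$\begin{aligned}T_{11}={}&i\big[-\tfrac12|q|^2+\tfrac12q_0^2+10\delta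 q_0^6-10\delta|q|^6-5\delta(q_x^2(q^*)^2+(q^*_x)^2q^2)-\delta|q_{xx}|^2\\&\quad+\delta(q_xq^*_{xxx}+q^*_xq_{xxx}-q^*q_{xxxx}-qq^*_{xxxx})-10\delta|q|^2(q_{xx}q^*+q^*_{xx}q)\big]\\&-k\delta\big[12|q|^2(q_xq^*-q^*_xq)+2(q_xq^*_{xx}-q^*_xq_{xx}+q^*q_{xxx}-q^*_{xxx}q)\big]\\&+ik^2\big[1+12\delta|q|^4-4\delta|q_x|^2+4\delta(q^*_{xx}q+q_{xx}q^*)\big]-8\delta k^3(qq^*_x-q^*q_x)-16i\delta k^4|q|^2+32i\delta k^6,\\T_{21}={}&32i\delta k^5q-16\delta k^4q_x-ik^3\delta(16|q|^2q+8q_{xx})+k^2\delta(24|q|^2q_x+4q_{xxx})\\&+ik\big[q+\delta(12q^*q_x^2+16|q|^2q_{xx}+4q^2q^*_{xx}+2q_{xxxx}+12|q|^4q+8q|q_x|^2)\big]\\&-\big[\tfrac12q_x+\delta q_{xxxxx}+10\delta(qq^*_xq_{xx}+qq^*_{xx}q_x+|q|^2q_{xxx}+3|q|^4q_x+q_x|q_x|^2+2q^*q_xq_{xx})\big],\\T_{12}={}&32i\delta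 k^5q^*+16\delta k^4q^*_x-ik^3\delta(16|q|^2q^*+8q^*_{xx})-k^2\delta(24|q|^2q^*_x+4q^*_{xxx})\\&+ik\big[q^*+\delta(12q(q^*_x)^2+16|q|^2q^*_{xx}+4(q^*)^2q_{xx}+2q^*_{xxxx}+12|q|^4q^*+8q^*|q_x|^2)\big]\\&+\big[\tfrac12q^*_x+\delta q^*_{xxxxx}+10\delta(q^*q_xq^*_{xx}+q^*q_{xx}q^*_x+|q|^2q^*_{xxx}+3|q|^4q^*_x+q^*_x|q_x|^2+2qq^*_xq^*_{xx})\big].\end{aligned}$$ Moreover $s_{11}$ (on $D^+\cup\Sigma'$), $s_{22}$ (on $D^-\cup\Sigma'$) and $s_{12},s_{21}$ (on $\Sigma'$) do not depend on $(x,t)$, and $\psi_+=\psi_-S$ on $\Sigma'$. For all $x,t\in\mathbb R$, the matrix $M$ solves the following generalized Riemann–Hilbert problem. 1. $M$ is meromorphic in $\mathbb C\setminus\Sigma$. 2. At every $z\in\Sigma'$ with $s_{11}(z)\ne0$ (respectively $s_{22}(z)\neq0$), $M^+(z)$ (respectively $M^-(z)$) is the limit of $M$ from $D^+$ (respectively $D^-$);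 and at every $z\in\Sigma'$ with $s_{11}(z)s_{22}(z)\ne0$, $$M^-=M^+(I-G),\qquad G=\begin{pmatrix}0&-\tilde\rho\,e^{2i\theta}\\\rho\,e^{-2i\theta}&\rho\tilde\rho\end{pmatrix}.$$ 3. $M^\pm=I+O(1/z)$ as $z\to\infty$ in $D^\pm\cup\Sigma$. 4. $M^\pm=\frac iz\sigma_3Q_-+O(1)$ as $z\to0$ in $(D^\pm\cup\Sigma)\setminus\{0\}$. -/

import Mathlib

open Complex Filter Topology Matrix MeasureTheory Asymptotics
open scoped ComplexConjugate

namespace SexticNLS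

noncomputable section

/-! ### The equation and its Lax pair -/

/-- The `n`-th `x`-derivative of `q` at `(x, t)`. -/
def dx (q : ℝ → ℝ → ℂ) (n : ℕ) (x t : ℝ) : ℂ := iteratedDeriv n (fun y => q y t) x

/-- The higher-order part of the sextic equation, a differential polynomial in the jets
`q n = ∂ₓⁿ q` and `p n = ∂ₓⁿ q*`. -/
def sexticPart (q p : ℕ → ℂ) : ℂ :=
  q 6 + (60 * p 0 * q 1 * p 1 + 50 * p 0 ^ 2 * q 2 + 2 * p 4) * q 0 ^ 2
    + q 0 * (12 * p 0 * q 4 + 8 * q 1 * p 3 + 22 * q 2 * p 2)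
    + q 0 * (18 * q 3 * p 1 + 70 * p 0 ^ 2 * q 1 ^ 2)
    + 20 * q 1 ^ 2 * p 2
    + 10 * q 1 * (5 * q 2 * p 1 + 3 * p 0 * q 3)
    + 20 * p 0 * q 2 ^ 2
    + 10 * q 0 ^ 3 * (p 1 ^ 2 + 2 * p 0 * p 2)

/-- The sextic NLS equation at `(x, t)`, in the gauge in which the boundary values do not
depend on time. -/
def SatisfiesEquation (δ q₀ : ℝ) (q : ℝ → ℝ → ℂ) (x t : ℝ) : Prop :=
  I * deriv (fun τ => q x τ) t + 1 / 2 * dx q 2 x t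
    + q x t * ((‖q x t‖ : ℂ) ^ 2 - (q₀ : ℂ) ^ 2)
    + 20 * δ * q x t * ((‖q x t‖ : ℂ) ^ 6 - (q₀ : ℂ) ^ 6)
    + δ * sexticPart (fun n => dx q n x t) (fun n => conj (dx q n x t)) = 0

/-- Classical solutions with the non-zero boundary conditions `q → q₊` (`x → +∞`),
`q → q₋` (`x → -∞`), `|q₊| = |q₋| = q₀ ≠ 0`, attained together with the `x`-derivatives that occur
in the Lax pair, with `q - q±` integrable at `±∞` and `qₓ` integrable. -/
structure IsSolution (δ q₀ : ℝ) (qp qm : ℂ) (q : ℝ → ℝ → ℂ) : Prop where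
  q₀_pos : 0 < q₀
  norm_qp : ‖qp‖ = q₀
  norm_qm : ‖qm‖ = q₀
  contDiff_x : ∀ t, ContDiff ℝ 6 (fun x => q x t)
  continuous_dx : ∀ n ≤ 6, Continuous (fun p : ℝ × ℝ => dx q n p.1 p.2)
  differentiable_t : ∀ x, Differentiable ℝ (fun t => q x t)
  equation : ∀ x t, SatisfiesEquation δ q₀ q x t
  tendsto_top : TendstoLocallyUniformly (fun x t => q x t) (fun _ => qp) atTop
  tendsto_bot : TendstoLocallyUniformly (fun x t => q x t) (fun _ => qm) atBot
  tendsto_dx_top : ∀ n, 1 ≤ n → n ≤ 5 →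
    TendstoLocallyUniformly (fun x t => dx q n x t) (fun _ => 0) atTop
  tendsto_dx_bot : ∀ n, 1 ≤ n → n ≤ 5 →
    TendstoLocallyUniformly (fun x t => dx q n x t) (fun _ => 0) atBot
  integrable_top : ∀ t, IntegrableOn (fun x => q x t - qp) (Set.Ici 0)
  integrable_bot : ∀ t, IntegrableOn (fun x => q x t - qm) (Set.Iic 0)
  integrable_dx : ∀ t, Integrable (fun x => dx q 1 x t)

def sigma3 : Matrix (Fin 2) (Fin 2) ℂ := !![1, 0; 0, -1]

/-- The potential matrix `Q`; `Q±` is `Qmat q±`. -/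
def Qmat (w : ℂ) : Matrix (Fin 2) (Fin 2) ℂ := !![0, I * conj w; I * w, 0]

/-- `X = i k σ₃ + Q`. -/
def laxX (q : ℝ → ℝ → ℂ) (k : ℂ) (x t : ℝ) : Matrix (Fin 2) (Fin 2) ℂ :=
  (I * k) • sigma3 + Qmat (q x t)

def T11 (δ q₀ k : ℂ) (q p : ℕ → ℂ) : ℂ :=
  I * (-(1 / 2) * q 0 * p 0 + 1 / 2 * q₀ ^ 2 + 10 * δ * q₀ ^ 6
      + δ * (-10 * (q 0 * p 0) ^ 3 - 5 * (q 1 ^ 2 * p 0 ^ 2 + p 1 ^ 2 * q 0 ^ 2) - q 2 * p 2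
        + q 1 * p 3 + p 1 * q 3 - p 0 * q 4 - q 0 * p 4
        - 10 * q 0 * p 0 * (q 2 * p 0 + p 2 * q 0)))
    - k * δ * (12 * q 0 * p 0 * (q 1 * p 0 - p 1 * q 0)
        + 2 * (q 1 * p 2 - p 1 * q 2 + p 0 * q 3 - p 3 * q 0))
    + I * k ^ 2 * (1 + δ * (12 * (q 0 * p 0) ^ 2 - 4 * q 1 * p 1 + 4 * (p 2 * q 0 + q 2 * p 0)))
    - 8 * δ * k ^ 3 * (q 0 * p 1 - p 0 * q 1) - 16 * I * δ * k ^ 4 * q 0 * p 0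
    + 32 * I * δ * k ^ 6

def T21 (δ k : ℂ) (q p : ℕ → ℂ) : ℂ :=
  32 * I * δ * k ^ 5 * q 0 - 16 * δ * k ^ 4 * q 1
    + I * k ^ 3 * δ * (-16 * q 0 ^ 2 * p 0 - 8 * q 2)
    + k ^ 2 * δ * (24 * q 0 * p 0 * q 1 + 4 * q 3)
    + I * k * (q 0 + δ * (12 * p 0 * q 1 ^ 2 + 16 * q 0 * p 0 * q 2 + 4 * q 0 ^ 2 * p 2
        + 2 * q 4 + 12 * (q 0 * p 0) ^ 2 * q 0 + 8 * q 0 * q 1 * p 1))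
    - (1 / 2 * q 1 + δ * q 5 + 10 * δ * (q 0 * p 1 * q 2 + q 0 * p 2 * q 1 + q 0 * p 0 * q 3
        + 3 * (q 0 * p 0) ^ 2 * q 1 + q 1 ^ 2 * p 1 + 2 * p 0 * q 1 * q 2))

def T12 (δ k : ℂ) (q p : ℕ → ℂ) : ℂ :=
  32 * I * δ * k ^ 5 * p 0 + 16 * δ * k ^ 4 * p 1
    + I * k ^ 3 * δ * (-16 * p 0 ^ 2 * q 0 - 8 * p 2)
    - k ^ 2 * δ * (24 * q 0 * p 0 * p 1 + 4 * p 3)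
    + I * k * (p 0 + δ * (12 * q 0 * p 1 ^ 2 + 16 * q 0 * p 0 * p 2 + 4 * p 0 ^ 2 * q 2
        + 2 * p 4 + 12 * (q 0 * p 0) ^ 2 * p 0 + 8 * p 0 * q 1 * p 1))
    + (1 / 2 * p 1 + δ * p 5 + 10 * δ * (p 0 * q 1 * p 2 + p 0 * q 2 * p 1 + q 0 * p 0 * p 3
        + 3 * (q 0 * p 0) ^ 2 * p 1 + p 1 ^ 2 * q 1 + 2 * q 0 * p 1 * p 2))

/-- The matrix `T` of the time part of the Lax pair. -/
def laxT (δ q₀ : ℝ) (q : ℝ → ℝ → ℂ) (k : ℂ) (x t : ℝ) : Matrix (Fin 2) (Fin 2) ℂ :=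
  let u : ℕ → ℂ := fun n => dx q n x t
  let v : ℕ → ℂ := fun n => conj (dx q n x t)
  !![T11 δ q₀ k u v, T12 δ k u v; T21 δ k u v, -T11 δ q₀ k u v]

/-! ### The uniformization variable -/

def kz (q₀ : ℝ) (z : ℂ) : ℂ := 1 / 2 * (z - (q₀ : ℂ) ^ 2 / z)

def lam (q₀ : ℝ) (z : ℂ) : ℂ := 1 / 2 * (z + (q₀ : ℂ) ^ 2 / z)

def Dplus (q₀ : ℝ) : Set ℂ := {z | 0 < (‖z‖ ^ 2 - q₀ ^ 2) * z.im}

def Dminus (q₀ : ℝ) : Set ℂ := {z | (‖z‖ ^ 2 - q₀ ^ 2) * z.im < 0}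

/-- The contour `Σ = ℝ ∪ {|z| = q₀}`. -/
def Sigma (q₀ : ℝ) : Set ℂ := {z | z.im = 0 ∨ ‖z‖ = q₀}

/-- `Σ` without the origin and the branch points `± i q₀`. -/
def SigmaReg (q₀ : ℝ) : Set ℂ := Sigma q₀ \ {0, I * q₀, -(I * q₀)}

def theta (δ q₀ : ℝ) (x t : ℝ) (z : ℂ) : ℂ :=
  lam q₀ z * (x + (32 * δ * kz q₀ z ^ 5 - 16 * δ * kz q₀ z ^ 3 * (q₀ : ℂ) ^ 2
    + 12 * δ * kz q₀ z * (q₀ : ℂ) ^ 4 + kz q₀ z) * t)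

/-! ### Jost functions -/

/-- `Y± = I + (i/z) σ₃ Q±`, for `w = q±`. -/
def Ymat (w z : ℂ) : Matrix (Fin 2) (Fin 2) ℂ := 1 + (I / z) • (sigma3 * Qmat w)

/-- `f` is the `j`-th column, at time `t`, of the modified Jost matrix `μ = ψ e^{-iθσ₃}` normalized
at the end `l` (`atTop` or `atBot`) of the line, where the potential tends to `w`: it satisfies
`μₓ = X μ - i λ μ σ₃` and `μ → Y`. -/
def IsJost (q₀ : ℝ) (q : ℝ → ℝ → ℂ) (l : Filter ℝ) (w : ℂ) (t : ℝ) (z : ℂ) (j : Fin 2)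
    (f : ℝ → Fin 2 → ℂ) : Prop :=
  (∀ x, HasDerivAt f
    (laxX q (kz q₀ z) x t *ᵥ f x - (I * lam q₀ z * sigma3 j j) • f x) x) ∧
  Tendsto f l (𝓝 (fun i => Ymat w z i j))

open Classical in
/-- The `j`-th column of `μ` (the zero function if there is none). -/
def jost (q₀ : ℝ) (q : ℝ → ℝ → ℂ) (l : Filter ℝ) (w : ℂ) (t : ℝ) (z : ℂ) (j : Fin 2) :
    ℝ → Fin 2 → ℂ :=
  if h : ∃ f, IsJost q₀ q l w t z j f then h.choose else 0

/-- The matrix `μ(x, t; z)`; `μ₊` is `mu q₀ q atTop q₊` and `μ₋` is `mu q₀ q atBot q₋`. -/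
def mu (q₀ : ℝ) (q : ℝ → ℝ → ℂ) (l : Filter ℝ) (w : ℂ) (x t : ℝ) (z : ℂ) :
    Matrix (Fin 2) (Fin 2) ℂ :=
  Matrix.of fun i j => jost q₀ q l w t z j x i

/-- The Jost matrix `ψ = μ e^{iθσ₃}`. -/
def psi (δ q₀ : ℝ) (q : ℝ → ℝ → ℂ) (l : Filter ℝ) (w : ℂ) (x t : ℝ) (z : ℂ) :
    Matrix (Fin 2) (Fin 2) ℂ :=
  mu q₀ q l w x t z *
    Matrix.diagonal ![exp (I * theta δ q₀ x t z), exp (-(I * theta δ q₀ x t z))]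

/-- `φ` solves both equations `φₓ = X φ`, `φₜ = T φ` of the Lax pair. -/
def SolvesLax (δ q₀ : ℝ) (q : ℝ → ℝ → ℂ) (z : ℂ) (φ : ℝ → ℝ → Fin 2 → ℂ) : Prop :=
  ∀ x t, HasDerivAt (fun y => φ y t) (laxX q (kz q₀ z) x t *ᵥ φ x t) x ∧
    HasDerivAt (fun τ => φ x τ) (laxT δ q₀ q (kz q₀ z) x t *ᵥ φ x t) t

/-- `f` is the unique Jost column of index `j` at every time, and the resulting column of `ψ`
solves the Lax pair. -/
def JostWellDefined (δ q₀ : ℝ) (q : ℝ → ℝ → ℂ) (l : Filter ℝ) (w : ℂ) (j : Fin 2) (z : ℂ) :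
    Prop :=
  (∀ t, ∃! f, IsJost q₀ q l w t z j f) ∧
  SolvesLax δ q₀ q z (fun x t i => psi δ q₀ q l w x t z i j)

/-! ### Scattering data -/

/-- Wronskian of two columns. -/
def wronskian (f g : Fin 2 → ℂ) : ℂ := f 0 * g 1 - f 1 * g 0

/-- `γ = det Y± = 1 + q₀²/z²`. -/
def gam (q₀ : ℝ) (z : ℂ) : ℂ := 1 + (q₀ : ℂ) ^ 2 / z ^ 2

/-- The Wronskian expressions for `s₁₁, s₁₂, s₂₁, s₂₂`, formed at `(x, t)`. -/
def scatAt (δ q₀ : ℝ) (qp qm : ℂ) (q : ℝ → ℝ → ℂ) (x t : ℝ) (z : ℂ) :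
    Matrix (Fin 2) (Fin 2) ℂ :=
  let P : Fin 2 → Fin 2 → ℂ := fun j i => psi δ q₀ q atTop qp x t z i j
  let N : Fin 2 → Fin 2 → ℂ := fun j i => psi δ q₀ q atBot qm x t z i j
  !![wronskian (P 0) (N 1) / gam q₀ z, wronskian (P 1) (N 1) / gam q₀ z;
     wronskian (N 0) (P 0) / gam q₀ z, wronskian (N 0) (P 1) / gam q₀ z]

/-- The scattering matrix `S(z)`. The Wronskian expressions do not depend on `(x, t)`, which is part
of the theorem; here they are formed at `(0, 0)`. -/
def scat (δ q₀ : ℝ) (qp qm : ℂ) (q : ℝ → ℝ → ℂ) (z : ℂ) : Matrix (Fin 2) (Fin 2) ℂ :=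
  scatAt δ q₀ qp qm q 0 0 z

/-- `ρ = s₂₁ / s₁₁`. -/
def rho (δ q₀ : ℝ) (qp qm : ℂ) (q : ℝ → ℝ → ℂ) (z : ℂ) : ℂ :=
  scat δ q₀ qp qm q z 1 0 / scat δ q₀ qp qm q z 0 0

/-- `ρ̃ = s₁₂ / s₂₂`. -/
def rhoT (δ q₀ : ℝ) (qp qm : ℂ) (q : ℝ → ℝ → ℂ) (z : ℂ) : ℂ :=
  scat δ q₀ qp qm q z 0 1 / scat δ q₀ qp qm q z 1 1

/-! ### The matrices of the Riemann-Hilbert problem -/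

/-- `M⁺ = (μ₊,₁ / s₁₁, μ₋,₂)`. -/
def Mplus (δ q₀ : ℝ) (qp qm : ℂ) (q : ℝ → ℝ → ℂ) (x t : ℝ) (z : ℂ) :
    Matrix (Fin 2) (Fin 2) ℂ :=
  Matrix.of fun i => ![mu q₀ q atTop qp x t z i 0 / scat δ q₀ qp qm q z 0 0,
    mu q₀ q atBot qm x t z i 1]

/-- `M⁻ = (μ₋,₁, μ₊,₂ / s₂₂)`. -/
def Mminus (δ q₀ : ℝ) (qp qm : ℂ) (q : ℝ → ℝ → ℂ) (x t : ℝ) (z : ℂ) :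
    Matrix (Fin 2) (Fin 2) ℂ :=
  Matrix.of fun i => ![mu q₀ q atBot qm x t z i 0,
    mu q₀ q atTop qp x t z i 1 / scat δ q₀ qp qm q z 1 1]

open Classical in
/-- The sectionally meromorphic matrix on `ℂ \ Σ`: `M⁺` on `D⁺` and `M⁻` on `D⁻`. -/
def Mmat (δ q₀ : ℝ) (qp qm : ℂ) (q : ℝ → ℝ → ℂ) (x t : ℝ) (z : ℂ) :
    Matrix (Fin 2) (Fin 2) ℂ :=
  if z ∈ Dplus q₀ then Mplus δ q₀ qp qm q x t z else Mminus δ q₀ qp qm q x t z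

/-- The matrix `G` of the jump condition. -/
def Gmat (δ q₀ : ℝ) (qp qm : ℂ) (q : ℝ → ℝ → ℂ) (x t : ℝ) (z : ℂ) :
    Matrix (Fin 2) (Fin 2) ℂ :=
  !![0, -rhoT δ q₀ qp qm q z * exp (2 * I * theta δ q₀ x t z);
     rho δ q₀ qp qm q z * exp (-(2 * I * theta δ q₀ x t z)),
     rho δ q₀ qp qm q z * rhoT δ q₀ qp qm q z]

end

end SexticNLS

namespace SexticNLS

noncomputable section

/-! ### Decaying solutions of scalar linear equations on a half-line -/

/-! Everything is reduced to one model column, the first modified Jost column normalized at `+∞`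
(`IsCol`, `col`). In the basis formed by the columns of `Y` the limiting system is diagonal with
entries `0` and `-2iλ`, and the perturbation is integrable because `q - q±` is. Prescribing the
value `(1, 0)` at `+∞` gives a Volterra equation whose kernel is bounded by one exactly when `Im λ ≥
0`. In an exponential weight its operator is a contraction by one half, without any smallness
assumption. This yields existence and uniqueness (`IsVolterra.existsUnique`). The Picard iterates
converge uniformly in the spectral parameter, so the column is continuous up to `Σ'`
(`continuousOn_sol`) and holomorphic inside (`differentiableOn_sol`). The other three Jost columns
come from the model by conjugating the potential, exchanging components, reflecting `x` and negating
`z`; since `z ↦ -z` exchanges `D⁺` and `D⁻`, two of them live on `D⁺ ∪ Σ'` and two on `D⁻ ∪ Σ'`.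

The time equation follows from zero curvature, which is the sextic equation in disguise. A Jost
column at time `t` is carried to nearby times by the flow of `T`. Zero curvature preserves the
`x`-equation along that flow (`ZeroCurvature.hasDerivAt_x`). At spatial infinity `T` tends to `ω`
times the limit of `X` (`jetT_const`), so after a scalar shift it annihilates the columns of `Y` and
the normalization is preserved too (`tendsto_of_evolution`). Uniqueness of the Jost column
identifies the transported column with the Jost column itself.

Both Lax matrices have trace zero, so Wronskians of solutions are constant in `(x, t)`. As `det ψ₋ =
γ ≠ 0` on `Σ'`, Cramer's rule gives `ψ₊ = ψ₋ S`, and the jump condition is a rearrangement of this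
identity.

For `z → ∞` one integration by parts in the oscillating component gains a factor `1/λ`; this is
where integrability of `q_x` enters (`IsPotential.exists_bound_eigen`). The origin needs no estimate
of its own: the involution `z ↦ -q₀²/z` exchanges `D⁺` with `D⁻` and `0` with `∞`, and `M⁺(z) =
M⁻(-q₀²/z) (i/z) σ₃ Q₋` (`IsSolution.Mplus_eq_antipode`), so the behaviour at `0` is read off from
that at `∞`. -/

lemma hasDerivAt_integral_Ioi {E : Type*} [NormedAddCommGroup E] [NormedSpace ℝ E]
    [CompleteSpace E] {g : ℝ → E} (hg : Continuous g)
    (hi : ∀ a, IntegrableOn g (Set.Ioi a)) (x : ℝ) :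
    HasDerivAt (fun y => ∫ s in Set.Ioi y, g s) (-g x) x := by
  have h : (fun y => ∫ s in Set.Ioi y, g s)
      = fun y => (∫ s in Set.Ioi x, g s) - ∫ s in x..y, g s := by
    funext y
    rw [← intervalIntegral.integral_Ioi_sub_Ioi' (hi x) (hi y)]
    abel
  rw [h]
  simpa using (hg.integral_hasStrictDerivAt x x).hasDerivAt.const_sub (∫ s in Set.Ioi x, g s)

lemma tendsto_integral_Ioi_atTop {E : Type*} [NormedAddCommGroup E] [NormedSpace ℝ E]
    [CompleteSpace E] {g : ℝ → E} :
    Tendsto (fun y => ∫ s in Set.Ioi y, g s) atTop (𝓝 0) :=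
  tendsto_integral_Ioi_zero tendsto_id

/-- The solution of `y' = c y + g` that decays at `+∞`, for `0 ≤ Re c` and integrable `g`. -/
def decayInt (c : ℂ) (g : ℝ → ℂ) (x : ℝ) : ℂ := -∫ s in Set.Ioi x, exp (c * (x - s)) * g s

lemma norm_exp_mul_sub_le {c : ℂ} (hc : 0 ≤ c.re) {x s : ℝ} (h : x ≤ s) :
    ‖exp (c * (x - s))‖ ≤ 1 := by
  rw [Complex.norm_exp, Real.exp_le_one_iff]
  have : (c * (x - s)).re = c.re * (x - s) := by simp
  rw [this]
  exact mul_nonpos_of_nonneg_of_nonpos hc (by linarith)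

lemma norm_kernel_mul_le {c : ℂ} (hc : 0 ≤ c.re) {x s : ℝ} (h : x ≤ s) (w : ℂ) :
    ‖exp (c * (x - s)) * w‖ ≤ ‖w‖ := by
  rw [norm_mul]
  exact mul_le_of_le_one_left (norm_nonneg _) (norm_exp_mul_sub_le hc h)

lemma integrableOn_kernel_mul {c : ℂ} (hc : 0 ≤ c.re) {g : ℝ → ℂ}
    {x : ℝ} (hi : IntegrableOn g (Set.Ioi x)) :
    IntegrableOn (fun s : ℝ => exp (c * (x - s)) * g s) (Set.Ioi x) := by
  refine Integrable.mono hi ?_ ?_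
  · exact (Continuous.aestronglyMeasurable (by fun_prop)).mul hi.aestronglyMeasurable
  · exact (ae_restrict_iff' measurableSet_Ioi).2
      (Eventually.of_forall fun s hs => norm_kernel_mul_le hc (le_of_lt hs) _)

lemma norm_decayInt_le {c : ℂ} (hc : 0 ≤ c.re) {g : ℝ → ℂ} {h : ℝ → ℝ} {x : ℝ}
    (hh : IntegrableOn h (Set.Ioi x)) (hgh : ∀ s, x < s → ‖g s‖ ≤ h s) :
    ‖decayInt c g x‖ ≤ ∫ s in Set.Ioi x, h s := by
  rw [decayInt, norm_neg]
  refine norm_integral_le_of_norm_le hh ?_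
  exact (ae_restrict_iff' measurableSet_Ioi).2
    (Eventually.of_forall fun s hs => (norm_kernel_mul_le hc (le_of_lt hs) _).trans (hgh s hs))

/-- The kernel splits into a function of `x` times a function of `s`, so `decayInt` can be
differentiated by the product rule and the fundamental theorem of calculus. -/
lemma decayInt_eq (c : ℂ) (g : ℝ → ℂ) (x : ℝ) :
    decayInt c g x = -(exp (c * x) * ∫ s in Set.Ioi x, exp (-(c * s)) * g s) := by
  rw [decayInt, ← integral_const_mul]
  congr 2
  funext s
  rw [← mul_assoc, ← Complex.exp_add]
  congr 2
  ring

lemma integrableOn_exp_mul {c : ℂ} (hc : 0 ≤ c.re) {g : ℝ → ℂ}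
    {x : ℝ} (hi : IntegrableOn g (Set.Ioi x)) :
    IntegrableOn (fun s : ℝ => exp (-(c * s)) * g s) (Set.Ioi x) := by
  have := (integrableOn_kernel_mul hc hi).const_mul (exp (-(c * x)))
  refine this.congr (Eventually.of_forall fun s => ?_)
  simp only
  rw [← mul_assoc, ← Complex.exp_add]
  congr 2
  ring

lemma hasDerivAt_decayInt {c : ℂ} (hc : 0 ≤ c.re) {g : ℝ → ℂ} (hg : Continuous g)
    (hi : ∀ a, IntegrableOn g (Set.Ioi a)) (x : ℝ) :
    HasDerivAt (decayInt c g) (c * decayInt c g x + g x) x := by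
  have h1 := hasDerivAt_integral_Ioi (g := fun s : ℝ => exp (-(c * s)) * g s) (by fun_prop)
    (fun a => integrableOn_exp_mul hc (hi a)) x
  have h2 : HasDerivAt (fun y : ℝ => exp (c * y)) (exp (c * x) * (c * 1)) x :=
    ((Complex.ofRealCLM.hasDerivAt (x := x)).const_mul c).cexp
  have h3 := (h2.mul h1).neg
  have h4 : decayInt c g
      = -(fun y : ℝ => exp (c * y) * ∫ s in Set.Ioi y, exp (-(c * s)) * g s) := by
    funext y; exact decayInt_eq c g y
  rw [h4]
  refine h3.congr_deriv ?_
  have : exp (c * x) * (exp (-(c * x)) * g x) = g x := by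
    rw [← mul_assoc, ← Complex.exp_add]; simp
  simp only [Pi.neg_apply]
  linear_combination this

lemma tendsto_decayInt {c : ℂ} (hc : 0 ≤ c.re) {g : ℝ → ℂ}
    (hi : ∀ a, IntegrableOn g (Set.Ioi a)) : Tendsto (decayInt c g) atTop (𝓝 0) := by
  refine squeeze_zero_norm (fun x => norm_decayInt_le hc (hi x).norm fun s _ => le_rfl) ?_
  exact tendsto_integral_Ioi_atTop

/-- The difference of two decaying solutions, multiplied by `exp (-c x)`, is constant. For `x ≥ 0`
that factor has norm at most one, so the constant is zero. -/
lemma eq_decayInt {c : ℂ} (hc : 0 ≤ c.re) {g y : ℝ → ℂ} (hg : Continuous g)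
    (hi : ∀ a, IntegrableOn g (Set.Ioi a)) (hy : ∀ x, HasDerivAt y (c * y x + g x) x)
    (hlim : Tendsto y atTop (𝓝 0)) : y = decayInt c g := by
  set w : ℝ → ℂ := fun x => exp (-(c * x)) * (y x - decayInt c g x) with hw
  have hd : ∀ x, HasDerivAt w 0 x := fun x => by
    have h2 : HasDerivAt (fun y : ℝ => exp (-(c * y))) (exp (-(c * x)) * (-(c * 1))) x :=
      ((Complex.ofRealCLM.hasDerivAt (x := x)).const_mul c).neg.cexp
    refine (h2.mul ((hy x).sub (hasDerivAt_decayInt hc hg hi x))).congr_deriv ?_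
    simp only [Pi.sub_apply]
    ring
  have hconst : ∀ x x', w x = w x' := fun x x' =>
    is_const_of_deriv_eq_zero (fun x => (hd x).differentiableAt) (fun x => (hd x).deriv) x x'
  have hd0 : Tendsto (fun x => y x - decayInt c g x) atTop (𝓝 0) := by
    simpa using hlim.sub (tendsto_decayInt hc hi)
  have h0 : w 0 = 0 := by
    have h1 : Tendsto w atTop (𝓝 0) := by
      refine squeeze_zero_norm' ?_ (tendsto_zero_iff_norm_tendsto_zero.1 hd0)
      filter_upwards [eventually_ge_atTop 0] with x hx
      have := norm_kernel_mul_le hc hx (y x - decayInt c g x)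
      simpa [hw, mul_comm] using this
    have h2 : Tendsto w atTop (𝓝 (w 0)) := by
      rw [show w = fun _ => w 0 from funext fun x => hconst x 0]
      exact tendsto_const_nhds
    exact tendsto_nhds_unique h2 h1
  funext x
  have := (hconst x 0).trans h0
  rw [hw] at this
  simpa [sub_eq_zero] using this

/-- The integrand is the exact derivative of `-exp (2 ∫ m) / 2`. The resulting division by two is
the contraction constant of the Volterra operator. -/
lemma integral_Ioi_mul_exp {m : ℝ → ℝ} (hm : Continuous m) (hm0 : ∀ x, 0 ≤ m x)
    (hi : ∀ a, IntegrableOn m (Set.Ioi a)) (x : ℝ) :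
    IntegrableOn (fun s => m s * Real.exp (2 * ∫ r in Set.Ioi s, m r)) (Set.Ioi x) ∧
    ∫ s in Set.Ioi x, m s * Real.exp (2 * ∫ r in Set.Ioi s, m r)
      = (Real.exp (2 * ∫ r in Set.Ioi x, m r) - 1) / 2 := by
  have hd : ∀ s, HasDerivAt (fun s => -(Real.exp (2 * ∫ r in Set.Ioi s, m r)) / 2)
      (m s * Real.exp (2 * ∫ r in Set.Ioi s, m r)) s := fun s => by
    refine ((((hasDerivAt_integral_Ioi hm hi s).const_mul 2).exp).neg.div_const 2).congr_deriv ?_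
    ring
  have hl : Tendsto (fun s => -(Real.exp (2 * ∫ r in Set.Ioi s, m r)) / 2) atTop
      (𝓝 (-(1 : ℝ) / 2)) := by
    have := ((tendsto_integral_Ioi_atTop (g := m)).const_mul 2).rexp.neg.div_const 2
    simpa using this
  have hint : IntegrableOn (fun s => m s * Real.exp (2 * ∫ r in Set.Ioi s, m r)) (Set.Ioi x) :=
    integrableOn_Ioi_deriv_of_nonneg' (fun s _ => hd s)
      (fun s _ => mul_nonneg (hm0 s) (Real.exp_pos _).le) hl
  refine ⟨hint, ?_⟩
  rw [integral_Ioi_of_hasDerivAt_of_tendsto' (fun s _ => hd s) hint hl]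
  ring

/-! ### Linear systems normalized at infinity -/

/-- The system `v' = diag(d) v + R v` with `R` integrable (dominated by `m`) at `+∞`, and the data
`e` prescribed there. -/
structure IsVolterra (d e : Fin 2 → ℂ) (R : ℝ → Matrix (Fin 2) (Fin 2) ℂ) (m : ℝ → ℝ) : Prop where
  d_re : ∀ i, 0 ≤ (d i).re
  -- This makes the constant `e` a solution of the unperturbed system, so that `v - e` is a decaying
  -- solution of a scalar equation in each component.
  d_mul : ∀ i, d i * e i = 0
  cont_R : Continuous R
  cont_m : Continuous m
  m_nonneg : ∀ x, 0 ≤ m x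
  m_int : ∀ a, IntegrableOn m (Set.Ioi a)
  bound : ∀ x v, ‖R x *ᵥ v‖ ≤ m x * ‖v‖

/-- The weight in which the Volterra operator is a contraction. -/
def wt (m : ℝ → ℝ) (x : ℝ) : ℝ := Real.exp (2 * ∫ r in Set.Ioi x, m r)

/-- Continuous and bounded on right half-lines. -/
def Tame (v : ℝ → Fin 2 → ℂ) : Prop := Continuous v ∧ ∀ a, ∃ b, ∀ x, a ≤ x → ‖v x‖ ≤ b

def volterraStep (d e : Fin 2 → ℂ) (R : ℝ → Matrix (Fin 2) (Fin 2) ℂ) (v : ℝ → Fin 2 → ℂ)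
    (x : ℝ) : Fin 2 → ℂ :=
  fun i => e i + decayInt (d i) (fun s => (R s *ᵥ v s) i) x

def picardIter (d e : Fin 2 → ℂ) (R : ℝ → Matrix (Fin 2) (Fin 2) ℂ) : ℕ → ℝ → Fin 2 → ℂ
  | 0 => 0
  | n + 1 => volterraStep d e R (picardIter d e R n)

lemma one_le_wt {m : ℝ → ℝ} (hm : ∀ x, 0 ≤ m x) (x : ℝ) : 1 ≤ wt m x :=
  Real.one_le_exp (mul_nonneg zero_le_two (integral_nonneg hm))

lemma wt_anti {m : ℝ → ℝ} (hm : ∀ x, 0 ≤ m x) (hi : ∀ a, IntegrableOn m (Set.Ioi a)) :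
    Antitone (wt m) := fun a b hab => by
  refine Real.exp_le_exp.2 (mul_le_mul_of_nonneg_left ?_ zero_le_two)
  exact setIntegral_mono_set (hi a) (Eventually.of_forall hm)
    (Set.Ioi_subset_Ioi hab).eventuallyLE

namespace IsVolterra

variable {d e : Fin 2 → ℂ} {R : ℝ → Matrix (Fin 2) (Fin 2) ℂ} {m : ℝ → ℝ}

lemma continuous_mulVec (h : IsVolterra d e R m) {v : ℝ → Fin 2 → ℂ} (hv : Continuous v)
    (i : Fin 2) :
    Continuous fun s => (R s *ᵥ v s) i :=
  (continuous_apply i).comp (h.cont_R.matrix_mulVec hv)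

lemma integrableOn_mulVec (h : IsVolterra d e R m) {v : ℝ → Fin 2 → ℂ} (hv : Tame v) (i : Fin 2)
    (a : ℝ) :
    IntegrableOn (fun s => (R s *ᵥ v s) i) (Set.Ioi a) := by
  obtain ⟨b, hb⟩ := hv.2 a
  refine Integrable.mono' ((h.m_int a).mul_const b)
    (h.continuous_mulVec hv.1 i).aestronglyMeasurable ?_
  refine (ae_restrict_iff' measurableSet_Ioi).2 (Eventually.of_forall fun s hs => ?_)
  exact (norm_le_pi_norm _ i).trans ((h.bound s _).trans
    (mul_le_mul_of_nonneg_left (hb s (le_of_lt hs)) (h.m_nonneg s)))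

lemma tame_step (h : IsVolterra d e R m) {v : ℝ → Fin 2 → ℂ} (hv : Tame v) : Tame
    (volterraStep d e R v) := by
  refine ⟨continuous_pi fun i => continuous_const.add ?_, fun a => ?_⟩
  · exact continuous_iff_continuousAt.2 fun x => (hasDerivAt_decayInt (h.d_re i)
      (h.continuous_mulVec hv.1 i) (h.integrableOn_mulVec hv i) x).continuousAt
  · obtain ⟨b, hb⟩ := hv.2 a
    have hb0 : 0 ≤ b := (norm_nonneg _).trans (hb a le_rfl)
    have hI : 0 ≤ ∫ s in Set.Ioi a, m s * b := integral_nonneg fun s => mul_nonneg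
        (h.m_nonneg s) hb0
    refine ⟨‖e‖ + ∫ s in Set.Ioi a, m s * b, fun x hx => ?_⟩
    refine (pi_norm_le_iff_of_nonneg (by positivity)).2 fun i => (norm_add_le _ _).trans ?_
    refine add_le_add (norm_le_pi_norm _ i) ?_
    refine (norm_decayInt_le (h.d_re i) ((h.m_int x).mul_const b) fun s hs => ?_).trans ?_
    · exact (norm_le_pi_norm _ i).trans ((h.bound s _).trans
        (mul_le_mul_of_nonneg_left (hb s (hx.trans hs.le)) (h.m_nonneg s)))
    · exact setIntegral_mono_set ((h.m_int a).mul_const b)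
        (Eventually.of_forall fun s => mul_nonneg (h.m_nonneg s) hb0)
        (Set.Ioi_subset_Ioi hx).eventuallyLE

/-- Integrating `m * wt m` over `(x, ∞)` gives `(wt m x - 1) / 2`, so the weight produces the factor
one half however large `m` is. -/
lemma norm_step_sub_le (h : IsVolterra d e R m) {v w : ℝ → Fin 2 → ℂ} (hv : Tame v) (hw : Tame w)
    {a b : ℝ}
    (hvw : ∀ x, a ≤ x → ‖v x - w x‖ ≤ b * wt m x) (x : ℝ) (hx : a ≤ x) :
    ‖volterraStep d e R v x - volterraStep d e R w x‖ ≤ b / 2 * wt m x := by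
  have hb : 0 ≤ b := by
    by_contra hb
    have := (norm_nonneg _).trans (hvw a le_rfl)
    nlinarith [one_le_wt h.m_nonneg a]
  obtain ⟨hi, he⟩ := integral_Ioi_mul_exp h.cont_m h.m_nonneg h.m_int x
  have h0 : 0 ≤ b / 2 * wt m x := by
    have := one_le_wt h.m_nonneg x
    positivity
  refine (pi_norm_le_iff_of_nonneg h0).2 fun i => ?_
  have h1 : (volterraStep d e R v x - volterraStep d e R w x) i
      = decayInt (d i) (fun s => (R s *ᵥ (v s - w s)) i) x := by
    have h2 : ∀ s : ℝ, exp (d i * (x - s)) * (R s *ᵥ (v s - w s)) i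
        = exp (d i * (x - s)) * (R s *ᵥ v s) i - exp (d i * (x - s)) * (R s *ᵥ w s) i := fun s => by
      rw [Matrix.mulVec_sub, Pi.sub_apply, mul_sub]
    simp only [volterraStep, Pi.sub_apply, decayInt, h2]
    rw [integral_sub (integrableOn_kernel_mul (h.d_re i) (h.integrableOn_mulVec hv i x))
      (integrableOn_kernel_mul (h.d_re i) (h.integrableOn_mulVec hw i x))]
    ring
  rw [h1]
  refine (norm_decayInt_le (h.d_re i) (hi.const_mul b) fun s hs => ?_).trans ?_
  · refine (norm_le_pi_norm _ i).trans ((h.bound s _).trans ?_)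
    calc m s * ‖v s - w s‖ ≤ m s * (b * wt m s) :=
          mul_le_mul_of_nonneg_left (hvw s (hx.trans hs.le)) (h.m_nonneg s)
      _ = _ := by rw [wt]; ring
  · rw [integral_const_mul, he, wt]
    nlinarith

lemma tame_picardIter (h : IsVolterra d e R m) (n : ℕ) : Tame (picardIter d e R n) := by
  induction n with
  | zero => exact ⟨continuous_const, fun a => ⟨0, fun x _ => by simp [picardIter]⟩⟩
  | succ n ih => exact h.tame_step ih

lemma norm_picardIter_succ_sub_le (h : IsVolterra d e R m) (n : ℕ) (x : ℝ) :
    ‖picardIter d e R (n + 1) x - picardIter d e R n x‖ ≤ ‖e‖ * wt m x / 2 ^ n := by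
  suffices H : ∀ x, ‖picardIter d e R (n + 1) x - picardIter d e R n x‖ ≤ ‖e‖ / 2 ^ n * wt m x by
    convert H x using 1; ring
  induction n with
  | zero =>
    intro x
    have : picardIter d e R (0 + 1) x - picardIter d e R 0 x = e := by
      funext i
      simp [picardIter, volterraStep, decayInt]
    rw [this]
    simpa using le_mul_of_one_le_right (norm_nonneg e) (one_le_wt h.m_nonneg x)
  | succ n ih =>
    intro x
    have := h.norm_step_sub_le (h.tame_picardIter (n + 1)) (h.tame_picardIter n)
      (fun y _ => ih y) x le_rfl
    exact this.trans (le_of_eq (by ring))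

/-- Successive iterates differ by a geometric sequence with ratio one half. The explicit error bound
is kept because it involves only `e` and `m`, hence is uniform in any parameter on which `d` and `R`
depend. -/
lemma exists_fixed (h : IsVolterra d e R m) :
    ∃ v, Tame v ∧ volterraStep d e R v = v ∧
      ∀ n x, ‖picardIter d e R n x - v x‖ ≤ 2 * ‖e‖ * wt m x / 2 ^ n := by
  have hc : ∀ x, ∃ l, Tendsto (fun n => picardIter d e R n x) atTop (𝓝 l) := fun x =>
    cauchySeq_tendsto_of_complete (cauchySeq_of_le_geometric_two (C := 2 * ‖e‖ * wt m x)
      fun n => by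
        rw [dist_comm, dist_eq_norm]
        refine (h.norm_picardIter_succ_sub_le n x).trans (le_of_eq ?_)
        ring)
  choose v hv using hc
  have hd : ∀ n x, ‖picardIter d e R n x - v x‖ ≤ 2 * ‖e‖ * wt m x / 2 ^ n := fun n x => by
    have := dist_le_of_le_geometric_two_of_tendsto (C := 2 * ‖e‖ * wt m x)
      (f := fun n => picardIter d e R n x) (fun n => by
        rw [dist_comm, dist_eq_norm]
        refine (h.norm_picardIter_succ_sub_le n x).trans (le_of_eq ?_)
        ring) (hv x) n
    rwa [dist_eq_norm] at this
  have hpow : ∀ C : ℝ, Tendsto (fun n : ℕ => C / 2 ^ n) atTop (𝓝 0) := fun C =>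
    tendsto_const_nhds.div_atTop (tendsto_pow_atTop_atTop_of_one_lt one_lt_two)
  have hbd : ∀ a n x, a ≤ x → ‖picardIter d e R n x - v x‖ ≤ 2 * ‖e‖ * wt m a / 2 ^ n :=
    fun a n x hx => (hd n x).trans <| by
      have := wt_anti h.m_nonneg h.m_int hx
      gcongr
  have hT : Tame v := by
    constructor
    · refine continuous_iff_continuousAt.2 fun x => ?_
      -- The weight is decreasing, so the error bound at `x - 1` serves the whole half-line to its
      -- right.
      have hu : TendstoUniformlyOn (picardIter d e R) v atTop (Set.Ici (x - 1)) := by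
        refine Metric.tendstoUniformlyOn_iff.2 fun ε hε => ?_
        filter_upwards [(hpow (2 * ‖e‖ * wt m (x - 1))).eventually_lt_const hε] with n hn y hy
        rw [dist_comm, dist_eq_norm]
        exact (hbd (x - 1) n y hy).trans_lt hn
      exact (hu.continuousOn (Frequently.of_forall fun n =>
        (h.tame_picardIter n).1.continuousOn)).continuousAt (Ici_mem_nhds (by linarith))
    · intro a
      refine ⟨2 * ‖e‖ * wt m a, fun x hx => ?_⟩
      simpa [picardIter] using hbd a 0 x hx
  refine ⟨v, hT, ?_, hd⟩
  funext x
  have h1 : Tendsto (fun n => picardIter d e R (n + 1) x) atTop (𝓝 (volterraStep d e R v x)) := by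
    refine tendsto_iff_norm_sub_tendsto_zero.2 ?_
    refine squeeze_zero (fun n => norm_nonneg _) (fun n => ?_) (hpow (2 * ‖e‖ / 2 * wt m x))
    have := h.norm_step_sub_le (h.tame_picardIter n) hT (a := x) (b := 2 * ‖e‖ / 2 ^ n)
      (fun y _ => (hd n y).trans (le_of_eq (by ring))) x le_rfl
    refine this.trans (le_of_eq (by ring))
  exact tendsto_nhds_unique h1 ((tendsto_add_atTop_iff_nat 1).2 (hv x))

/-- Tameness bounds the difference on `[a, ∞)`, and each application of the operator halves that
bound. -/
lemma fixed_unique (h : IsVolterra d e R m) {v w : ℝ → Fin 2 → ℂ} (hv : Tame v) (hw : Tame w)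
    (hv' : volterraStep d e R v = v) (hw' : volterraStep d e R w = w) : v = w := by
  funext a
  obtain ⟨b, hb⟩ := hv.2 a
  obtain ⟨c, hc⟩ := hw.2 a
  have hbc : 0 ≤ b + c := add_nonneg ((norm_nonneg _).trans (hb a le_rfl))
    ((norm_nonneg _).trans (hc a le_rfl))
  have key : ∀ n : ℕ, ∀ x, a ≤ x → ‖v x - w x‖ ≤ (b + c) / 2 ^ n * wt m x := by
    intro n
    induction n with
    | zero =>
      intro x hx
      refine (norm_sub_le _ _).trans ((add_le_add (hb x hx) (hc x hx)).trans ?_)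
      simpa using le_mul_of_one_le_right hbc (one_le_wt h.m_nonneg x)
    | succ n ih =>
      intro x hx
      have := h.norm_step_sub_le hv hw ih x hx
      rw [hv', hw'] at this
      refine this.trans (le_of_eq (by ring))
  have h0 : ‖v a - w a‖ ≤ 0 := by
    refine ge_of_tendsto' (x := atTop) (f := fun n : ℕ => (b + c) * wt m a / 2 ^ n)
      (tendsto_const_nhds.div_atTop (tendsto_pow_atTop_atTop_of_one_lt one_lt_two)) fun n => ?_
    exact (key n a le_rfl).trans (le_of_eq (by ring))
  exact sub_eq_zero.1 (norm_le_zero_iff.1 h0)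

/-- Solutions of the system with limit `e` at `+∞`. -/
def _root_.SexticNLS.IsVolterraSol (d e : Fin 2 → ℂ) (R : ℝ → Matrix (Fin 2) (Fin 2) ℂ)
    (v : ℝ → Fin 2 → ℂ) : Prop :=
  (∀ x, HasDerivAt v (fun i => d i * v x i + (R x *ᵥ v x) i) x) ∧ Tendsto v atTop (𝓝 e)

lemma isVolterraSol_of_fixed (h : IsVolterra d e R m) {v : ℝ → Fin 2 → ℂ} (hv : Tame v)
    (hv' : volterraStep d e R v = v) :
    IsVolterraSol d e R v := by
  constructor
  · intro x
    refine hasDerivAt_pi.2 fun i => ?_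
    have h1 : (fun y => v y i) = fun y => e i + decayInt (d i) (fun s => (R s *ᵥ v s) i) y := by
      funext y
      conv_lhs => rw [← hv']
      rfl
    rw [h1]
    refine ((hasDerivAt_decayInt (h.d_re i) (h.continuous_mulVec hv.1 i)
      (h.integrableOn_mulVec hv i) x).const_add (e i)).congr_deriv ?_
    rw [congrFun h1 x]
    linear_combination -h.d_mul i
  · refine tendsto_pi_nhds.2 fun i => ?_
    rw [← hv']
    simpa [volterraStep] using (tendsto_decayInt (h.d_re i)
        (h.integrableOn_mulVec hv i)).const_add (e i)

lemma _root_.SexticNLS.IsVolterraSol.tame {v : ℝ → Fin 2 → ℂ} (hv : IsVolterraSol d e R v) :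
    Tame v := by
  have hc : Continuous v := continuous_iff_continuousAt.2 fun x => (hv.1 x).continuousAt
  refine ⟨hc, fun a => ?_⟩
  obtain ⟨N, hN⟩ := eventually_atTop.1 (hv.2.norm.eventually_le_const (lt_add_one ‖e‖))
  obtain ⟨C, hC⟩ := (isCompact_Icc (a := a) (b := N)).exists_bound_of_continuousOn hc.continuousOn
  refine ⟨max C (‖e‖ + 1), fun x hx => ?_⟩
  rcases le_total x N with hxN | hxN
  · exact (hC x ⟨hx, hxN⟩).trans (le_max_left _ _)
  · exact (hN x hxN).trans (le_max_right _ _)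

lemma fixed_of_isVolterraSol (h : IsVolterra d e R m) {v : ℝ → Fin 2 → ℂ}
    (hv : IsVolterraSol d e R v) :
    volterraStep d e R v = v := by
  have hT := hv.tame
  funext x i
  have := eq_decayInt (h.d_re i) (h.continuous_mulVec hT.1 i) (h.integrableOn_mulVec hT i)
    (y := fun x => v x i - e i) (fun x => ?_) ?_
  · rw [volterraStep, ← this]; ring
  · refine ((hasDerivAt_pi.1 (hv.1 x) i).sub_const (e i)).congr_deriv ?_
    linear_combination h.d_mul i
  · simpa using (tendsto_pi_nhds.1 hv.2 i).sub_const (e i)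

lemma existsUnique (h : IsVolterra d e R m) : ∃! v, IsVolterraSol d e R v := by
  obtain ⟨v, hv, hf, -⟩ := h.exists_fixed
  exact ⟨v, h.isVolterraSol_of_fixed hv hf, fun w hw =>
    h.fixed_unique hw.tame hv (h.fixed_of_isVolterraSol hw) hf⟩

lemma norm_picardIter_sub_le (h : IsVolterra d e R m) {v : ℝ → Fin 2 → ℂ}
    (hv : IsVolterraSol d e R v) (n : ℕ) (x : ℝ) :
    ‖picardIter d e R n x - v x‖ ≤ 2 * ‖e‖ * wt m x / 2 ^ n := by
  obtain ⟨w, hw, hf, hb⟩ := h.exists_fixed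
  rw [h.fixed_unique hv.tame hw (h.fixed_of_isVolterraSol hv) hf]
  exact hb n x

lemma norm_sol_le (h : IsVolterra d e R m) {v : ℝ → Fin 2 → ℂ} (hv : IsVolterraSol d e R v)
    (x : ℝ) :
    ‖v x‖ ≤ 2 * ‖e‖ * wt m x := by
  simpa [picardIter] using h.norm_picardIter_sub_le hv 0 x

end IsVolterra

/-! ### Dependence on the spectral parameter -/

/-- A dominated integral of holomorphic functions is holomorphic. -/
lemma differentiableOn_integral_of_dominated {α : Type*} [MeasurableSpace α] {μ : Measure α}
    {F : ℂ → α → ℂ} {U : Set ℂ} (hU : IsOpen U) {bound : α → ℝ}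
    (hm : ∀ z ∈ U, AEStronglyMeasurable (F z) μ)
    (hb : ∀ᵐ a ∂μ, ∀ z ∈ U, ‖F z a‖ ≤ bound a) (hbi : Integrable bound μ)
    (hd : ∀ᵐ a ∂μ, DifferentiableOn ℂ (fun z => F z a) U) :
    DifferentiableOn ℂ (fun z => ∫ a, F z a ∂μ) U := by
  classical
  intro z₀ hz₀
  obtain ⟨r, hr, hrU⟩ := Metric.isOpen_iff.1 hU z₀ hz₀
  have hr2 : 0 < r / 2 := by positivity
  have hr4 : 0 < r / 4 := by positivity
  have hsub : ∀ z ∈ Metric.ball z₀ (r / 2), Metric.closedBall z (r / 4) ⊆ U := by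
    intro z hz y hy
    refine hrU (Metric.mem_ball.2 ?_)
    have h1 := Metric.mem_closedBall.1 hy
    have h2 := Metric.mem_ball.1 hz
    linarith [dist_triangle y z z₀]
  refine (hasDerivAt_integral_of_dominated_loc_of_deriv_le (s := Metric.ball z₀ (r / 2))
    (F' := fun z a => deriv (fun y => F y a) z) (bound := fun a => bound a / (r / 4))
    (Metric.ball_mem_nhds _ hr2) ?_ ?_ ?_ ?_ (hbi.div_const _)
    ?_).2.differentiableAt.differentiableWithinAt
  · filter_upwards [hU.mem_nhds hz₀] with z hz using hm z hz
  · exact hbi.mono' (hm z₀ hz₀) (hb.mono fun a ha => ha z₀ hz₀)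
  -- The `z`-derivative is measurable in `a` as a limit of difference quotients; they are set to
  -- zero outside `U`, where measurability of `F z` is not known.
  · refine aestronglyMeasurable_of_tendsto_ae (𝓝[≠] z₀)
      (f := fun z a => if z ∈ U then slope (fun y => F y a) z₀ z else 0) (fun z => ?_) ?_
    · by_cases hz : z ∈ U
      · simp only [hz, if_true, slope, vsub_eq_sub]
        exact AEStronglyMeasurable.const_smul ((hm z hz).sub (hm z₀ hz₀)) ((z - z₀)⁻¹)
      · simp only [hz, if_false]
        exact aestronglyMeasurable_const
    · filter_upwards [hd] with a ha
      refine ((ha.differentiableAt (hU.mem_nhds hz₀)).hasDerivAt.tendsto_slope).congr' ?_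
      filter_upwards [mem_nhdsWithin_of_mem_nhds (hU.mem_nhds hz₀)] with z hz
      rw [if_pos hz]
  · filter_upwards [hb, hd] with a ha hda z hz
    -- Cauchy's estimate on a circle of radius `r / 4` turns the bound on `F` into one on its
    -- derivative.
    refine Complex.norm_deriv_le_of_forall_mem_sphere_norm_le hr4 ?_ fun y hy =>
      ha y (hsub z hz (Metric.sphere_subset_closedBall hy))
    refine DifferentiableOn.diffContOnCl ?_
    rw [closure_ball _ hr4.ne']
    exact hda.mono (hsub z hz)
  · filter_upwards [hd] with a ha z hz
    exact (ha.differentiableAt (hU.mem_nhds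
      (hsub z hz (Metric.mem_closedBall_self hr4.le)))).hasDerivAt

section Parameter

variable {Ω : Set ℂ} {d : ℂ → Fin 2 → ℂ} {e : Fin 2 → ℂ} {R : ℂ → ℝ → Matrix (Fin 2) (Fin 2) ℂ}
  {m : ℝ → ℝ} {v : ℂ → ℝ → Fin 2 → ℂ}

lemma norm_picardIter_le (h : ∀ z ∈ Ω, IsVolterra (d z) e (R z) m) {z : ℂ} (hz : z ∈ Ω) (n : ℕ)
    (x : ℝ) : ‖picardIter (d z) e (R z) n x‖ ≤ 4 * ‖e‖ * wt m x := by
  obtain ⟨v, hv, -⟩ := (h z hz).existsUnique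
  have h1 := (h z hz).norm_picardIter_sub_le hv n x
  have h2 := (h z hz).norm_sol_le hv x
  have h3 : 2 * ‖e‖ * wt m x / 2 ^ n ≤ 2 * ‖e‖ * wt m x := by
    refine div_le_self ?_ (one_le_pow₀ one_le_two)
    exact mul_nonneg (by positivity) (Real.exp_pos _).le
  calc _ = ‖(picardIter (d z) e (R z) n x - v x) + v x‖ := by rw [sub_add_cancel]
    _ ≤ _ := norm_add_le _ _
    _ ≤ _ := by linarith

lemma norm_mulVec_picardIter_le (h : ∀ z ∈ Ω, IsVolterra (d z) e (R z) m) {z : ℂ} (hz : z ∈ Ω)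
    (n : ℕ) (x : ℝ) (i : Fin 2) :
    ‖(R z x *ᵥ picardIter (d z) e (R z) n x) i‖ ≤ m x * wt m x * (4 * ‖e‖) := by
  refine (norm_le_pi_norm _ i).trans (((h z hz).bound x _).trans ?_)
  rw [mul_assoc]
  refine mul_le_mul_of_nonneg_left ?_ ((h z hz).m_nonneg x)
  rw [mul_comm (wt m x)]
  exact norm_picardIter_le h hz n x

lemma tendstoUniformlyOn_picardIter (h : ∀ z ∈ Ω, IsVolterra (d z) e (R z) m)
    (hv : ∀ z ∈ Ω, IsVolterraSol (d z) e (R z) (v z)) (x : ℝ) (i : Fin 2) :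
    TendstoUniformlyOn (fun n z => picardIter (d z) e (R z) n x i) (fun z => v z x i) atTop Ω := by
  refine Metric.tendstoUniformlyOn_iff.2 fun ε hε => ?_
  have hpow : Tendsto (fun n : ℕ => 2 * ‖e‖ * wt m x / 2 ^ n) atTop (𝓝 0) :=
    tendsto_const_nhds.div_atTop (tendsto_pow_atTop_atTop_of_one_lt one_lt_two)
  filter_upwards [hpow.eventually_lt_const hε] with n hn z hz
  rw [dist_comm, dist_eq_norm]
  exact ((norm_le_pi_norm (picardIter (d z) e (R z) n x - v z x) i).trans
    ((h z hz).norm_picardIter_sub_le (hv z hz) n x)).trans_lt hn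

/-- All parameters in `Ω` share `m` and `e`, so the Picard iterates converge uniformly on `Ω`; each
iterate is continuous by dominated convergence. -/
lemma continuousOn_sol (h : ∀ z ∈ Ω, IsVolterra (d z) e (R z) m)
    (hv : ∀ z ∈ Ω, IsVolterraSol (d z) e (R z) (v z))
    (hd : ∀ i, ContinuousOn (fun z => d z i) Ω)
    (hR : ∀ x i j, ContinuousOn (fun z => R z x i j) Ω) (x : ℝ) (i : Fin 2) :
    ContinuousOn (fun z => v z x i) Ω := by
  rcases Ω.eq_empty_or_nonempty with rfl | ⟨z₀, hz₀⟩
  · exact continuousOn_empty _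
  have h₀ := h z₀ hz₀
  refine (tendstoUniformlyOn_picardIter h hv x i).continuousOn (Frequently.of_forall fun n => ?_)
  induction n generalizing x i with
  | zero => exact continuousOn_const
  | succ n ih =>
    refine continuousOn_const.add (ContinuousOn.neg ?_)
    refine continuousOn_of_dominated (bound := fun s => m s * wt m s * (4 * ‖e‖)) ?_ ?_
      ((integral_Ioi_mul_exp h₀.cont_m h₀.m_nonneg h₀.m_int x).1.mul_const _) ?_
    · intro z hz
      refine Continuous.aestronglyMeasurable (Continuous.mul (by fun_prop) ?_)
      exact (h z hz).continuous_mulVec ((h z hz).tame_picardIter n).1 i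
    · intro z hz
      refine (ae_restrict_iff' measurableSet_Ioi).2 (Eventually.of_forall fun s hs => ?_)
      exact (norm_kernel_mul_le ((h z hz).d_re i) (le_of_lt hs) _).trans
        (norm_mulVec_picardIter_le h hz n s i)
    · refine Eventually.of_forall fun s => ContinuousOn.mul ((hd i).mul continuousOn_const).cexp ?_
      simp only [Matrix.mulVec, dotProduct]
      exact continuousOn_finsetSum _ fun j _ => (hR s i j).mul (ih s j)

/-- Same scheme as for continuity, with the holomorphy of dominated integrals for the iterates and
Weierstrass's theorem for their limit. -/
lemma differentiableOn_sol (hΩ : IsOpen Ω) (h : ∀ z ∈ Ω, IsVolterra (d z) e (R z) m)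
    (hv : ∀ z ∈ Ω, IsVolterraSol (d z) e (R z) (v z))
    (hd : ∀ i, DifferentiableOn ℂ (fun z => d z i) Ω)
    (hR : ∀ x i j, DifferentiableOn ℂ (fun z => R z x i j) Ω) (x : ℝ) (i : Fin 2) :
    DifferentiableOn ℂ (fun z => v z x i) Ω := by
  rcases Ω.eq_empty_or_nonempty with rfl | ⟨z₀, hz₀⟩
  · exact differentiableOn_empty
  have h₀ := h z₀ hz₀
  refine (tendstoUniformlyOn_picardIter h hv x i).tendstoLocallyUniformlyOn.differentiableOn
    (Eventually.of_forall fun n => ?_) hΩ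
  induction n generalizing x i with
  | zero => exact differentiableOn_const _
  | succ n ih =>
    refine (differentiableOn_const _).add (DifferentiableOn.neg ?_)
    refine differentiableOn_integral_of_dominated hΩ
      (bound := fun s => m s * wt m s * (4 * ‖e‖)) ?_ ?_
      ((integral_Ioi_mul_exp h₀.cont_m h₀.m_nonneg h₀.m_int x).1.mul_const _) ?_
    · intro z hz
      refine Continuous.aestronglyMeasurable (Continuous.mul (by fun_prop) ?_)
      exact (h z hz).continuous_mulVec ((h z hz).tame_picardIter n).1 i
    · refine (ae_restrict_iff' measurableSet_Ioi).2 (Eventually.of_forall fun s hs z hz => ?_)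
      exact (norm_kernel_mul_le ((h z hz).d_re i) (le_of_lt hs) _).trans
        (norm_mulVec_picardIter_le h hz n s i)
    · refine Eventually.of_forall fun s =>
        DifferentiableOn.mul ((hd i).mul (differentiableOn_const _)).cexp ?_
      simp only [Matrix.mulVec, dotProduct]
      exact DifferentiableOn.fun_sum fun j _ => (hR s i j).mul (ih s j)

end Parameter

/-! ### Linear ordinary differential equations -/

lemma norm_mulVec_le_of_entries {M : Matrix (Fin 2) (Fin 2) ℂ} {c : ℝ}
    (hM : ∀ i j, ‖M i j‖ ≤ c) (v : Fin 2 → ℂ) : ‖M *ᵥ v‖ ≤ 2 * c * ‖v‖ := by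
  have hc : 0 ≤ c := (norm_nonneg _).trans (hM 0 0)
  refine (pi_norm_le_iff_of_nonneg (by positivity)).2 fun i => ?_
  rw [Matrix.mulVec, dotProduct, Fin.sum_univ_two]
  refine (norm_add_le _ _).trans ?_
  rw [norm_mul, norm_mul]
  have h0 := mul_le_mul (hM i 0) (norm_le_pi_norm v 0) (norm_nonneg _) hc
  have h1 := mul_le_mul (hM i 1) (norm_le_pi_norm v 1) (norm_nonneg _) hc
  linarith

lemma hasDerivAt_mulVec {M : ℝ → Matrix (Fin 2) (Fin 2) ℂ} {M' : Matrix (Fin 2) (Fin 2) ℂ}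
    {v : ℝ → Fin 2 → ℂ} {v' : Fin 2 → ℂ} {t : ℝ}
    (hM : ∀ i j, HasDerivAt (fun s => M s i j) (M' i j) t) (hv : HasDerivAt v v' t) :
    HasDerivAt (fun s => M s *ᵥ v s) (M' *ᵥ v t + M t *ᵥ v') t := by
  refine hasDerivAt_pi.2 fun i => ?_
  have hv' := hasDerivAt_pi.1 hv
  simp only [Matrix.mulVec, dotProduct, Fin.sum_univ_two, Pi.add_apply]
  refine (((hM i 0).mul (hv' 0)).add ((hM i 1).mul (hv' 1))).congr_deriv ?_
  ring

lemma gronwallBound_le {δ K ε x : ℝ} (hK : 1 ≤ K) (hδ : 0 ≤ δ) (hε : 0 ≤ ε) (hx : x ≤ 1) :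
    gronwallBound δ K ε x ≤ (δ + ε) * Real.exp K := by
  rw [gronwallBound_of_K_ne_0 (by positivity)]
  have h1 : Real.exp (K * x) ≤ Real.exp K := Real.exp_le_exp.2 (by nlinarith)
  have h2 : ε / K ≤ ε := div_le_self hε hK
  have h3 : 0 ≤ ε / K := by positivity
  have h4 := Real.exp_pos (K * x)
  calc δ * Real.exp (K * x) + ε / K * (Real.exp (K * x) - 1)
      ≤ δ * Real.exp K + ε / K * Real.exp K := by nlinarith
    _ ≤ _ := by nlinarith [Real.exp_pos K]

/-- Grönwall's inequality on an interval of length at most one, in either direction. -/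
lemma norm_le_of_gronwall {E : Type*} [NormedAddCommGroup E] [NormedSpace ℝ E] {f f' : ℝ → E}
    {K δ ε t₀ t₁ : ℝ} (hK : 1 ≤ K) (hε : 0 ≤ ε) (ht : |t₁ - t₀| ≤ 1)
    (hd : ∀ t ∈ Set.uIcc t₀ t₁, HasDerivAt f (f' t) t)
    (hb : ∀ t ∈ Set.uIcc t₀ t₁, ‖f' t‖ ≤ K * ‖f t‖ + ε) (h₀ : ‖f t₀‖ ≤ δ) :
    ‖f t₁‖ ≤ (δ + ε) * Real.exp K := by
  have hδ : 0 ≤ δ := (norm_nonneg _).trans h₀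
  rcases le_total t₀ t₁ with h | h
  · rw [Set.uIcc_of_le h] at hd hb
    have := norm_le_gronwallBound_of_norm_deriv_right_le (f := f) (f' := f') (δ := δ) (K := K)
      (ε := ε) (a := t₀) (b := t₁) (fun t ht => (hd t ht).continuousAt.continuousWithinAt)
      (fun t ht => (hd t (Set.Ico_subset_Icc_self ht)).hasDerivWithinAt) h₀
      (fun t ht => hb t (Set.Ico_subset_Icc_self ht)) t₁ ⟨h, le_rfl⟩
    exact this.trans (gronwallBound_le hK hδ hε ((le_abs_self _).trans ht))
  · rw [Set.uIcc_of_ge h] at hd hb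
    -- The backward direction is the forward one for the reflected function `s ↦ f (-s)`.
    have hmem : ∀ t ∈ Set.Icc (-t₀) (-t₁), -t ∈ Set.Icc t₁ t₀ := fun t ht =>
      ⟨by linarith [ht.2], by linarith [ht.1]⟩
    have hd' : ∀ t ∈ Set.Icc (-t₀) (-t₁), HasDerivAt (fun s => f (-s)) (-f' (-t)) t :=
      fun t ht => by
        exact ((hd _ (hmem t ht)).scomp t (hasDerivAt_neg t)).congr_deriv (by simp)
    have := norm_le_gronwallBound_of_norm_deriv_right_le (f := fun s => f (-s))
      (f' := fun s => -f' (-s)) (δ := δ) (K := K)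
      (ε := ε) (a := -t₀) (b := -t₁) (fun t ht => (hd' t ht).continuousAt.continuousWithinAt)
      (fun t ht => (hd' t (Set.Ico_subset_Icc_self ht)).hasDerivWithinAt) (by simpa using h₀)
      (fun t ht => by simpa using hb _ (hmem t (Set.Ico_subset_Icc_self ht)))
      (-t₁) ⟨by linarith, le_rfl⟩
    rw [neg_neg] at this
    refine this.trans (gronwallBound_le hK hδ hε ?_)
    rw [abs_sub_comm] at ht
    linarith [le_abs_self (t₀ - t₁)]

/-- The Volterra theory also solves the initial value problem. A cutoff equal to `1` up to `t₀ + 1`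
and to `0` from `t₀ + 2` on makes the coefficient integrable at `+∞`, so solutions are parametrized
by their limit there. The linear map from this limit to the value at `t₀` is injective, since a
solution vanishing at `t₀` vanishes afterwards; in finite dimension it is therefore surjective. -/
lemma exists_linear_sol {A : ℝ → Matrix (Fin 2) (Fin 2) ℂ} (hA : Continuous A) (t₀ : ℝ)
    (y₀ : Fin 2 → ℂ) :
    ∃ y : ℝ → Fin 2 → ℂ, y t₀ = y₀ ∧ ∀ t < t₀ + 1, HasDerivAt y (A t *ᵥ y t) t := by
  set φ : ℝ → ℝ := fun s => max 0 (min 1 (t₀ + 2 - s)) with hφ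
  have hφc : Continuous φ := by fun_prop
  have hφ0 : ∀ s, 0 ≤ φ s := fun s => le_max_left _ _
  set R : ℝ → Matrix (Fin 2) (Fin 2) ℂ := fun s => (φ s : ℂ) • A s with hR
  set m : ℝ → ℝ := fun s => 2 * (φ s * ∑ i, ∑ j, ‖A s i j‖) with hm
  have hentry : ∀ i j, Continuous fun s => A s i j := fun i j => hA.matrix_elem i j
  have hmc : Continuous m := by
    refine continuous_const.mul (hφc.mul (continuous_finsetSum _ fun i _ =>
      continuous_finsetSum _ fun j _ => (hentry i j).norm))
  have hV : ∀ e, IsVolterra 0 e R m := fun e =>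
    { d_re := fun i => by simp
      d_mul := fun i => by simp
      cont_R := (continuous_ofReal.comp hφc).smul hA
      cont_m := hmc
      m_nonneg := fun x => mul_nonneg zero_le_two (mul_nonneg (hφ0 x)
        (Finset.sum_nonneg fun i _ => Finset.sum_nonneg fun j _ => norm_nonneg _))
      m_int := fun a => by
        refine IntegrableOn.of_forall_sdiff_eq_zero (s := Set.Icc a (t₀ + 2))
          hmc.continuousOn.integrableOn_Icc measurableSet_Ioi fun x hx => ?_
        have : t₀ + 2 < x := by
          by_contra hcon
          exact hx.2 ⟨le_of_lt hx.1, not_lt.1 hcon⟩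
        have h0 : φ x = 0 := max_eq_left ((min_le_right _ _).trans (by linarith))
        simp [hm, h0]
      bound := fun x v => norm_mulVec_le_of_entries (fun i j => by
        simp only [hR, Matrix.smul_apply, norm_smul, Complex.norm_real,
          Real.norm_of_nonneg (hφ0 x)]
        refine mul_le_mul_of_nonneg_left ?_ (hφ0 x)
        refine (Finset.single_le_sum (f := fun j => ‖A x i j‖) (fun j _ => norm_nonneg _)
          (Finset.mem_univ j)).trans ?_
        exact Finset.single_le_sum (f := fun i => ∑ j, ‖A x i j‖)
          (fun i _ => Finset.sum_nonneg fun j _ => norm_nonneg _) (Finset.mem_univ i)) v }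
  choose v hv using fun e => (hV e).existsUnique.exists
  have hvd : ∀ e x, HasDerivAt (v e) (R x *ᵥ v e x) x := fun e x => by
    refine ((hv e).1 x).congr_deriv ?_
    funext i; simp
  set L : (Fin 2 → ℂ) →ₗ[ℂ] (Fin 2 → ℂ) :=
    (LinearMap.proj 0).smulRight (v (Pi.single 0 1) t₀)
      + (LinearMap.proj 1).smulRight (v (Pi.single 1 1) t₀) with hL
  set w : (Fin 2 → ℂ) → ℝ → Fin 2 → ℂ := fun c x =>
    c 0 • v (Pi.single 0 1) x + c 1 • v (Pi.single 1 1) x with hw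
  have hwd : ∀ c x, HasDerivAt (w c) (R x *ᵥ w c x) x := fun c x => by
    refine (((hvd _ x).const_smul (c 0)).add ((hvd _ x).const_smul (c 1))).congr_deriv ?_
    simp [hw, Matrix.mulVec_add, Matrix.mulVec_smul]
  have hwl : ∀ c, Tendsto (w c) atTop (𝓝 c) := fun c => by
    have := ((hv (Pi.single 0 1)).2.const_smul (c 0)).add ((hv (Pi.single 1 1)).2.const_smul (c 1))
    convert this using 2
    funext i
    fin_cases i <;> simp
  have hinj : Function.Injective L := by
    refine (injective_iff_map_eq_zero L).2 fun c hc => ?_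
    have h0 : w c t₀ = 0 := by simpa [hL, hw] using hc
    have hz : ∀ x, t₀ ≤ x → w c x = 0 := fun x hx => by
      obtain ⟨K, hK⟩ := (isCompact_Icc (a := t₀) (b := x)).exists_bound_of_continuousOn
        hmc.continuousOn
      refine eq_zero_of_abs_deriv_le_mul_abs_self_of_eq_zero_right (K := K)
        (fun t _ => (hwd c t).continuousAt.continuousWithinAt)
        (fun t _ => (hwd c t).hasDerivWithinAt) h0 (fun t ht => ?_) x ⟨hx, le_rfl⟩
      refine ((hV 0).bound t _).trans (mul_le_mul_of_nonneg_right ?_ (norm_nonneg _))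
      exact (le_abs_self _).trans (hK t (Set.Ico_subset_Icc_self ht))
    refine tendsto_nhds_unique (hwl c) (tendsto_const_nhds.congr' ?_)
    filter_upwards [eventually_ge_atTop t₀] with x hx using (hz x hx).symm
  obtain ⟨c, hc⟩ := (LinearMap.injective_iff_surjective.1 hinj) y₀
  refine ⟨w c, by simpa [hL, hw] using hc, fun t ht => ?_⟩
  have h1 : φ t = 1 := by
    have h2 : min 1 (t₀ + 2 - t) = 1 := min_eq_left (by linarith)
    simp only [hφ]
    rw [h2]
    exact max_eq_right zero_le_one
  have := hwd c t
  simpa only [hR, h1, Complex.ofReal_one, one_smul] using this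

/-! ### Compatible linear systems -/

lemma eventually_forall_dist_lt {E : Type*} [NormedAddCommGroup E] {f : ℝ → ℝ → E}
    (hf : Continuous fun p : ℝ × ℝ => f p.1 p.2) {K : Set ℝ} (hK : IsCompact K) (x : ℝ)
    {ε : ℝ} (hε : 0 < ε) : ∀ᶠ y in 𝓝 x, ∀ t ∈ K, ‖f y t - f x t‖ < ε := by
  refine hK.eventually_forall_of_forall_eventually fun t _ => ?_
  have hc : Continuous fun p : ℝ × ℝ => ‖f p.1 p.2 - f x p.2‖ :=
    (hf.sub (hf.comp (continuous_const.prodMk continuous_snd))).norm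
  refine hc.continuousAt.eventually_lt continuousAt_const ?_
  simpa using hε

/-- Differentiability in `x`, uniformly in `t` on compact sets. -/
lemma eventually_forall_taylor {B B' : ℝ → ℝ → ℂ}
    (hB : ∀ x t, HasDerivAt (fun y => B y t) (B' x t) x)
    (hB' : Continuous fun p : ℝ × ℝ => B' p.1 p.2) {K : Set ℝ} (hK : IsCompact K) (x : ℝ)
    {ε : ℝ} (hε : 0 < ε) :
    ∀ᶠ h in 𝓝 (0 : ℝ), ∀ t ∈ K, ‖B (x + h) t - B x t - h * B' x t‖ ≤ ε * |h| := by
  obtain ⟨r, hr, hball⟩ := Metric.eventually_nhds_iff_ball.1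
    (eventually_forall_dist_lt hB' hK x hε)
  filter_upwards [Metric.ball_mem_nhds (0 : ℝ) hr] with h hh t ht
  have key := (convex_ball x r).norm_image_sub_le_of_norm_hasDerivWithin_le
    (f := fun y => B y t - (y : ℂ) * B' x t) (f' := fun y => B' y t - B' x t) (C := ε)
    (x := x) (y := x + h) (fun y _ => ?_) (fun y hy => (hball y hy t ht).le)
    (Metric.mem_ball_self hr) (by simpa using hh)
  · have e1 : B (x + h) t - B x t - h * B' x t
        = B (x + h) t - ((x + h : ℝ) : ℂ) * B' x t - (B x t - (x : ℂ) * B' x t) := by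
      push_cast; ring
    rw [e1]
    simpa using key
  · refine HasDerivAt.hasDerivWithinAt ?_
    exact ((hB y t).sub ((Complex.ofRealCLM.hasDerivAt (x := y)).mul_const
      (B' x t))).congr_deriv (by simp)

/-- The systems `φₓ = X φ`, `φₜ = T φ` with the zero curvature condition
`Xₜ - Tₓ + [X, T] = 0`. -/
structure ZeroCurvature (X T Xt Tx : ℝ → ℝ → Matrix (Fin 2) (Fin 2) ℂ) : Prop where
  deriv_X : ∀ x t i j, HasDerivAt (fun s => X x s i j) (Xt x t i j) t
  deriv_T : ∀ x t i j, HasDerivAt (fun y => T y t i j) (Tx x t i j) x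
  cont_X : ∀ i j, Continuous fun p : ℝ × ℝ => X p.1 p.2 i j
  cont_T : ∀ i j, Continuous fun p : ℝ × ℝ => T p.1 p.2 i j
  cont_Tx : ∀ i j, Continuous fun p : ℝ × ℝ => Tx p.1 p.2 i j
  zero : ∀ x t, Xt x t - Tx x t + X x t * T x t - T x t * X x t = 0

namespace ZeroCurvature

variable {X T Xt Tx : ℝ → ℝ → Matrix (Fin 2) (Fin 2) ℂ}

/-- If `g` solves the `t`-equation near `t₀` and the `x`-equation at `t₀`, then it solves the
`x`-equation at all nearby times. -/
lemma hasDerivAt_x (H : ZeroCurvature X T Xt Tx) {g : ℝ → ℝ → Fin 2 → ℂ} {t₀ t₁ : ℝ}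
    (ht₁ : |t₁ - t₀| ≤ 1)
    (hgt : ∀ x, ∀ t ∈ Set.uIcc t₀ t₁, HasDerivAt (g x) (T x t *ᵥ g x t) t)
    (hgx : ∀ x, HasDerivAt (fun y => g y t₀) (X x t₀ *ᵥ g x t₀) x) (x : ℝ) :
    HasDerivAt (fun y => g y t₁) (X x t₁ *ᵥ g x t₁) x := by
  have hI : IsCompact (Set.uIcc t₀ t₁) := isCompact_uIcc
  have hIcont : ∀ F : ℝ → ℝ → ℂ, (Continuous fun p : ℝ × ℝ => F p.1 p.2) →
      ∃ C, ∀ t ∈ Set.uIcc t₀ t₁, ‖F x t‖ ≤ C := fun F hF =>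
    hI.exists_bound_of_continuousOn (f := fun t => F x t)
      (hF.comp (continuous_const.prodMk continuous_id)).continuousOn
  obtain ⟨G, hG⟩ := hI.exists_bound_of_continuousOn (f := g x)
    fun t ht => (hgt x t ht).continuousAt.continuousWithinAt
  choose CX hCX using fun i j => hIcont (fun y t => X y t i j) (H.cont_X i j)
  choose CT hCT using fun i j => hIcont (fun y t => T y t i j) (H.cont_T i j)
  obtain ⟨CX', hCX'⟩ : ∃ C, ∀ t ∈ Set.uIcc t₀ t₁, ∀ i j, ‖X x t i j‖ ≤ C :=
    ⟨∑ i, ∑ j, |CX i j|, fun t ht i j => ((hCX i j t ht).trans (le_abs_self _)).trans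
      ((Finset.single_le_sum (f := fun j => |CX i j|) (fun j _ => abs_nonneg _)
        (Finset.mem_univ j)).trans (Finset.single_le_sum (f := fun i => ∑ j, |CX i j|)
        (fun i _ => Finset.sum_nonneg fun j _ => abs_nonneg _) (Finset.mem_univ i)))⟩
  obtain ⟨CT', hCT'⟩ : ∃ C, ∀ t ∈ Set.uIcc t₀ t₁, ∀ i j, ‖T x t i j‖ ≤ C :=
    ⟨∑ i, ∑ j, |CT i j|, fun t ht i j => ((hCT i j t ht).trans (le_abs_self _)).trans
      ((Finset.single_le_sum (f := fun j => |CT i j|) (fun j _ => abs_nonneg _)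
        (Finset.mem_univ j)).trans (Finset.single_le_sum (f := fun i => ∑ j, |CT i j|)
        (fun i _ => Finset.sum_nonneg fun j _ => abs_nonneg _) (Finset.mem_univ i)))⟩
  have hG0 : 0 ≤ G := (norm_nonneg _).trans (hG t₀ Set.left_mem_uIcc)
  have hCX0 : 0 ≤ CX' := (norm_nonneg _).trans (hCX' t₀ Set.left_mem_uIcc 0 0)
  have hCT0 : 0 ≤ CT' := (norm_nonneg _).trans (hCT' t₀ Set.left_mem_uIcc 0 0)
  set K : ℝ := 2 * (CT' + 1) with hKdef
  have hK : 1 ≤ K := by linarith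
  -- `A` collects the initial error, the size of the source term and the Grönwall growth, each in
  -- units of `ε |h|`; `ε` is then chosen so that `ε * A ≤ c`.
  set A : ℝ := (1 + (2 * G + 4 * CX' * G)) * Real.exp K with hA
  have hA0 : 0 < A := by positivity
  rw [hasDerivAt_iff_isLittleO_nhds_zero, isLittleO_iff]
  intro c hc
  set ε : ℝ := min 1 (c / A) with hεdef
  have hε : 0 < ε := lt_min one_pos (by positivity)
  have hadd : Tendsto (fun h : ℝ => x + h) (𝓝 0) (𝓝 x) := by
    simpa using (continuous_const.add continuous_id).tendsto (x := (0 : ℝ))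
        (f := fun h : ℝ => x + h)
  have e1 : ∀ᶠ h in 𝓝 (0 : ℝ), ∀ i j, ∀ t ∈ Set.uIcc t₀ t₁,
      ‖T (x + h) t i j - T x t i j - h * Tx x t i j‖ ≤ ε * |h| :=
    eventually_all.2 fun i => eventually_all.2 fun j =>
      eventually_forall_taylor (B := fun y t => T y t i j) (B' := fun y t => Tx y t i j)
        (fun x t => H.deriv_T x t i j) (H.cont_Tx i j) hI x hε
  have e2 : ∀ᶠ h in 𝓝 (0 : ℝ), ∀ i j, ∀ t ∈ Set.uIcc t₀ t₁,
      ‖T (x + h) t i j - T x t i j‖ < ε :=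
    eventually_all.2 fun i => eventually_all.2 fun j =>
      hadd.eventually (eventually_forall_dist_lt (f := fun y t => T y t i j) (H.cont_T i j) hI x hε)
  have e3 := (isLittleO_iff.1 (hasDerivAt_iff_isLittleO_nhds_zero.1 (hgx x))) hε
  filter_upwards [e1, e2, e3] with h h1 h2 h3
  -- `D` is the first-order remainder in `x`. Zero curvature cancels the leading terms, so `D`
  -- solves the `t`-equation at `x + h` with a source of size `o(h)`, and Grönwall carries the
  -- smallness from `t₀` to `t₁`.
  set D : ℝ → Fin 2 → ℂ := fun t => g (x + h) t - g x t - (h : ℂ) • (X x t *ᵥ g x t) with hD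
  have hsmul : ∀ u : Fin 2 → ℂ, (h : ℂ) • u = h • u := fun u => by
    funext i; simp
  have hD0 : ‖D t₀‖ ≤ ε * |h| := by
    simpa only [hD, hsmul, Real.norm_eq_abs] using h3
  have hDd : ∀ t ∈ Set.uIcc t₀ t₁, HasDerivAt D (T (x + h) t *ᵥ D t
      + ((T (x + h) t - T x t - (h : ℂ) • Tx x t) *ᵥ g x t
        + (h : ℂ) • ((T (x + h) t - T x t) *ᵥ (X x t *ᵥ g x t)))) t := fun t ht => by
    refine (((hgt (x + h) t ht).sub (hgt x t ht)).sub
      ((hasDerivAt_mulVec (fun i j => H.deriv_X x t i j) (hgt x t ht)).const_smul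
        (h : ℂ))).congr_deriv ?_
    have hz := H.zero x t
    have hz' : Xt x t = Tx x t - X x t * T x t + T x t * X x t := by
      rw [← sub_eq_zero, ← hz]; abel
    rw [hz']
    simp only [hD, Matrix.add_mulVec, Matrix.sub_mulVec, Matrix.mulVec_sub, Matrix.sub_mul,
      Matrix.smul_mulVec, Matrix.mulVec_smul, Matrix.mulVec_mulVec, smul_add, smul_sub]
    abel
  have hDb : ∀ t ∈ Set.uIcc t₀ t₁, ‖T (x + h) t *ᵥ D t
      + ((T (x + h) t - T x t - (h : ℂ) • Tx x t) *ᵥ g x t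
        + (h : ℂ) • ((T (x + h) t - T x t) *ᵥ (X x t *ᵥ g x t)))‖
      ≤ K * ‖D t‖ + (2 * G + 4 * CX' * G) * (ε * |h|) := fun t ht => by
    have b1 : ‖T (x + h) t *ᵥ D t‖ ≤ K * ‖D t‖ := by
      refine norm_mulVec_le_of_entries (fun i j => ?_) _
      calc ‖T (x + h) t i j‖ = ‖T x t i j + (T (x + h) t i j - T x t i j)‖ := by
            rw [add_sub_cancel]
        _ ≤ _ := norm_add_le _ _
        _ ≤ CT' + 1 := add_le_add (hCT' t ht i j) ((h2 i j t ht).le.trans (min_le_left _ _))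
    have b2 : ‖(T (x + h) t - T x t - (h : ℂ) • Tx x t) *ᵥ g x t‖ ≤ 2 * (ε * |h|) * G := by
      refine (norm_mulVec_le_of_entries (c := ε * |h|) (fun i j => ?_) _).trans ?_
      · simpa using h1 i j t ht
      · exact mul_le_mul_of_nonneg_left (hG t ht) (by positivity)
    have b3 : ‖(T (x + h) t - T x t) *ᵥ (X x t *ᵥ g x t)‖ ≤ 2 * ε * (2 * CX' * G) := by
      refine (norm_mulVec_le_of_entries (c := ε) (fun i j => ?_) _).trans ?_
      · simpa using (h2 i j t ht).le
      · refine mul_le_mul_of_nonneg_left ?_ (by positivity)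
        refine (norm_mulVec_le_of_entries (hCX' t ht) _).trans ?_
        exact mul_le_mul_of_nonneg_left (hG t ht) (by positivity)
    have b4 : ‖(h : ℂ) • ((T (x + h) t - T x t) *ᵥ (X x t *ᵥ g x t))‖
        ≤ |h| * (2 * ε * (2 * CX' * G)) := by
      rw [norm_smul, Complex.norm_real, Real.norm_eq_abs]
      exact mul_le_mul_of_nonneg_left b3 (abs_nonneg _)
    refine (norm_add_le _ _).trans ((add_le_add b1 ((norm_add_le _ _).trans
      (add_le_add b2 b4))).trans (le_of_eq ?_))
    ring
  have key := norm_le_of_gronwall hK (by positivity) ht₁ hDd hDb hD0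
  have h5 : ‖g (x + h) t₁ - g x t₁ - h • (X x t₁ *ᵥ g x t₁)‖ = ‖D t₁‖ := by
    simp only [hD, hsmul]
  rw [h5, Real.norm_eq_abs]
  refine key.trans ?_
  have h6 : ε * A ≤ c := by
    calc ε * A ≤ c / A * A := mul_le_mul_of_nonneg_right (min_le_right _ _) hA0.le
      _ = c := div_mul_cancel₀ _ hA0.ne'
  calc _ = ε * A * |h| := by rw [hA]; ring
    _ ≤ c * |h| := mul_le_mul_of_nonneg_right h6 (abs_nonneg _)

end ZeroCurvature

/-- Solutions of `φₜ = T φ` keep their limit `y` as `x → l` if `T` tends to a matrix that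
annihilates `y`, uniformly in `t`. -/
lemma tendsto_of_evolution {T : ℝ → ℝ → Matrix (Fin 2) (Fin 2) ℂ}
    {Tinf : Matrix (Fin 2) (Fin 2) ℂ} {y : Fin 2 → ℂ} {l : Filter ℝ} {g : ℝ → ℝ → Fin 2 → ℂ}
    {t₀ t₁ : ℝ} (ht₁ : |t₁ - t₀| ≤ 1)
    (hT : ∀ i j, ∀ ε > 0, ∀ᶠ x in l, ∀ t ∈ Set.uIcc t₀ t₁, ‖T x t i j - Tinf i j‖ < ε)
    (hy : Tinf *ᵥ y = 0)
    (hgt : ∀ x, ∀ t ∈ Set.uIcc t₀ t₁, HasDerivAt (g x) (T x t *ᵥ g x t) t)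
    (hg : Tendsto (fun x => g x t₀) l (𝓝 y)) : Tendsto (fun x => g x t₁) l (𝓝 y) := by
  obtain ⟨C, hC⟩ : ∃ C, ∀ i j, ‖Tinf i j‖ ≤ C := by
    refine ⟨∑ i, ∑ j, ‖Tinf i j‖, fun i j => ?_⟩
    exact (Finset.single_le_sum (f := fun j => ‖Tinf i j‖) (fun j _ => norm_nonneg _)
        (Finset.mem_univ j)).trans (Finset.single_le_sum (f := fun i => ∑ j, ‖Tinf i j‖)
        (fun i _ => Finset.sum_nonneg fun j _ => norm_nonneg _) (Finset.mem_univ i))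
  have hC0 : 0 ≤ C := (norm_nonneg _).trans (hC 0 0)
  set K : ℝ := 2 * (C + 1) with hKdef
  have hK : 1 ≤ K := by linarith
  set A : ℝ := (1 + 2 * ‖y‖) * Real.exp K with hA
  have hA0 : 0 < A := by positivity
  refine Metric.tendsto_nhds.2 fun c hc => ?_
  set ε : ℝ := min 1 (c / 2 / A) with hεdef
  have hε : 0 < ε := lt_min one_pos (by positivity)
  have e1 : ∀ᶠ x in l, ∀ i j, ∀ t ∈ Set.uIcc t₀ t₁, ‖T x t i j - Tinf i j‖ < ε :=
    eventually_all.2 fun i => eventually_all.2 fun j => hT i j ε hε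
  filter_upwards [e1, Metric.tendsto_nhds.1 hg ε hε] with x h1 h2
  rw [dist_eq_norm] at h2 ⊢
  -- Since `Tinf` annihilates `y`, the difference `g - y` solves the same system with the small
  -- source `(T - Tinf) y`.
  have hd : ∀ t ∈ Set.uIcc t₀ t₁, HasDerivAt (fun t => g x t - y) (T x t *ᵥ (g x t - y)
      + (T x t - Tinf) *ᵥ y) t := fun t ht => by
    refine ((hgt x t ht).sub_const y).congr_deriv ?_
    rw [Matrix.sub_mulVec, Matrix.mulVec_sub, hy]
    abel
  have hb : ∀ t ∈ Set.uIcc t₀ t₁, ‖T x t *ᵥ (g x t - y) + (T x t - Tinf) *ᵥ y‖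
      ≤ K * ‖g x t - y‖ + 2 * ε * ‖y‖ := fun t ht => by
    refine (norm_add_le _ _).trans (add_le_add ?_ ?_)
    · refine norm_mulVec_le_of_entries (fun i j => ?_) _
      calc ‖T x t i j‖ = ‖Tinf i j + (T x t i j - Tinf i j)‖ := by rw [add_sub_cancel]
        _ ≤ _ := norm_add_le _ _
        _ ≤ C + 1 := add_le_add (hC i j) ((h1 i j t ht).le.trans (min_le_left _ _))
    · exact norm_mulVec_le_of_entries (fun i j => by simpa using (h1 i j t ht).le) _
  have key := norm_le_of_gronwall hK (by positivity) ht₁ hd hb h2.le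
  refine key.trans_lt ?_
  have h6 : ε * A ≤ c / 2 := by
    calc ε * A ≤ c / 2 / A * A := mul_le_mul_of_nonneg_right (min_le_right _ _) hA0.le
      _ = c / 2 := div_mul_cancel₀ _ hA0.ne'
  calc _ = ε * A := by rw [hA]; ring
    _ ≤ c / 2 := h6
    _ < c := by linarith

/-- The solutions of the `x`-equation characterized by their limit `y` at `l` satisfy the
`t`-equation. -/
lemma ZeroCurvature.hasDerivAt_t {X T Xt Tx : ℝ → ℝ → Matrix (Fin 2) (Fin 2) ℂ}
    (H : ZeroCurvature X T Xt Tx) {Tinf : Matrix (Fin 2) (Fin 2) ℂ} {y : Fin 2 → ℂ} {l : Filter ℝ}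
    (hT : ∀ i j, ∀ K : Set ℝ, IsCompact K → ∀ ε > 0, ∀ᶠ x in l, ∀ t ∈ K,
      ‖T x t i j - Tinf i j‖ < ε)
    (hy : Tinf *ᵥ y = 0) {f : ℝ → ℝ → Fin 2 → ℂ}
    (hfx : ∀ x t, HasDerivAt (fun y => f y t) (X x t *ᵥ f x t) x)
    (hfl : ∀ t, Tendsto (fun x => f x t) l (𝓝 y))
    (huniq : ∀ t, ∀ f₁ f₂ : ℝ → Fin 2 → ℂ, (∀ x, HasDerivAt f₁ (X x t *ᵥ f₁ x) x) →
      Tendsto f₁ l (𝓝 y) → (∀ x, HasDerivAt f₂ (X x t *ᵥ f₂ x) x) →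
      Tendsto f₂ l (𝓝 y) → f₁ = f₂) (x t : ℝ) :
    HasDerivAt (f x) (T x t *ᵥ f x t) t := by
  have hTc : ∀ x, Continuous (T x) := fun x => continuous_matrix fun i j =>
    (H.cont_T i j).comp (continuous_const.prodMk continuous_id)
  -- `g x` is the flow of the `t`-equation started from `f x t`. It keeps both the `x`-equation and
  -- the limit at `l`, so uniqueness forces it to agree with `f` for times near `t`.
  choose g hg0 hgd using fun x => exists_linear_sol (hTc x) t (f x t)
  have heq : ∀ s, |s - t| < 1 → (fun x => g x s) = fun x => f x s := fun s hs => by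
    have hd : ∀ x, ∀ r ∈ Set.uIcc t s, HasDerivAt (g x) (T x r *ᵥ g x r) r := fun x r hr => by
      refine hgd x r ?_
      have h1 := Set.abs_sub_left_of_mem_uIcc hr
      linarith [le_abs_self (r - t)]
    refine huniq s _ _ (H.hasDerivAt_x hs.le hd ?_)
      (tendsto_of_evolution hs.le (fun i j => hT i j _ isCompact_uIcc) hy hd ?_)
      (fun x => hfx x s) (hfl s)
    · intro x
      simp only [hg0]
      exact hfx x t
    · simp only [hg0]
      exact hfl t
  have h1 := hgd x t (by linarith)
  rw [hg0] at h1
  refine h1.congr_of_eventuallyEq ?_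
  filter_upwards [Metric.ball_mem_nhds t one_pos] with s hs
  exact (congrFun (heq s hs) x).symm

/-! ### The zero curvature condition -/

/-- The sextic equation reads `i qₜ + stationaryPart q q* = 0`. -/
def stationaryPart (δ c : ℂ) (q p : ℕ → ℂ) : ℂ :=
  1 / 2 * q 2 + q 0 * (q 0 * p 0 - c ^ 2) + 20 * δ * q 0 * ((q 0 * p 0) ^ 3 - c ^ 6)
    + δ * sexticPart q p

/-- The coefficient of `I` in `T21`, and, with the two arguments exchanged, in `T12`. -/
def oddPart (δ k : ℂ) (q p : ℕ → ℂ) : ℂ :=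
  32 * δ * k ^ 5 * q 0 + k ^ 3 * δ * (-16 * q 0 ^ 2 * p 0 - 8 * q 2)
    + k * (q 0 + δ * (12 * p 0 * q 1 ^ 2 + 16 * q 0 * p 0 * q 2 + 4 * q 0 ^ 2 * p 2
        + 2 * q 4 + 12 * (q 0 * p 0) ^ 2 * q 0 + 8 * q 0 * q 1 * p 1))

/-- The coefficient of `I` in `T11`. -/
def diagOddPart (δ q₀ k : ℂ) (q p : ℕ → ℂ) : ℂ :=
  (-(1 / 2) * q 0 * p 0 + 1 / 2 * q₀ ^ 2 + 10 * δ * q₀ ^ 6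
      + δ * (-10 * (q 0 * p 0) ^ 3 - 5 * (q 1 ^ 2 * p 0 ^ 2 + p 1 ^ 2 * q 0 ^ 2) - q 2 * p 2
        + q 1 * p 3 + p 1 * q 3 - p 0 * q 4 - q 0 * p 4
        - 10 * q 0 * p 0 * (q 2 * p 0 + p 2 * q 0)))
    + k ^ 2 * (1 + δ * (12 * (q 0 * p 0) ^ 2 - 4 * q 1 * p 1 + 4 * (p 2 * q 0 + q 2 * p 0)))
    - 16 * δ * k ^ 4 * q 0 * p 0 + 32 * δ * k ^ 6

/-- `u n` is differentiable with derivative `u (n + 1)` for `n ≤ 5`. -/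
def IsJet (u : ℕ → ℝ → ℂ) (x : ℝ) : Prop := ∀ n ≤ 5, HasDerivAt (u n) (u (n + 1) x) x

section Jets

variable {u v : ℕ → ℝ → ℂ} {x : ℝ}

lemma hasDerivAt_sq {f : ℝ → ℂ} {f' : ℂ} (h : HasDerivAt f f' x) :
    HasDerivAt (fun y => f y ^ 2) (2 * f x * f') x :=
  (h.fun_pow 2).congr_deriv (by norm_num)

lemma hasDerivAt_cube {f : ℝ → ℂ} {f' : ℂ} (h : HasDerivAt f f' x) :
    HasDerivAt (fun y => f y ^ 3) (3 * f x ^ 2 * f') x :=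
  (h.fun_pow 3).congr_deriv (by norm_num)

/-- This and the next two lemmas are the zero curvature condition entry by entry, with the jets of
`q` and of `q*` treated as independent. The diagonal entry is an identity; only the off-diagonal
ones produce `stationaryPart`, hence the equation. -/
lemma hasDerivAt_T11 (hu : IsJet u x) (hv : IsJet v x) (δ q₀ k : ℂ) :
    HasDerivAt (fun y => T11 δ q₀ k (fun n => u n y) (fun n => v n y))
      (I * v 0 x * T21 δ k (fun n => u n x) (fun n => v n x)
        - I * u 0 x * T12 δ k (fun n => u n x) (fun n => v n x)) x := by
  have u0 : HasDerivAt (u 0) (u 1 x) x := hu 0 (by norm_num)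
  have u1 : HasDerivAt (u 1) (u 2 x) x := hu 1 (by norm_num)
  have u2 : HasDerivAt (u 2) (u 3 x) x := hu 2 (by norm_num)
  have u3 : HasDerivAt (u 3) (u 4 x) x := hu 3 (by norm_num)
  have u4 : HasDerivAt (u 4) (u 5 x) x := hu 4 (by norm_num)
  have u5 : HasDerivAt (u 5) (u 6 x) x := hu 5 (by norm_num)
  have v0 : HasDerivAt (v 0) (v 1 x) x := hv 0 (by norm_num)
  have v1 : HasDerivAt (v 1) (v 2 x) x := hv 1 (by norm_num)
  have v2 : HasDerivAt (v 2) (v 3 x) x := hv 2 (by norm_num)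
  have v3 : HasDerivAt (v 3) (v 4 x) x := hv 3 (by norm_num)
  have v4 : HasDerivAt (v 4) (v 5 x) x := hv 4 (by norm_num)
  have v5 : HasDerivAt (v 5) (v 6 x) x := hv 5 (by norm_num)
  simp only [T11]
  apply HasDerivAt.congr_deriv
  · repeat' first
      | exact hasDerivAt_const _ _
      | exact u0 | exact u1 | exact u2 | exact u3 | exact u4 | exact u5
      | exact v0 | exact v1 | exact v2 | exact v3 | exact v4 | exact v5
      | with_reducible apply HasDerivAt.fun_add
      | with_reducible apply HasDerivAt.fun_sub
      | with_reducible apply HasDerivAt.fun_mul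
      | with_reducible apply hasDerivAt_sq
      | with_reducible apply hasDerivAt_cube
  · simp only [T21, T12]
    -- To `ring1` the unit `I` is an indeterminate; the products containing `I ^ 2` are those of `I`
    -- with the parts of the entries linear in `I`, which `oddPart` and `diagOddPart` name in these
    -- three proofs.
    linear_combination (norm := (simp only [oddPart]; ring1))
        (-(v 0 x * oddPart δ k (fun n => u n x) (fun n => v n x)
      - u 0 x * oddPart δ k (fun n => v n x) (fun n => u n x))) * I_sq

lemma hasDerivAt_T12 (hu : IsJet u x) (hv : IsJet v x) (δ q₀ k : ℂ) :
    HasDerivAt (fun y => T12 δ k (fun n => u n y) (fun n => v n y))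
      (stationaryPart δ q₀ (fun n => v n x) (fun n => u n x) + 2 * (I * k) * T12 δ k
          (fun n => u n x) (fun n => v n x)
        - 2 * (I * v 0 x) * T11 δ q₀ k (fun n => u n x) (fun n => v n x)) x := by
  have u0 : HasDerivAt (u 0) (u 1 x) x := hu 0 (by norm_num)
  have u1 : HasDerivAt (u 1) (u 2 x) x := hu 1 (by norm_num)
  have u2 : HasDerivAt (u 2) (u 3 x) x := hu 2 (by norm_num)
  have u3 : HasDerivAt (u 3) (u 4 x) x := hu 3 (by norm_num)
  have u4 : HasDerivAt (u 4) (u 5 x) x := hu 4 (by norm_num)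
  have u5 : HasDerivAt (u 5) (u 6 x) x := hu 5 (by norm_num)
  have v0 : HasDerivAt (v 0) (v 1 x) x := hv 0 (by norm_num)
  have v1 : HasDerivAt (v 1) (v 2 x) x := hv 1 (by norm_num)
  have v2 : HasDerivAt (v 2) (v 3 x) x := hv 2 (by norm_num)
  have v3 : HasDerivAt (v 3) (v 4 x) x := hv 3 (by norm_num)
  have v4 : HasDerivAt (v 4) (v 5 x) x := hv 4 (by norm_num)
  have v5 : HasDerivAt (v 5) (v 6 x) x := hv 5 (by norm_num)
  simp only [T12]
  apply HasDerivAt.congr_deriv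
  · repeat' first
      | exact hasDerivAt_const _ _
      | exact u0 | exact u1 | exact u2 | exact u3 | exact u4 | exact u5
      | exact v0 | exact v1 | exact v2 | exact v3 | exact v4 | exact v5
      | with_reducible apply HasDerivAt.fun_add
      | with_reducible apply HasDerivAt.fun_sub
      | with_reducible apply HasDerivAt.fun_mul
      | with_reducible apply hasDerivAt_sq
  · simp only [T11, stationaryPart, sexticPart]
    linear_combination (norm := (simp only [oddPart, diagOddPart]; ring1))
        (-(2 * k * oddPart δ k (fun n => v n x) (fun n => u n x)
      - 2 * v 0 x * diagOddPart δ q₀ k (fun n => u n x) (fun n => v n x))) * I_sq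

lemma hasDerivAt_T21 (hu : IsJet u x) (hv : IsJet v x) (δ q₀ k : ℂ) :
    HasDerivAt (fun y => T21 δ k (fun n => u n y) (fun n => v n y))
      (-stationaryPart δ q₀ (fun n => u n x) (fun n => v n x) - 2 * (I * k) * T21 δ k
          (fun n => u n x) (fun n => v n x)
        + 2 * (I * u 0 x) * T11 δ q₀ k (fun n => u n x) (fun n => v n x)) x := by
  have u0 : HasDerivAt (u 0) (u 1 x) x := hu 0 (by norm_num)
  have u1 : HasDerivAt (u 1) (u 2 x) x := hu 1 (by norm_num)
  have u2 : HasDerivAt (u 2) (u 3 x) x := hu 2 (by norm_num)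
  have u3 : HasDerivAt (u 3) (u 4 x) x := hu 3 (by norm_num)
  have u4 : HasDerivAt (u 4) (u 5 x) x := hu 4 (by norm_num)
  have u5 : HasDerivAt (u 5) (u 6 x) x := hu 5 (by norm_num)
  have v0 : HasDerivAt (v 0) (v 1 x) x := hv 0 (by norm_num)
  have v1 : HasDerivAt (v 1) (v 2 x) x := hv 1 (by norm_num)
  have v2 : HasDerivAt (v 2) (v 3 x) x := hv 2 (by norm_num)
  have v3 : HasDerivAt (v 3) (v 4 x) x := hv 3 (by norm_num)
  have v4 : HasDerivAt (v 4) (v 5 x) x := hv 4 (by norm_num)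
  have v5 : HasDerivAt (v 5) (v 6 x) x := hv 5 (by norm_num)
  simp only [T21]
  apply HasDerivAt.congr_deriv
  · repeat' first
      | exact hasDerivAt_const _ _
      | exact u0 | exact u1 | exact u2 | exact u3 | exact u4 | exact u5
      | exact v0 | exact v1 | exact v2 | exact v3 | exact v4 | exact v5
      | with_reducible apply HasDerivAt.fun_add
      | with_reducible apply HasDerivAt.fun_sub
      | with_reducible apply HasDerivAt.fun_mul
      | with_reducible apply hasDerivAt_sq
  · simp only [T11, stationaryPart, sexticPart]
    linear_combination (norm := (simp only [oddPart, diagOddPart]; ring1))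
        (2 * k * oddPart δ k (fun n => u n x) (fun n => v n x)
      - 2 * u 0 x * diagOddPart δ q₀ k (fun n => u n x) (fun n => v n x)) * I_sq

end Jets

/-! ### Continuity in the jets, and truncation -/

section Continuity

variable (δ q₀ k : ℂ)

lemma continuous_T11 : Continuous fun p : (ℕ → ℂ) × (ℕ → ℂ) => T11 δ q₀ k p.1 p.2 := by
  unfold T11; fun_prop

lemma continuous_T12 : Continuous fun p : (ℕ → ℂ) × (ℕ → ℂ) => T12 δ k p.1 p.2 := by
  unfold T12; fun_prop

lemma continuous_T21 : Continuous fun p : (ℕ → ℂ) × (ℕ → ℂ) => T21 δ k p.1 p.2 := by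
  unfold T21; fun_prop

lemma continuous_stationaryPart :
    Continuous fun p : (ℕ → ℂ) × (ℕ → ℂ) => stationaryPart δ q₀ p.1 p.2 := by
  unfold stationaryPart sexticPart; fun_prop

end Continuity

/-- The jet `u`, with the entries of order above `N` removed. -/
def trunc (N : ℕ) (u : ℕ → ℂ) (n : ℕ) : ℂ := if n ≤ N then u n else 0

/-- Convergence in `ℕ → ℂ` concerns every entry, while the jets of `q` are controlled up to a finite
order only; truncating them lets the continuity of `jetT` and `stationaryPart` be applied. -/
lemma tendsto_trunc {α : Type*} {F : Filter α} {N : ℕ} {u : ℕ → α → ℂ} {w : ℕ → ℂ}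
    (h : ∀ n ≤ N, Tendsto (u n) F (𝓝 (w n))) :
    Tendsto (fun a => trunc N (fun n => u n a)) F (𝓝 (trunc N w)) := by
  refine tendsto_pi_nhds.2 fun n => ?_
  by_cases hn : n ≤ N
  · simpa only [trunc, hn, if_true] using h n hn
  · simp only [trunc, hn, if_false]; exact tendsto_const_nhds

lemma continuous_trunc {α : Type*} [TopologicalSpace α] {N : ℕ} {u : ℕ → α → ℂ}
    (h : ∀ n ≤ N, Continuous (u n)) : Continuous fun a => trunc N (fun n => u n a) :=
  continuous_iff_continuousAt.2 fun a => tendsto_trunc (w := fun n => u n a)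
    fun n hn => (h n hn).continuousAt

/-- The matrix `T` as a function of the jets of `q` and of `q*`. -/
def jetT (δ q₀ k : ℂ) (u v : ℕ → ℂ) : Matrix (Fin 2) (Fin 2) ℂ :=
  !![T11 δ q₀ k u v, T12 δ k u v; T21 δ k u v, -T11 δ q₀ k u v]

lemma continuous_jetT (δ q₀ k : ℂ) :
    Continuous fun p : (ℕ → ℂ) × (ℕ → ℂ) => jetT δ q₀ k p.1 p.2 := by
  refine continuous_matrix fun i j => ?_
  fin_cases i <;> fin_cases j
  · exact continuous_T11 δ q₀ k
  · exact continuous_T12 δ k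
  · exact continuous_T21 δ k
  · exact (continuous_T11 δ q₀ k).neg

lemma jetT_trunc (δ q₀ k : ℂ) (u v : ℕ → ℂ) :
    jetT δ q₀ k (trunc 5 u) (trunc 5 v) = jetT δ q₀ k u v := by
  simp [jetT, T11, T12, T21, trunc]

lemma stationaryPart_trunc (δ q₀ : ℂ) (u v : ℕ → ℂ) :
    stationaryPart δ q₀ (trunc 6 u) (trunc 6 v) = stationaryPart δ q₀ u v := by
  simp [stationaryPart, sexticPart, trunc]

/-- The factor of `λ t` in `θ`. -/
def omega (δ q₀ : ℝ) (k : ℂ) : ℂ :=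
  32 * δ * k ^ 5 - 16 * δ * k ^ 3 * (q₀ : ℂ) ^ 2 + 12 * δ * k * (q₀ : ℂ) ^ 4 + k

/-! ### The Lax pair along a solution -/

namespace IsSolution

variable {δ q₀ : ℝ} {qp qm : ℂ} {q : ℝ → ℝ → ℂ}

lemma hasDerivAt_dx (hq : IsSolution δ q₀ qp qm q) {n : ℕ} (hn : n ≤ 5) (x t : ℝ) :
    HasDerivAt (fun y => dx q n y t) (dx q (n + 1) x t) x := by
  have h1 : Differentiable ℝ (iteratedDeriv n fun y => q y t) :=
    (hq.contDiff_x t).differentiable_iteratedDeriv n (by exact_mod_cast (by omega : n < 6))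
  have h2 := (h1 x).hasDerivAt
  rw [← iteratedDeriv_succ] at h2
  exact h2

lemma hasDerivAt_conj {f : ℝ → ℂ} {f' : ℂ} {x : ℝ} (h : HasDerivAt f f' x) :
    HasDerivAt (fun y => conj (f y)) (conj f') x :=
  Complex.conjCLE.hasFDerivAt.comp_hasDerivAt x h

lemma isJet (hq : IsSolution δ q₀ qp qm q) (x t : ℝ) : IsJet (fun n y => dx q n y t) x :=
  fun _ hn => hq.hasDerivAt_dx hn x t

lemma isJet_conj (hq : IsSolution δ q₀ qp qm q) (x t : ℝ) :
    IsJet (fun n y => conj (dx q n y t)) x :=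
  fun _ hn => hasDerivAt_conj (hq.hasDerivAt_dx hn x t)

lemma dx_zero (q : ℝ → ℝ → ℂ) (x t : ℝ) : dx q 0 x t = q x t := by
  simp [dx]

/-- The differential polynomial has real coefficients, so conjugation exchanges the two jets and
yields the evolution equation of `q*`. -/
lemma conj_stationaryPart (δ q₀ : ℝ) (u : ℕ → ℂ) :
    conj (stationaryPart δ q₀ u fun n => conj (u n))
      = stationaryPart δ q₀ (fun n => conj (u n)) u := by
  simp [stationaryPart, sexticPart, map_ofNat (starRingEnd ℂ)]

lemma I_mul_deriv (hq : IsSolution δ q₀ qp qm q) (x t : ℝ) :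
    I * deriv (fun τ => q x τ) t
      = -stationaryPart δ q₀ (fun n => dx q n x t) fun n => conj (dx q n x t) := by
  have h := hq.equation x t
  have h2 : (‖q x t‖ : ℂ) ^ 2 = q x t * conj (q x t) := (Complex.mul_conj' _).symm
  have h6 : (‖q x t‖ : ℂ) ^ 6 = (q x t * conj (q x t)) ^ 3 := by rw [← h2]; ring
  rw [SatisfiesEquation, h2, h6] at h
  simp only [stationaryPart, dx_zero]
  linear_combination h

lemma hasDerivAt_I_mul (hq : IsSolution δ q₀ qp qm q) (x t : ℝ) :
    HasDerivAt (fun τ => I * q x τ)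
      (-stationaryPart δ q₀ (fun n => dx q n x t) fun n => conj (dx q n x t)) t :=
  ((hq.differentiable_t x t).hasDerivAt.const_mul I).congr_deriv (hq.I_mul_deriv x t)

lemma hasDerivAt_I_mul_conj (hq : IsSolution δ q₀ qp qm q) (x t : ℝ) :
    HasDerivAt (fun τ => I * conj (q x τ))
      (stationaryPart δ q₀ (fun n => conj (dx q n x t)) fun n => dx q n x t) t := by
  have h := (hasDerivAt_conj (hq.hasDerivAt_I_mul x t)).neg
  rw [map_neg, neg_neg, conj_stationaryPart] at h
  refine h.congr_of_eventuallyEq (Eventually.of_forall fun τ => ?_)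
  simp

lemma continuous_q (hq : IsSolution δ q₀ qp qm q) : Continuous fun p : ℝ × ℝ => q p.1 p.2 := by
  simpa only [dx_zero] using hq.continuous_dx 0 (by norm_num)

lemma continuous_conj_dx (hq : IsSolution δ q₀ qp qm q) {n : ℕ} (hn : n ≤ 6) :
    Continuous fun p : ℝ × ℝ => conj (dx q n p.1 p.2) :=
  Complex.continuous_conj.comp (hq.continuous_dx n hn)

lemma continuous_laxT (hq : IsSolution δ q₀ qp qm q) (k : ℂ) :
    Continuous fun p : ℝ × ℝ => laxT δ q₀ q k p.1 p.2 := by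
  have h := (continuous_jetT δ q₀ k).comp
    ((continuous_trunc (N := 5) (u := fun n (p : ℝ × ℝ) => dx q n p.1 p.2)
      fun n hn => hq.continuous_dx n (by omega)).prodMk
    (continuous_trunc (N := 5) (u := fun n (p : ℝ × ℝ) => conj (dx q n p.1 p.2))
      fun n hn => hq.continuous_conj_dx (by omega)))
  simp only [Function.comp_def, jetT_trunc] at h
  exact h

lemma continuous_laxX (hq : IsSolution δ q₀ qp qm q) (k : ℂ) :
    Continuous fun p : ℝ × ℝ => laxX q k p.1 p.2 := by
  refine continuous_const.add (continuous_matrix fun i j => ?_)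
  have h := hq.continuous_q
  have h' := Complex.continuous_conj.comp h
  fin_cases i <;> fin_cases j
  · exact continuous_const
  · exact continuous_const.mul h'
  · exact continuous_const.mul h
  · exact continuous_const

/-- The `t`-derivative of `X`. -/
def laxXt (δ q₀ : ℝ) (q : ℝ → ℝ → ℂ) (x t : ℝ) : Matrix (Fin 2) (Fin 2) ℂ :=
  !![0, stationaryPart δ q₀ (fun n => conj (dx q n x t)) fun n => dx q n x t;
    -stationaryPart δ q₀ (fun n => dx q n x t) fun n => conj (dx q n x t), 0]

lemma continuous_laxXt (hq : IsSolution δ q₀ qp qm q) :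
    Continuous fun p : ℝ × ℝ => laxXt δ q₀ q p.1 p.2 := by
  have hu := continuous_trunc (N := 6) (u := fun n (p : ℝ × ℝ) => dx q n p.1 p.2)
      fun n hn => hq.continuous_dx n hn
  have hv := continuous_trunc (N := 6) (u := fun n (p : ℝ × ℝ) => conj (dx q n p.1 p.2))
      fun n hn => hq.continuous_conj_dx hn
  have h1 := (continuous_stationaryPart δ q₀).comp (hu.prodMk hv)
  have h2 := (continuous_stationaryPart δ q₀).comp (hv.prodMk hu)
  simp only [Function.comp_def, stationaryPart_trunc] at h1 h2
  refine continuous_matrix fun i j => ?_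
  fin_cases i <;> fin_cases j
  · exact continuous_const
  · exact h2
  · exact h1.neg
  · exact continuous_const

/-- Scalar matrices commute with everything, so the shifts by `c` and `c'` do not affect the
condition; they are what turns the equations for `ψ` into those for `μ`. As `Tx` is given in the
form required by `zero`, the content lies in `deriv_T`. -/
lemma zeroCurvature (hq : IsSolution δ q₀ qp qm q) (k c c' : ℂ) :
    ZeroCurvature (fun x t => laxX q k x t - c • (1 : Matrix (Fin 2) (Fin 2) ℂ))
      (fun x t => laxT δ q₀ q k x t - c' • (1 : Matrix (Fin 2) (Fin 2) ℂ))
      (fun x t => laxXt δ q₀ q x t)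
      (fun x t => laxXt δ q₀ q x t + laxX q k x t * laxT δ q₀ q k x t
        - laxT δ q₀ q k x t * laxX q k x t) where
  deriv_X x t i j := by
    fin_cases i <;> fin_cases j
    · simpa [laxX, Qmat, sigma3, laxXt] using hasDerivAt_const t (I * k - c)
    · simpa [laxX, Qmat, sigma3, laxXt] using hq.hasDerivAt_I_mul_conj x t
    · simpa [laxX, Qmat, sigma3, laxXt] using hq.hasDerivAt_I_mul x t
    · simpa [laxX, Qmat, sigma3, laxXt] using hasDerivAt_const t (-(I * k) - c)
  deriv_T x t i j := by
    have h11 := hasDerivAt_T11 (hq.isJet x t) (hq.isJet_conj x t) δ q₀ k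
    have h12 := hasDerivAt_T12 (hq.isJet x t) (hq.isJet_conj x t) δ q₀ k
    have h21 := hasDerivAt_T21 (hq.isJet x t) (hq.isJet_conj x t) δ q₀ k
    simp only [dx_zero] at h11 h12 h21
    fin_cases i <;> fin_cases j
    · refine (h11.sub_const (c' * 1)).congr_deriv ?_
      simp [laxX, laxT, laxXt, sigma3, Qmat]
      ring
    · refine (h12.sub_const (c' * 0)).congr_deriv ?_
      simp [laxX, laxT, laxXt, sigma3, Qmat]
      ring
    · refine (h21.sub_const (c' * 0)).congr_deriv ?_
      simp [laxX, laxT, laxXt, sigma3, Qmat]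
      ring
    · refine (h11.neg.sub_const (c' * 1)).congr_deriv ?_
      simp [laxX, laxT, laxXt, sigma3, Qmat]
      ring
  cont_X i j := ((hq.continuous_laxX k).sub continuous_const).matrix_elem i j
  cont_T i j := ((hq.continuous_laxT k).sub continuous_const).matrix_elem i j
  cont_Tx i j := ((hq.continuous_laxXt.add ((hq.continuous_laxX k).matrix_mul
    (hq.continuous_laxT k))).sub ((hq.continuous_laxT k).matrix_mul
    (hq.continuous_laxX k))).matrix_elem i j
  zero x t := by
    simp only [Matrix.sub_mul, Matrix.mul_sub, Matrix.smul_mul, Matrix.mul_smul, Matrix.one_mul,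
      Matrix.mul_one, smul_sub]
    rw [smul_comm c c']
    abel

end IsSolution

/-! ### The limit of the Lax pair at spatial infinity -/

/-- The jet of a constant. -/
def constJet (w : ℂ) (n : ℕ) : ℂ := if n = 0 then w else 0

/-- The potential tends to `w` along `l` together with five derivatives that tend to zero. -/
def TendsToConst (q : ℝ → ℝ → ℂ) (l : Filter ℝ) (w : ℂ) : Prop :=
  ∀ n ≤ 5, TendstoLocallyUniformly (fun x t => dx q n x t) (fun _ => constJet w n) l

/-- On a constant background of modulus `q₀` the time flow is `ω` times the space flow, which
explains the phase `θ = λ (x + ω t)`. The constants `q₀² / 2` and `10 δ q₀⁶` in `T11` cancel the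
terms that would spoil the proportionality. -/
lemma jetT_const (δ q₀ : ℝ) (k : ℂ) {w : ℂ} (hw : ‖w‖ = q₀) :
    jetT δ q₀ k (constJet w) (fun n => conj (constJet w n))
      = omega δ q₀ k • ((I * k) • sigma3 + Qmat w) := by
  have h : w * conj w = (q₀ : ℂ) ^ 2 := by rw [Complex.mul_conj', hw]
  ext i j
  fin_cases i <;> fin_cases j
  · simp [jetT, T11, constJet, sigma3, Qmat, omega]
    linear_combination (norm := ring_nf) (-(1 / 2) * I - 16 * I * δ * k ^ 4
      + 12 * I * δ * k ^ 2 * (w * conj w + q₀ ^ 2) - 10 * I * δ * ((w * conj w) ^ 2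
      + w * conj w * q₀ ^ 2 + q₀ ^ 4)) * h
  · simp [jetT, T12, constJet, sigma3, Qmat, omega]
    linear_combination (norm := ring_nf) (I * conj w * (-16 * k ^ 3 * δ
      + 12 * δ * k * (w * conj w + q₀ ^ 2))) * h
  · simp [jetT, T21, constJet, sigma3, Qmat, omega]
    linear_combination (norm := ring_nf) (I * w * (-16 * k ^ 3 * δ
      + 12 * δ * k * (w * conj w + q₀ ^ 2))) * h
  · simp [jetT, T11, constJet, sigma3, Qmat, omega]
    linear_combination (norm := ring_nf) (-(-(1 / 2) * I - 16 * I * δ * k ^ 4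
      + 12 * I * δ * k ^ 2 * (w * conj w + q₀ ^ 2) - 10 * I * δ * ((w * conj w) ^ 2
      + w * conj w * q₀ ^ 2 + q₀ ^ 4))) * h

lemma TendsToConst.eventually_laxT {δ q₀ : ℝ} {q : ℝ → ℝ → ℂ} {l : Filter ℝ} {w : ℂ}
    (h : TendsToConst q l w) (hw : ‖w‖ = q₀) (k : ℂ) (i j : Fin 2) {K : Set ℝ} (hK : IsCompact K)
    {ε : ℝ} (hε : 0 < ε) :
    ∀ᶠ x in l, ∀ t ∈ K, ‖laxT δ q₀ q k x t i j
      - (omega δ q₀ k • ((I * k) • sigma3 + Qmat w)) i j‖ < ε := by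
  rw [← jetT_const δ q₀ k hw]
  have hu : ∀ t, ∀ n ≤ 5, Tendsto (fun p : ℝ × ℝ => dx q n p.1 p.2) (l ×ˢ 𝓝 t)
      (𝓝 (constJet w n)) := fun t n hn => by
    have := tendstoLocallyUniformly_iff_forall_tendsto.1 (h n hn) t
    exact Uniform.tendsto_nhds_right.2 this
  have hT : ∀ t, Tendsto (fun p : ℝ × ℝ => laxT δ q₀ q k p.1 p.2 i j) (l ×ˢ 𝓝 t)
      (𝓝 (jetT δ q₀ k (constJet w) (fun n => conj (constJet w n)) i j)) := fun t => by
    have h1 := tendsto_trunc (N := 5) (u := fun n (p : ℝ × ℝ) => dx q n p.1 p.2) (hu t)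
    have h2 := tendsto_trunc (N := 5) (u := fun n (p : ℝ × ℝ) => conj (dx q n p.1 p.2))
      (w := fun n => conj (constJet w n))
      fun n hn => (Complex.continuous_conj.tendsto _).comp (hu t n hn)
    have h3 := (((continuous_jetT δ q₀ k).matrix_elem i j).tendsto _).comp (h1.prodMk_nhds h2)
    simp only [Function.comp_def, jetT_trunc] at h3
    exact h3
  have hloc : TendstoLocallyUniformly (fun x t => laxT δ q₀ q k x t i j)
      (fun _ => jetT δ q₀ k (constJet w) (fun n => conj (constJet w n)) i j) l := by
    refine tendstoLocallyUniformly_iff_forall_tendsto.2 fun t => ?_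
    exact Uniform.tendsto_nhds_right.1 (hT t)
  have hun := (tendstoLocallyUniformlyOn_iff_tendstoUniformlyOn_of_compact hK).1
    (hloc.tendstoLocallyUniformlyOn (s := K))
  filter_upwards [Metric.tendstoUniformlyOn_iff.1 hun ε hε] with x hx t ht
  have := hx t ht
  rwa [dist_comm, dist_eq_norm] at this

/-! ### The model Jost column -/

/-- A differentiable potential with derivative `u'` and integrable approach to `w` at `+∞`. -/
structure IsPotential (q₀ : ℝ) (u u' : ℝ → ℂ) (w : ℂ) : Prop where
  pos : 0 < q₀
  norm_eq : ‖w‖ = q₀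
  hasDerivAt : ∀ x, HasDerivAt u (u' x) x
  cont_deriv : Continuous u'
  tendsto : Tendsto u atTop (𝓝 w)
  int : ∀ a, IntegrableOn (fun x => u x - w) (Set.Ioi a)
  int_deriv : ∀ a, IntegrableOn u' (Set.Ioi a)

/-- The first modified Jost column normalized at `+∞`, for the potential `u`. -/
def IsCol (q₀ : ℝ) (u : ℝ → ℂ) (w z : ℂ) (f : ℝ → Fin 2 → ℂ) : Prop :=
  (∀ x, HasDerivAt f
    (((I * kz q₀ z) • sigma3 + Qmat (u x)) *ᵥ f x - (I * lam q₀ z) • f x) x) ∧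
  Tendsto f atTop (𝓝 ![1, w / z])

/-- The spectral parameters for which the model column exists. -/
def adm (q₀ : ℝ) : Set ℂ := {z | z ≠ 0 ∧ gam q₀ z ≠ 0 ∧ 0 ≤ (lam q₀ z).im}

/-- The coefficient matrix in the eigenbasis of the limiting system. -/
def colR (q₀ : ℝ) (u : ℝ → ℂ) (w z : ℂ) (x : ℝ) : Matrix (Fin 2) (Fin 2) ℂ :=
  (I / gam q₀ z) • !![(w * conj (u x - w) + conj w * (u x - w)) / z,
      conj (u x - w) - conj w ^ 2 * (u x - w) / z ^ 2;
    (u x - w) - w ^ 2 * conj (u x - w) / z ^ 2,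
      -((w * conj (u x - w) + conj w * (u x - w)) / z)]

/-- The eigenvalues `±iλ` of the limiting matrix, shifted by `-iλ`. The second entry has real part
`2 Im λ`, whence the sign condition in `adm`. -/
def colD (q₀ : ℝ) (z : ℂ) : Fin 2 → ℂ := ![0, -(2 * I * lam q₀ z)]

def colE : Fin 2 → ℂ := ![1, 0]

/-- Coordinates with respect to the columns `(1, w / z)` and `(-conj w / z, 1)` of `Y`, a matrix of
determinant `gam q₀ z`. -/
def toEigen (q₀ : ℝ) (w z : ℂ) (f : Fin 2 → ℂ) : Fin 2 → ℂ :=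
  ![(f 0 + conj w / z * f 1) / gam q₀ z, (f 1 - w / z * f 0) / gam q₀ z]

def ofEigen (w z : ℂ) (v : Fin 2 → ℂ) : Fin 2 → ℂ :=
  ![v 0 - conj w / z * v 1, w / z * v 0 + v 1]

lemma gam_eq {q₀ : ℝ} {w : ℂ} (hw : ‖w‖ = q₀) {z : ℂ} (hz : z ≠ 0) :
    gam q₀ z = (z ^ 2 + w * conj w) / z ^ 2 := by
  rw [gam, Complex.mul_conj', hw]
  field_simp

lemma gam_eq_one_add {q₀ : ℝ} {w : ℂ} (hw : ‖w‖ = q₀) (z : ℂ) :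
    gam q₀ z = 1 + conj w / z * (w / z) := by
  rw [gam, ← hw, ← Complex.mul_conj']
  ring

lemma toEigen_ofEigen {q₀ : ℝ} {w z : ℂ} (hw : ‖w‖ = q₀) (hγ : gam q₀ z ≠ 0)
    (v : Fin 2 → ℂ) : toEigen q₀ w z (ofEigen w z v) = v := by
  funext i
  fin_cases i <;> simp [toEigen, ofEigen] <;>
    rw [div_eq_iff hγ, gam_eq_one_add hw z] <;> ring

lemma ofEigen_toEigen {q₀ : ℝ} {w z : ℂ} (hw : ‖w‖ = q₀) (hγ : gam q₀ z ≠ 0)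
    (f : Fin 2 → ℂ) : ofEigen w z (toEigen q₀ w z f) = f := by
  funext i
  fin_cases i <;> simp [toEigen, ofEigen] <;>
    rw [← mul_div_assoc] <;> first | rw [← sub_div] | rw [← add_div]
  all_goals
    rw [div_eq_iff hγ, gam_eq_one_add hw z]
    ring

lemma continuous_toEigen (q₀ : ℝ) (w z : ℂ) : Continuous (toEigen q₀ w z) := by
  refine continuous_pi fun i => ?_
  fin_cases i <;> simp only [toEigen] <;> simp <;> fun_prop

lemma continuous_ofEigen (w z : ℂ) : Continuous (ofEigen w z) := by
  refine continuous_pi fun i => ?_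
  fin_cases i <;> simp only [ofEigen] <;> simp <;> fun_prop

lemma isVolterraSol_of_isCol {q₀ : ℝ} {u : ℝ → ℂ} {w z : ℂ} (hw : ‖w‖ = q₀) (hz : z ≠ 0)
    (hγ : gam q₀ z ≠ 0) {f : ℝ → Fin 2 → ℂ} (hf : IsCol q₀ u w z f) :
    IsVolterraSol (colD q₀ z) colE (colR q₀ u w z) fun x => toEigen q₀ w z (f x) := by
  have hγ0 := hγ
  rw [gam_eq hw hz] at hγ
  have hγ' : z ^ 2 + w * conj w ≠ 0 := fun h => hγ (by rw [h, zero_div])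
  have hq : (q₀ : ℂ) ^ 2 = w * conj w := by rw [Complex.mul_conj', hw]
  constructor
  · intro x
    have h := hasDerivAt_pi.1 (hf.1 x)
    refine hasDerivAt_pi.2 fun i => ?_
    fin_cases i
    · refine (((h 0).add ((h 1).const_mul (conj w / z))).div_const (gam q₀ z)).congr_deriv ?_
      simp [colD, colR, toEigen, Matrix.mulVec, dotProduct, Fin.sum_univ_two, sigma3, Qmat,
        gam_eq hw hz, kz, lam, hq]
      field_simp
      ring
    · refine (((h 1).sub ((h 0).const_mul (w / z))).div_const (gam q₀ z)).congr_deriv ?_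
      simp [colD, colR, toEigen, Matrix.mulVec, dotProduct, Fin.sum_univ_two, sigma3, Qmat,
        gam_eq hw hz, kz, lam, hq]
      field_simp
      ring
  · have h := ((continuous_toEigen q₀ w z).tendsto _).comp hf.2
    have he : ofEigen w z colE = ![1, w / z] := by
      funext i; fin_cases i <;> simp [ofEigen, colE]
    rw [← he, toEigen_ofEigen hw hγ0] at h
    exact h

lemma isCol_of_isVolterraSol {q₀ : ℝ} {u : ℝ → ℂ} {w z : ℂ} (hw : ‖w‖ = q₀) (hz : z ≠ 0)
    (hγ : gam q₀ z ≠ 0) {v : ℝ → Fin 2 → ℂ}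
    (hv : IsVolterraSol (colD q₀ z) colE (colR q₀ u w z) v) :
    IsCol q₀ u w z fun x => ofEigen w z (v x) := by
  rw [gam_eq hw hz] at hγ
  have hγ' : z ^ 2 + w * conj w ≠ 0 := fun h => hγ (by rw [h, zero_div])
  have hq : (q₀ : ℂ) ^ 2 = w * conj w := by rw [Complex.mul_conj', hw]
  constructor
  · intro x
    have h := hasDerivAt_pi.1 (hv.1 x)
    refine hasDerivAt_pi.2 fun i => ?_
    fin_cases i
    · refine ((h 0).sub ((h 1).const_mul (conj w / z))).congr_deriv ?_
      simp [colD, colR, ofEigen, Matrix.mulVec, dotProduct, Fin.sum_univ_two, sigma3, Qmat,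
        gam_eq hw hz, kz, lam, hq]
      field_simp
      ring
    · refine (((h 0).const_mul (w / z)).add (h 1)).congr_deriv ?_
      simp [colD, colR, ofEigen, Matrix.mulVec, dotProduct, Fin.sum_univ_two, sigma3, Qmat,
        gam_eq hw hz, kz, lam, hq]
      field_simp
      ring
  · have h := ((continuous_ofEigen w z).tendsto _).comp hv.2
    have he : ofEigen w z colE = ![1, w / z] := by
      funext i; fin_cases i <;> simp [ofEigen, colE]
    rw [he] at h
    exact h

/-- The constant in the bound of `colR`. -/
def colC (q₀ : ℝ) (z : ℂ) : ℝ := 2 * ((1 + q₀ / ‖z‖) ^ 2 / ‖gam q₀ z‖)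

namespace IsPotential

variable {q₀ : ℝ} {u u' : ℝ → ℂ} {w : ℂ}

lemma continuous (h : IsPotential q₀ u u' w) : Continuous u :=
  continuous_iff_continuousAt.2 fun x => (h.hasDerivAt x).continuousAt

lemma norm_diag_le (h : IsPotential q₀ u u' w) (z : ℂ) (x : ℝ) :
    ‖(w * conj (u x - w) + conj w * (u x - w)) / z‖ ≤ 2 * (q₀ / ‖z‖) * ‖u x - w‖ := by
  rw [norm_div]
  have h1 : ‖w * conj (u x - w) + conj w * (u x - w)‖ ≤ 2 * q₀ * ‖u x - w‖ := by
    refine (norm_add_le _ _).trans (le_of_eq ?_)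
    rw [norm_mul, norm_mul, RCLike.norm_conj, RCLike.norm_conj, h.norm_eq]
    ring
  calc _ ≤ 2 * q₀ * ‖u x - w‖ / ‖z‖ := div_le_div_of_nonneg_right h1 (norm_nonneg _)
    _ = _ := by ring

lemma norm_offdiag_le (a b c z : ℂ) (hc : ‖c‖ = q₀) (hab : ‖b‖ = ‖a‖) :
    ‖a - c ^ 2 * b / z ^ 2‖ ≤ (1 + (q₀ / ‖z‖) ^ 2) * ‖a‖ := by
  refine (norm_sub_le _ _).trans (le_of_eq ?_)
  rw [norm_div, norm_mul, norm_pow, norm_pow, hc, hab]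
  ring

lemma norm_colR_le (h : IsPotential q₀ u u' w) (z : ℂ) (x : ℝ) (i j : Fin 2) :
    ‖colR q₀ u w z x i j‖ ≤ (1 + q₀ / ‖z‖) ^ 2 / ‖gam q₀ z‖ * ‖u x - w‖ := by
  have h0 := h.pos
  have hr : 0 ≤ q₀ / ‖z‖ := by positivity
  have key : ∀ c : ℂ, ‖c‖ ≤ (1 + q₀ / ‖z‖) ^ 2 * ‖u x - w‖ →
      ‖I / gam q₀ z * c‖ ≤ (1 + q₀ / ‖z‖) ^ 2 / ‖gam q₀ z‖ * ‖u x - w‖ := fun c hc => by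
    rw [norm_mul, norm_div, Complex.norm_I]
    calc 1 / ‖gam q₀ z‖ * ‖c‖ ≤ 1 / ‖gam q₀ z‖ * ((1 + q₀ / ‖z‖) ^ 2 * ‖u x - w‖) :=
          mul_le_mul_of_nonneg_left hc (by positivity)
      _ = _ := by ring
  have hd : ‖(w * conj (u x - w) + conj w * (u x - w)) / z‖
      ≤ (1 + q₀ / ‖z‖) ^ 2 * ‖u x - w‖ :=
    (h.norm_diag_le z x).trans (mul_le_mul_of_nonneg_right (by nlinarith) (norm_nonneg _))
  have hcw : ‖conj w‖ = q₀ := by rw [RCLike.norm_conj, h.norm_eq]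
  have hcu : ‖conj (u x - w)‖ = ‖u x - w‖ := RCLike.norm_conj _
  have ho1 := (norm_offdiag_le (conj (u x - w)) (u x - w) (conj w) z hcw hcu.symm).trans
    (mul_le_mul_of_nonneg_right (by nlinarith : _ ≤ (1 + q₀ / ‖z‖) ^ 2) (norm_nonneg _))
  have ho2 := (norm_offdiag_le (u x - w) (conj (u x - w)) w z h.norm_eq hcu).trans
    (mul_le_mul_of_nonneg_right (by nlinarith : _ ≤ (1 + q₀ / ‖z‖) ^ 2) (norm_nonneg _))
  rw [hcu] at ho1
  fin_cases i <;> fin_cases j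
  · exact key _ hd
  · exact key _ ho1
  · exact key _ ho2
  · exact key _ ((norm_neg _).trans_le hd)

lemma continuous_colR (h : IsPotential q₀ u u' w) (z : ℂ) : Continuous (colR q₀ u w z) := by
  have h1 : Continuous fun x => u x - w := h.continuous.sub continuous_const
  have h2 : Continuous fun x => conj (u x - w) := Complex.continuous_conj.comp h1
  refine continuous_matrix fun i j => ?_
  fin_cases i <;> fin_cases j <;> refine continuous_const.mul ?_
  · exact ((continuous_const.mul h2).add (continuous_const.mul h1)).div_const _
  · exact h2.sub ((continuous_const.mul h1).div_const _)
  · exact h1.sub ((continuous_const.mul h2).div_const _)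
  · exact (((continuous_const.mul h2).add (continuous_const.mul h1)).div_const _).neg

/-- The constant `C` is left free so that a whole family of spectral parameters can share one
dominating function. -/
lemma isVolterra (h : IsPotential q₀ u u' w) {z : ℂ} (hz : z ∈ adm q₀) {C : ℝ}
    (hC : colC q₀ z ≤ C) :
    IsVolterra (colD q₀ z) colE (colR q₀ u w z) fun x => C * ‖u x - w‖ where
  d_re i := by
    fin_cases i
    · simp [colD]
    · have := hz.2.2
      simp [colD]
      linarith
  d_mul i := by fin_cases i <;> simp [colD, colE]
  cont_R := h.continuous_colR z
  cont_m := continuous_const.mul (h.continuous.sub continuous_const).norm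
  m_nonneg x := by
    have h0 : 0 ≤ colC q₀ z := by rw [colC]; positivity
    exact mul_nonneg (h0.trans hC) (norm_nonneg _)
  m_int a := (h.int a).norm.const_mul C
  bound x v := by
    refine (norm_mulVec_le_of_entries (h.norm_colR_le z x) v).trans ?_
    refine mul_le_mul_of_nonneg_right ?_ (norm_nonneg _)
    rw [← mul_assoc]
    exact mul_le_mul_of_nonneg_right hC (norm_nonneg _)

lemma existsUnique_isCol (h : IsPotential q₀ u u' w) {z : ℂ} (hz : z ∈ adm q₀) :
    ∃! f, IsCol q₀ u w z f := by
  obtain ⟨v, hv, huniq⟩ := (h.isVolterra hz le_rfl).existsUnique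
  refine ⟨_, isCol_of_isVolterraSol h.norm_eq hz.1 hz.2.1 hv, fun f hf => ?_⟩
  have := huniq _ (isVolterraSol_of_isCol h.norm_eq hz.1 hz.2.1 hf)
  funext x
  rw [← congrFun this x, ofEigen_toEigen h.norm_eq hz.2.1]

end IsPotential

open Classical in
/-- The model column. -/
def col (q₀ : ℝ) (u : ℝ → ℂ) (w z : ℂ) : ℝ → Fin 2 → ℂ :=
  if h : ∃ f, IsCol q₀ u w z f then h.choose else 0

lemma continuousAt_gam {q₀ : ℝ} {z : ℂ} (hz : z ≠ 0) : ContinuousAt (gam q₀) z :=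
  continuousAt_const.add (continuousAt_const.div (continuousAt_id.pow 2) (pow_ne_zero 2 hz))

lemma differentiableAt_gam {q₀ : ℝ} {z : ℂ} (hz : z ≠ 0) : DifferentiableAt ℂ (gam q₀) z :=
  (differentiableAt_const _).add ((differentiableAt_const _).div (differentiableAt_id.pow 2)
    (pow_ne_zero 2 hz))

lemma differentiableAt_lam {q₀ : ℝ} {z : ℂ} (hz : z ≠ 0) : DifferentiableAt ℂ (lam q₀) z :=
  ((differentiableAt_id).add ((differentiableAt_const _).div differentiableAt_id hz)).const_mul _

namespace IsPotential

variable {q₀ : ℝ} {u u' : ℝ → ℂ} {w : ℂ}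

lemma isCol_col (h : IsPotential q₀ u u' w) {z : ℂ} (hz : z ∈ adm q₀) :
    IsCol q₀ u w z (col q₀ u w z) := by
  have hex := (h.existsUnique_isCol hz).exists
  rw [col, dif_pos hex]
  exact hex.choose_spec

lemma eq_col (h : IsPotential q₀ u u' w) {z : ℂ} (hz : z ∈ adm q₀) {f : ℝ → Fin 2 → ℂ}
    (hf : IsCol q₀ u w z f) : f = col q₀ u w z :=
  (h.existsUnique_isCol hz).unique hf (h.isCol_col hz)

/-- The eigenbasis coordinates of the model column. -/
lemma isVolterraSol_col (h : IsPotential q₀ u u' w) {z : ℂ} (hz : z ∈ adm q₀) :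
    IsVolterraSol (colD q₀ z) colE (colR q₀ u w z) fun x => toEigen q₀ w z (col q₀ u w z x) :=
  isVolterraSol_of_isCol h.norm_eq hz.1 hz.2.1 (h.isCol_col hz)

lemma col_eq (h : IsPotential q₀ u u' w) {z : ℂ} (hz : z ∈ adm q₀) (x : ℝ) :
    col q₀ u w z x = ofEigen w z (toEigen q₀ w z (col q₀ u w z x)) :=
  (ofEigen_toEigen h.norm_eq hz.2.1 _).symm

lemma exists_bound_colC {z₀ : ℂ} (hz : z₀ ≠ 0) (hγ : gam q₀ z₀ ≠ 0) :
    ∃ C, ∀ᶠ z in 𝓝 z₀, colC q₀ z ≤ C := by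
  have hc : ContinuousAt (colC q₀) z₀ :=
    continuousAt_const.mul (((continuousAt_const.add (continuousAt_const.div
      continuousAt_id.norm (norm_ne_zero_iff.2 hz))).pow 2).div (continuousAt_gam hz).norm
      (norm_ne_zero_iff.2 hγ))
  exact ⟨colC q₀ z₀ + 1, (hc.eventually_lt_const (lt_add_one _)).mono fun z hz => hz.le⟩

lemma differentiableAt_colR {x : ℝ} {z : ℂ} (hz : z ≠ 0) (hγ : gam q₀ z ≠ 0) (i j : Fin 2) :
    DifferentiableAt ℂ (fun z => colR q₀ u w z x i j) z := by
  have h1 : DifferentiableAt ℂ (fun z => I / gam q₀ z) z :=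
    (differentiableAt_const _).div (differentiableAt_gam hz) hγ
  have h2 : ∀ c : ℂ, DifferentiableAt ℂ (fun z => c / z) z := fun c =>
    (differentiableAt_const _).div differentiableAt_id hz
  have h3 : ∀ c : ℂ, DifferentiableAt ℂ (fun z => c / z ^ 2) z := fun c =>
    (differentiableAt_const _).div (differentiableAt_id.pow 2) (pow_ne_zero 2 hz)
  fin_cases i <;> fin_cases j
  · exact h1.mul (h2 _)
  · exact h1.mul ((h3 _).const_sub _)
  · exact h1.mul ((h3 _).const_sub _)
  · exact h1.mul (h2 _).neg

lemma differentiableAt_colD {z : ℂ} (hz : z ≠ 0) (i : Fin 2) :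
    DifferentiableAt ℂ (fun z => colD q₀ z i) z := by
  fin_cases i
  · exact differentiableAt_const _
  · exact ((differentiableAt_lam hz).const_mul _).neg

lemma continuousOn_col (h : IsPotential q₀ u u' w) (x : ℝ) (i : Fin 2) :
    ContinuousOn (fun z => col q₀ u w z x i) (adm q₀) := by
  intro z₀ hz₀
  obtain ⟨C, hC⟩ := exists_bound_colC (q₀ := q₀) hz₀.1 hz₀.2.1
  -- A relative neighbourhood of `z₀` on which a single constant dominates, as the parameter lemmas
  -- require.
  set Ω : Set ℂ := adm q₀ ∩ {z | colC q₀ z ≤ C} with hΩ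
  have hv : ∀ j, ContinuousOn (fun z => toEigen q₀ w z (col q₀ u w z x) j) Ω := fun j =>
    continuousOn_sol (d := colD q₀) (R := colR q₀ u w) (e := colE)
      (v := fun z x => toEigen q₀ w z (col q₀ u w z x))
      (fun z hz => h.isVolterra hz.1 hz.2) (fun z hz => h.isVolterraSol_col hz.1)
      (fun i z hz => (differentiableAt_colD hz.1.1 i).continuousAt.continuousWithinAt)
      (fun x i j z hz =>
        (differentiableAt_colR hz.1.1 hz.1.2.1 i j).continuousAt.continuousWithinAt) x j
  have hcol : ContinuousOn (fun z => col q₀ u w z x i) Ω := by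
    refine ContinuousOn.congr (f := fun z =>
      ofEigen w z (toEigen q₀ w z (col q₀ u w z x)) i) ?_ fun z hz =>
        congrFun (h.col_eq hz.1 x) i
    have hdiv : ∀ c : ℂ, ContinuousOn (fun z => c / z) Ω := fun c =>
      continuousOn_const.div continuousOn_id fun z hz => hz.1.1
    fin_cases i
    · exact (hv 0).sub ((hdiv _).mul (hv 1))
    · exact ((hdiv _).mul (hv 0)).add (hv 1)
  exact (hcol z₀ ⟨hz₀, hC.self_of_nhds⟩).mono_of_mem_nhdsWithin
    (inter_mem self_mem_nhdsWithin (mem_nhdsWithin_of_mem_nhds hC))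

lemma differentiableOn_col (h : IsPotential q₀ u u' w) {U : Set ℂ} (hU : IsOpen U)
    (hUa : U ⊆ adm q₀) (x : ℝ) (i : Fin 2) :
    DifferentiableOn ℂ (fun z => col q₀ u w z x i) U := by
  intro z₀ hz₀
  obtain ⟨C, hC⟩ := exists_bound_colC (q₀ := q₀) (hUa hz₀).1 (hUa hz₀).2.1
  obtain ⟨N, hN, hNo, hzN⟩ := eventually_nhds_iff.1 hC
  set Ω : Set ℂ := U ∩ N with hΩ
  have hΩo : IsOpen Ω := hU.inter hNo
  have hv : ∀ j, DifferentiableOn ℂ (fun z => toEigen q₀ w z (col q₀ u w z x) j) Ω := fun j =>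
    differentiableOn_sol (d := colD q₀) (R := colR q₀ u w) (e := colE)
      (v := fun z x => toEigen q₀ w z (col q₀ u w z x)) hΩo
      (fun z hz => h.isVolterra (hUa hz.1) (hN z hz.2))
      (fun z hz => h.isVolterraSol_col (hUa hz.1))
      (fun i z hz => (differentiableAt_colD (hUa hz.1).1 i).differentiableWithinAt)
      (fun x i j z hz =>
        (differentiableAt_colR (hUa hz.1).1 (hUa hz.1).2.1 i j).differentiableWithinAt) x j
  have hcol : DifferentiableOn ℂ (fun z => col q₀ u w z x i) Ω := by
    refine DifferentiableOn.congr (f := fun z =>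
      ofEigen w z (toEigen q₀ w z (col q₀ u w z x)) i) ?_ fun z hz =>
        congrFun (h.col_eq (hUa hz.1) x) i
    have hdiv : ∀ c : ℂ, DifferentiableOn ℂ (fun z => c / z) Ω := fun c =>
      (differentiableOn_const _).div differentiableOn_id fun z hz => (hUa hz.1).1
    fin_cases i
    · exact (hv 0).sub ((hdiv _).mul (hv 1))
    · exact ((hdiv _).mul (hv 0)).add (hv 1)
  exact (hcol.differentiableAt (hΩo.mem_nhds ⟨hz₀, hzN⟩)).differentiableWithinAt

end IsPotential

/-! ### Large spectral parameters -/

section LargeZ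

variable {q₀ : ℝ} {z : ℂ}

/-- The threshold `2 * q₀ + 1` keeps `γ` away from zero, makes `λ` comparable to `z`, and ensures `1
≤ ‖z‖`. -/
lemma div_norm_le_half (h0 : 0 < q₀) (hz : 2 * q₀ + 1 ≤ ‖z‖) : q₀ / ‖z‖ ≤ 1 / 2 := by
  rw [div_le_iff₀ (by linarith)]
  linarith

lemma norm_gam_ge (h0 : 0 < q₀) (hz : 2 * q₀ + 1 ≤ ‖z‖) : 3 / 4 ≤ ‖gam q₀ z‖ := by
  have h1 := div_norm_le_half h0 hz
  have h2 : ‖(q₀ : ℂ) ^ 2 / z ^ 2‖ = (q₀ / ‖z‖) ^ 2 := by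
    rw [norm_div, norm_pow, norm_pow, Complex.norm_real, Real.norm_of_nonneg h0.le, div_pow]
  have h3 : 0 ≤ q₀ / ‖z‖ := by positivity
  have h4 := norm_sub_norm_le (1 : ℂ) (-((q₀ : ℂ) ^ 2 / z ^ 2))
  rw [norm_neg, h2, sub_neg_eq_add, norm_one] at h4
  have : gam q₀ z = 1 + (q₀ : ℂ) ^ 2 / z ^ 2 := rfl
  rw [this]
  nlinarith

lemma norm_I_div_gam_le (h0 : 0 < q₀) (hz : 2 * q₀ + 1 ≤ ‖z‖) : ‖I / gam q₀ z‖ ≤ 4 / 3 := by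
  have := norm_gam_ge h0 hz
  rw [norm_div, Complex.norm_I, div_le_iff₀ (by linarith)]
  linarith

lemma colC_le (h0 : 0 < q₀) (hz : 2 * q₀ + 1 ≤ ‖z‖) : colC q₀ z ≤ 6 := by
  have h1 := div_norm_le_half h0 hz
  have h2 := norm_gam_ge h0 hz
  have h3 : 0 ≤ q₀ / ‖z‖ := by positivity
  rw [colC]
  have : (1 + q₀ / ‖z‖) ^ 2 / ‖gam q₀ z‖ ≤ 3 := by
    rw [div_le_iff₀ (by linarith)]
    nlinarith
  linarith

lemma norm_two_I_lam_ge (h0 : 0 < q₀) (hz : 2 * q₀ + 1 ≤ ‖z‖) :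
    ‖z‖ / 2 ≤ ‖-(2 * I * lam q₀ z)‖ := by
  have hz0 : 0 < ‖z‖ := by linarith
  have h1 : ‖-(2 * I * lam q₀ z)‖ = ‖z + (q₀ : ℂ) ^ 2 / z‖ := by
    rw [lam, norm_neg, norm_mul, norm_mul, norm_mul, Complex.norm_I]
    simp
  have h2 : ‖(q₀ : ℂ) ^ 2 / z‖ ≤ ‖z‖ / 2 := by
    rw [norm_div, norm_pow, Complex.norm_real, Real.norm_of_nonneg h0.le, div_le_iff₀ hz0]
    nlinarith
  have h4 := norm_sub_norm_le z (-((q₀ : ℂ) ^ 2 / z))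
  rw [norm_neg, sub_neg_eq_add] at h4
  rw [h1]
  linarith

end LargeZ

namespace IsPotential

variable {q₀ : ℝ} {u u' : ℝ → ℂ} {w : ℂ}

lemma exists_bound_sub (h : IsPotential q₀ u u' w) (a : ℝ) :
    ∃ c, 0 ≤ c ∧ ∀ s, a ≤ s → ‖u s - w‖ ≤ c := by
  have hlim : Tendsto (fun s => u s - w) atTop (𝓝 0) := by
    simpa using h.tendsto.sub_const w
  obtain ⟨N, hN⟩ := eventually_atTop.1 (hlim.norm.eventually_le_const (lt_add_one ‖(0 : ℂ)‖))
  obtain ⟨C, hC⟩ := (isCompact_Icc (a := a) (b := N)).exists_bound_of_continuousOn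
    (h.continuous.sub continuous_const).continuousOn
  refine ⟨max C (‖(0 : ℂ)‖ + 1), le_max_of_le_right (by positivity), fun x hx => ?_⟩
  rcases le_total x N with hxN | hxN
  · exact (hC x ⟨hx, hxN⟩).trans (le_max_left _ _)
  · exact (hN x hxN).trans (le_max_right _ _)

/-- The lower off-diagonal entry of `colR`. -/
def lowR (q₀ : ℝ) (w z y : ℂ) : ℂ := I / gam q₀ z * (y - w ^ 2 * conj y / z ^ 2)

lemma norm_lowR_le (h : IsPotential q₀ u u' w) {z : ℂ} (hz : 2 * q₀ + 1 ≤ ‖z‖) (y : ℂ) :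
    ‖lowR q₀ w z y‖ ≤ 2 * ‖y‖ := by
  have h1 := div_norm_le_half h.pos hz
  have h0 : 0 ≤ q₀ / ‖z‖ := div_nonneg h.pos.le (norm_nonneg _)
  rw [lowR, norm_mul]
  have h2 := norm_offdiag_le y (conj y) w z h.norm_eq (RCLike.norm_conj _)
  have h3 := norm_I_div_gam_le h.pos hz
  have h4 : (1 + (q₀ / ‖z‖) ^ 2) * ‖y‖ ≤ 3 / 2 * ‖y‖ :=
    mul_le_mul_of_nonneg_right (by nlinarith) (norm_nonneg _)
  calc _ ≤ 4 / 3 * (3 / 2 * ‖y‖) :=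
        mul_le_mul h3 (h2.trans h4) (norm_nonneg _) (by norm_num)
    _ = _ := by ring

lemma norm_colR_diag_le (h : IsPotential q₀ u u' w) {z : ℂ} (hz : 2 * q₀ + 1 ≤ ‖z‖) (x : ℝ) :
    ‖I / gam q₀ z * ((w * conj (u x - w) + conj w * (u x - w)) / z)‖
      ≤ 3 * q₀ * ‖u x - w‖ / ‖z‖ := by
  have h3 := norm_I_div_gam_le h.pos hz
  have h0 := h.pos
  rw [norm_mul]
  calc _ ≤ 4 / 3 * (2 * (q₀ / ‖z‖) * ‖u x - w‖) :=
        mul_le_mul h3 (h.norm_diag_le z x) (norm_nonneg _) (by norm_num)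
    _ = 8 / 3 * (q₀ * ‖u x - w‖ / ‖z‖) := by ring
    _ ≤ 3 * (q₀ * ‖u x - w‖ / ‖z‖) := mul_le_mul_of_nonneg_right (by norm_num) (by positivity)
    _ = _ := by ring

/-- The eigenbasis coordinates of the model column are `(1, 0) + O(1/z)`. -/
lemma exists_bound_eigen (h : IsPotential q₀ u u' w) (x : ℝ) :
    ∃ K, ∀ z ∈ adm q₀, 2 * q₀ + 1 ≤ ‖z‖ → ∀ v,
      IsVolterraSol (colD q₀ z) colE (colR q₀ u w z) v →
      ‖v x 0 - 1‖ ≤ K / ‖z‖ ∧ ‖v x 1‖ ≤ K / ‖z‖ ∧ ‖v x 0‖ ≤ K := by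
  have h0 := h.pos
  -- The factor `6` bounds `colC` for all large `z`, so the weight and the bound `b a` on solutions
  -- over `[a, ∞)` do not depend on `z`.
  set m : ℝ → ℝ := fun x => 6 * ‖u x - w‖ with hm
  have hm0 : ∀ x, 0 ≤ m x := fun x => by positivity
  have hmi : ∀ a, IntegrableOn m (Set.Ioi a) := fun a => (h.int a).norm.const_mul 6
  choose c hc0 hc using h.exists_bound_sub
  set b : ℝ → ℝ := fun a => 2 * ‖colE‖ * wt m a with hb
  have hb0 : ∀ a, 0 ≤ b a := fun a => mul_nonneg (by positivity) (Real.exp_pos _).le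
  -- An integrable majorant of `‖z‖ * ‖g‖` on `[a, ∞)`, where `g` is the source left after the
  -- integration by parts below; `u'` comes from differentiating `B`.
  set hh : ℝ → ℝ → ℝ := fun a s => b a * ((3 * q₀ + 24 * c a) * ‖u s - w‖ + 4 * ‖u' s‖) with hhh
  have hhi : ∀ a, IntegrableOn (hh a) (Set.Ioi a) := fun a =>
    (((h.int a).norm.const_mul _).add ((h.int_deriv a).norm.const_mul 4)).const_mul _
  set H : ℝ := ∫ s in Set.Ioi x, hh x s with hH
  set H1 : ℝ := H + 4 * c x * b x with hH1
  set K0 : ℝ := ∫ s in Set.Ioi x, (3 * q₀ * b x + 2 * H1) * ‖u s - w‖ with hK0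
  have hhpos : ∀ a s, 0 ≤ hh a s := fun a s => by
    have := hb0 a; have := hc0 a; positivity
  have hH0 : 0 ≤ H := integral_nonneg fun s => hhpos x s
  have hH10 : 0 ≤ H1 := by
    have := hb0 x; have := hc0 x; positivity
  refine ⟨max K0 (max H1 (b x)), fun z hz hzl v hv => ?_⟩
  have hz0 : 0 < ‖z‖ := by linarith
  have hV := h.isVolterra hz (colC_le h0 hzl)
  have hvb : ∀ a s, a ≤ s → ‖v s‖ ≤ b a := fun a s has =>
    (hV.norm_sol_le hv s).trans
      (mul_le_mul_of_nonneg_left (wt_anti hm0 hmi has) (by positivity))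
  have hvc : Continuous v := hv.tame.1
  set C : ℂ := -(2 * I * lam q₀ z) with hC
  have hCn : ‖z‖ / 2 ≤ ‖C‖ := norm_two_I_lam_ge h0 hzl
  have hC0 : C ≠ 0 := norm_pos_iff.1 (by linarith)
  have hCre : 0 ≤ C.re := hV.d_re 1
  have hCinv : ∀ y : ℂ, ‖y / C‖ ≤ 2 * ‖y‖ / ‖z‖ := fun y => by
    rw [norm_div, div_le_div_iff₀ (norm_pos_iff.2 hC0) hz0]
    nlinarith [norm_nonneg y]
  set A : ℝ → ℂ := fun s => I / gam q₀ z * ((w * conj (u s - w) + conj w * (u s - w)) / z) with hA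
  set B : ℝ → ℂ := fun s => lowR q₀ w z (u s - w) with hB
  set B' : ℝ → ℂ := fun s => lowR q₀ w z (u' s) with hB'
  have hRv0 : ∀ s, (colR q₀ u w z s *ᵥ v s) 0 = A s * v s 0 + colR q₀ u w z s 0 1 * v s 1 :=
    fun s => by
      simp [Matrix.mulVec, dotProduct, Fin.sum_univ_two, colR, hA]
  have hRv1 : ∀ s, (colR q₀ u w z s *ᵥ v s) 1 = B s * v s 0 - A s * v s 1 := fun s => by
    simp [Matrix.mulVec, dotProduct, Fin.sum_univ_two, colR, hA, hB, lowR]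
    ring
  have hv0d : ∀ s, HasDerivAt (fun s => v s 0) ((colR q₀ u w z s *ᵥ v s) 0) s := fun s =>
    (hasDerivAt_pi.1 (hv.1 s) 0).congr_deriv (by simp [colD])
  have hv1d : ∀ s, HasDerivAt (fun s => v s 1) (C * v s 1 + (B s * v s 0 - A s * v s 1)) s :=
    fun s => (hasDerivAt_pi.1 (hv.1 s) 1).congr_deriv (by rw [hRv1]; simp [colD, hC])
  have hBd : ∀ s, HasDerivAt B (B' s) s := fun s => by
    have h1 := (h.hasDerivAt s).sub_const w
    have h2 := IsSolution.hasDerivAt_conj h1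
    exact (h1.sub ((h2.const_mul (w ^ 2)).div_const (z ^ 2))).const_mul _
  set g : ℝ → ℂ := fun s => -(A s * v s 1)
    + (B' s * v s 0 + B s * (colR q₀ u w z s *ᵥ v s) 0) / C with hg
  -- Integration by parts. The second component has rate `C` of size `‖z‖` and a source `B v₀` that
  -- is not small. Adding `B v₀ / C` trades this source for its derivative divided by `C`; the rest
  -- of `g` contains `A`, which is already `O(1/z)`.
  set y : ℝ → ℂ := fun s => v s 1 + B s * v s 0 / C with hy
  have hyd : ∀ s, HasDerivAt y (C * y s + g s) s := fun s => by
    refine ((hv1d s).add (((hBd s).mul (hv0d s)).div_const C)).congr_deriv ?_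
    simp only [hy, hg]
    field_simp
    ring
  have hvi : ∀ i a s, a ≤ s → ‖v s i‖ ≤ b a := fun i a s has =>
    (norm_le_pi_norm _ i).trans (hvb a s has)
  have hgb : ∀ a s, a ≤ s → ‖g s‖ ≤ hh a s / ‖z‖ := fun a s has => by
    have g1 : ‖A s * v s 1‖ ≤ 3 * q₀ * ‖u s - w‖ / ‖z‖ * b a := by
      rw [norm_mul]
      exact mul_le_mul (h.norm_colR_diag_le hzl s) (hvi 1 a s has) (norm_nonneg _) (by positivity)
    have g2 : ‖B' s * v s 0‖ ≤ 2 * ‖u' s‖ * b a := by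
      rw [norm_mul]
      exact mul_le_mul (h.norm_lowR_le hzl _) (hvi 0 a s has) (norm_nonneg _) (by positivity)
    have g3 : ‖B s * (colR q₀ u w z s *ᵥ v s) 0‖ ≤ 2 * c a * (6 * ‖u s - w‖ * b a) := by
      rw [norm_mul]
      refine mul_le_mul ((h.norm_lowR_le hzl _).trans
        (mul_le_mul_of_nonneg_left (hc a s has) zero_le_two)) ?_ (norm_nonneg _)
        (mul_nonneg zero_le_two (hc0 a))
      exact (norm_le_pi_norm _ 0).trans ((hV.bound s _).trans
        (mul_le_mul_of_nonneg_left (hvb a s has) (by positivity)))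
    have g4 := hCinv (B' s * v s 0 + B s * (colR q₀ u w z s *ᵥ v s) 0)
    have g5 : ‖(B' s * v s 0 + B s * (colR q₀ u w z s *ᵥ v s) 0) / C‖
        ≤ 2 * (2 * ‖u' s‖ * b a + 2 * c a * (6 * ‖u s - w‖ * b a)) / ‖z‖ := by
      refine g4.trans (div_le_div_of_nonneg_right ?_ hz0.le)
      exact mul_le_mul_of_nonneg_left ((norm_add_le _ _).trans (add_le_add g2 g3)) zero_le_two
    calc ‖g s‖ ≤ ‖-(A s * v s 1)‖ + ‖(B' s * v s 0 + B s * (colR q₀ u w z s *ᵥ v s) 0) / C‖ :=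
          norm_add_le _ _
      _ ≤ 3 * q₀ * ‖u s - w‖ / ‖z‖ * b a
          + 2 * (2 * ‖u' s‖ * b a + 2 * c a * (6 * ‖u s - w‖ * b a)) / ‖z‖ := by
          rw [norm_neg]; exact add_le_add g1 g5
      _ = hh a s / ‖z‖ := by simp only [hhh]; ring
  have hAc : Continuous A := by
    have h1 : Continuous fun x => u x - w := h.continuous.sub continuous_const
    have h2 : Continuous fun x => conj (u x - w) := Complex.continuous_conj.comp h1
    exact continuous_const.mul (((continuous_const.mul h2).add
      (continuous_const.mul h1)).div_const _)
  have hBc : Continuous B := continuous_iff_continuousAt.2 fun s => (hBd s).continuousAt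
  have hBc' : Continuous B' := by
    have h2 : Continuous fun x => conj (u' x) := Complex.continuous_conj.comp h.cont_deriv
    exact continuous_const.mul (h.cont_deriv.sub ((continuous_const.mul h2).div_const _))
  have hgc : Continuous g := by
    have e0 : Continuous fun s => v s 0 := (continuous_apply 0).comp hvc
    have e1 : Continuous fun s => v s 1 := (continuous_apply 1).comp hvc
    exact (hAc.mul e1).neg.add (((hBc'.mul e0).add
      (hBc.mul (hV.continuous_mulVec hvc 0))).div_const _)
  have hgi : ∀ a, IntegrableOn g (Set.Ioi a) := fun a =>
    Integrable.mono' ((hhi a).div_const ‖z‖) hgc.aestronglyMeasurable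
      ((ae_restrict_iff' measurableSet_Ioi).2
        (Eventually.of_forall fun s hs => hgb a s (le_of_lt hs)))
  have hBlim : Tendsto B atTop (𝓝 0) := by
    have hlim : Tendsto (fun s => ‖u s - w‖) atTop (𝓝 0) := by
      simpa using (h.tendsto.sub_const w).norm
    refine squeeze_zero_norm (fun s => h.norm_lowR_le hzl _) ?_
    simpa using hlim.const_mul 2
  have hylim : Tendsto y atTop (𝓝 0) := by
    have l0 := tendsto_pi_nhds.1 hv.2 0
    have l1 := tendsto_pi_nhds.1 hv.2 1
    simpa [colE] using l1.add ((hBlim.mul l0).div_const C)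
  have hyeq := eq_decayInt hCre hgc hgi hyd hylim
  have hv1 : ∀ s, x ≤ s → ‖v s 1‖ ≤ H1 / ‖z‖ := fun s hs => by
    have y1 : ‖y s‖ ≤ H / ‖z‖ := by
      rw [hyeq]
      refine (norm_decayInt_le hCre (((hhi x).mono_set (Set.Ioi_subset_Ioi hs)).div_const ‖z‖)
        fun r hr => hgb x r (hs.trans hr.le)).trans ?_
      rw [integral_div]
      refine div_le_div_of_nonneg_right ?_ hz0.le
      exact setIntegral_mono_set (hhi x) (Eventually.of_forall fun r => hhpos x r)
        (Set.Ioi_subset_Ioi hs).eventuallyLE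
    have y2 : ‖B s * v s 0 / C‖ ≤ 2 * (2 * c x * b x) / ‖z‖ := by
      refine (hCinv _).trans (div_le_div_of_nonneg_right ?_ hz0.le)
      rw [norm_mul]
      refine mul_le_mul_of_nonneg_left ?_ zero_le_two
      exact mul_le_mul ((h.norm_lowR_le hzl _).trans
        (mul_le_mul_of_nonneg_left (hc x s hs) zero_le_two)) (hvi 0 x s hs) (norm_nonneg _)
        (mul_nonneg zero_le_two (hc0 x))
    calc ‖v s 1‖ = ‖y s - B s * v s 0 / C‖ := by simp only [hy, add_sub_cancel_right]
      _ ≤ ‖y s‖ + ‖B s * v s 0 / C‖ := norm_sub_le _ _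
      _ ≤ H / ‖z‖ + 2 * (2 * c x * b x) / ‖z‖ := add_le_add y1 y2
      _ = H1 / ‖z‖ := by rw [hH1]; ring
  have hR01 : ∀ s, ‖colR q₀ u w z s 0 1‖ ≤ 2 * ‖u s - w‖ := fun s => by
    have e := (norm_offdiag_le (conj (u s - w)) (u s - w) (conj w) z
      (by rw [RCLike.norm_conj, h.norm_eq]) (RCLike.norm_conj _).symm)
    have h1 := div_norm_le_half h0 hzl
    have h0' : 0 ≤ q₀ / ‖z‖ := by positivity
    rw [RCLike.norm_conj] at e
    have e2 : (1 + (q₀ / ‖z‖) ^ 2) * ‖u s - w‖ ≤ 3 / 2 * ‖u s - w‖ :=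
      mul_le_mul_of_nonneg_right (by nlinarith) (norm_nonneg _)
    have e3 : ‖colR q₀ u w z s 0 1‖ = ‖I / gam q₀ z‖
        * ‖conj (u s - w) - conj w ^ 2 * (u s - w) / z ^ 2‖ := by
      rw [← norm_mul]; simp [colR]
    rw [e3]
    calc _ ≤ 4 / 3 * (3 / 2 * ‖u s - w‖) :=
          mul_le_mul (norm_I_div_gam_le h0 hzl) (e.trans e2) (norm_nonneg _) (by norm_num)
      _ = _ := by ring
  refine ⟨?_, (hv1 x le_rfl).trans (div_le_div_of_nonneg_right ((le_max_left _ _).trans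
    (le_max_right _ _)) hz0.le), (hvi 0 x x le_rfl).trans ((le_max_right _ _).trans
    (le_max_right _ _))⟩
  -- With the second component known to be `O(1/z)`, the source `A v₀ + R₀₁ v₁` of the first one is
  -- `O(1/z)` times an integrable function, and its rate is zero.
  have hfix := congrFun (congrFun (hV.fixed_of_isVolterraSol hv) x) 0
  have e1 : v x 0 - 1 = decayInt 0 (fun s => (colR q₀ u w z s *ᵥ v s) 0) x := by
    rw [← hfix]
    simp [volterraStep, colE, colD]
  rw [e1]
  refine (norm_decayInt_le (by simp) (h := fun s => (3 * q₀ * b x + 2 * H1) * ‖u s - w‖ / ‖z‖)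
    (((h.int x).norm.const_mul _).div_const _) fun s hs => ?_).trans ?_
  · rw [hRv0]
    have e2 : ‖A s * v s 0‖ ≤ 3 * q₀ * ‖u s - w‖ / ‖z‖ * b x := by
      rw [norm_mul]
      exact mul_le_mul (h.norm_colR_diag_le hzl s) (hvi 0 x s hs.le) (norm_nonneg _)
        (by positivity)
    have e3 : ‖colR q₀ u w z s 0 1 * v s 1‖ ≤ 2 * ‖u s - w‖ * (H1 / ‖z‖) := by
      rw [norm_mul]
      exact mul_le_mul (hR01 s) (hv1 s hs.le) (norm_nonneg _) (by positivity)
    refine (norm_add_le _ _).trans ((add_le_add e2 e3).trans (le_of_eq ?_))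
    ring
  · rw [integral_div]
    exact div_le_div_of_nonneg_right (le_max_left _ _) hz0.le

/-- The model column is `(1, 0) + O(1/z)`. -/
lemma exists_bound_col (h : IsPotential q₀ u u' w) (x : ℝ) :
    ∃ K, ∀ z ∈ adm q₀, 2 * q₀ + 1 ≤ ‖z‖ →
      ‖col q₀ u w z x 0 - 1‖ ≤ K / ‖z‖ ∧ ‖col q₀ u w z x 1‖ ≤ K / ‖z‖ := by
  obtain ⟨K, hK⟩ := h.exists_bound_eigen x
  have h0 := h.pos
  refine ⟨K + q₀ * K, fun z hz hzl => ?_⟩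
  have hz1 : 1 ≤ ‖z‖ := by linarith
  have hz0 : 0 < ‖z‖ := by linarith
  obtain ⟨k0, k1, k2⟩ := hK z hz hzl _ (h.isVolterraSol_col hz)
  have hK0 : 0 ≤ K := (norm_nonneg _).trans k2
  rw [h.col_eq hz x]
  set v := toEigen q₀ w z (col q₀ u w z x)
  have k1' : ‖v 1‖ ≤ K := k1.trans (div_le_self hK0 hz1)
  constructor
  · have e : ofEigen w z v 0 - 1 = (v 0 - 1) - conj w / z * v 1 := by simp [ofEigen]; ring
    rw [e]
    refine (norm_sub_le _ _).trans ?_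
    rw [add_div]
    refine add_le_add k0 ?_
    rw [norm_mul, norm_div, RCLike.norm_conj, h.norm_eq]
    calc q₀ / ‖z‖ * ‖v 1‖ ≤ q₀ / ‖z‖ * K := mul_le_mul_of_nonneg_left k1' (by positivity)
      _ = _ := by ring
  · have e : ofEigen w z v 1 = v 1 + w / z * v 0 := by simp [ofEigen]; ring
    rw [e]
    refine (norm_add_le _ _).trans ?_
    rw [add_div]
    refine add_le_add k1 ?_
    rw [norm_mul, norm_div, h.norm_eq]
    calc q₀ / ‖z‖ * ‖v 0‖ ≤ q₀ / ‖z‖ * K := mul_le_mul_of_nonneg_left k2 (by positivity)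
      _ = _ := by ring

end IsPotential

/-! ### Regions of the spectral plane -/

section Regions

variable {q₀ : ℝ} {z : ℂ}

/-- The numerator is the product whose sign defines `D⁺` and `D⁻`, so these are the regions where
`Im λ` is positive and negative. -/
lemma lam_im (q₀ : ℝ) (hz : z ≠ 0) :
    (lam q₀ z).im = (‖z‖ ^ 2 - q₀ ^ 2) * z.im / (2 * ‖z‖ ^ 2) := by
  have h : 0 < ‖z‖ := norm_pos_iff.2 hz
  have e : (lam q₀ z).im = 1 / 2 * (z.im + -(q₀ ^ 2 * z.im / ‖z‖ ^ 2)) := by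
    rw [lam, ← Complex.normSq_eq_norm_sq]
    have h1 : (1 / 2 : ℂ) = ((1 / 2 : ℝ) : ℂ) := by push_cast; rfl
    have h2 : (q₀ : ℂ) ^ 2 = ((q₀ ^ 2 : ℝ) : ℂ) := by push_cast; rfl
    rw [h1, h2, Complex.im_ofReal_mul, Complex.add_im, Complex.div_im]
    simp only [Complex.ofReal_im, Complex.ofReal_re]
    ring
  rw [e]
  field_simp
  ring

lemma gam_ne_zero_of_norm_ne (hz : z ≠ 0) (h : ‖z‖ ≠ |q₀|) : gam q₀ z ≠ 0 := by
  intro h0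
  rw [gam] at h0
  have hz2 : z ^ 2 ≠ 0 := pow_ne_zero 2 hz
  field_simp at h0
  have h1 : z ^ 2 = -(q₀ : ℂ) ^ 2 := by linear_combination h0
  have h2 : ‖z‖ ^ 2 = |q₀| ^ 2 := by
    rw [← norm_pow, h1, norm_neg, norm_pow, Complex.norm_real, Real.norm_eq_abs]
  exact h ((pow_left_inj₀ (norm_nonneg _) (abs_nonneg _) two_ne_zero).1 h2)

lemma isOpen_Dplus (q₀ : ℝ) : IsOpen (Dplus q₀) :=
  isOpen_lt continuous_const (by fun_prop)

lemma isOpen_Dminus (q₀ : ℝ) : IsOpen (Dminus q₀) :=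
  isOpen_lt (by fun_prop) continuous_const

lemma neg_mem_Dplus_iff : -z ∈ Dplus q₀ ↔ z ∈ Dminus q₀ := by
  simp [Dplus, Dminus]

lemma neg_mem_Sigma_iff : -z ∈ Sigma q₀ ↔ z ∈ Sigma q₀ := by
  simp [Sigma]

lemma neg_mem_SigmaReg_iff : -z ∈ SigmaReg q₀ ↔ z ∈ SigmaReg q₀ := by
  simp only [SigmaReg, Set.mem_sdiff, neg_mem_Sigma_iff, Set.mem_insert_iff,
    Set.mem_singleton_iff, neg_eq_iff_eq_neg, neg_neg, neg_zero]
  tauto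

lemma not_mem_Dminus_of_mem_Dplus (h : z ∈ Dplus q₀) : z ∉ Dminus q₀ := fun h' =>
  lt_asymm (show 0 < (‖z‖ ^ 2 - q₀ ^ 2) * z.im from h) h'

lemma mem_compl_Sigma (hq₀ : 0 < q₀) (h : z ∈ (Sigma q₀)ᶜ) : z ∈ Dplus q₀ ∨ z ∈ Dminus q₀ := by
  have h' : ¬(z.im = 0 ∨ ‖z‖ = q₀) := h
  rw [not_or] at h'
  have h1 : ‖z‖ ^ 2 - q₀ ^ 2 ≠ 0 := fun h0 => h'.2
    ((pow_left_inj₀ (norm_nonneg _) hq₀.le two_ne_zero).1 (sub_eq_zero.1 h0))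
  exact (lt_or_gt_of_ne (mul_ne_zero h1 h'.1)).symm

lemma Dplus_subset_adm (q₀ : ℝ) : Dplus q₀ ⊆ adm q₀ := fun z hz => by
  have hz' : 0 < (‖z‖ ^ 2 - q₀ ^ 2) * z.im := hz
  have hz0 : z ≠ 0 := by rintro rfl; simp at hz'
  have hn : ‖z‖ ≠ |q₀| := fun h => by
    rw [h, sq_abs] at hz'
    simp at hz'
  refine ⟨hz0, gam_ne_zero_of_norm_ne hz0 hn, ?_⟩
  rw [lam_im q₀ hz0]
  positivity

/-- On the contour `λ` is real, and the excluded branch points are the zeros of `γ`. -/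
lemma SigmaReg_subset_adm (q₀ : ℝ) : SigmaReg q₀ ⊆ adm q₀ := fun z hz => by
  obtain ⟨hS, hne⟩ := hz
  simp only [Set.mem_insert_iff, Set.mem_singleton_iff, not_or] at hne
  refine ⟨hne.1, fun h0 => ?_, ?_⟩
  · rw [gam] at h0
    have hz := hne.1
    field_simp at h0
    have h1 : (z - I * q₀) * (z + I * q₀) = 0 := by
      linear_combination h0 - (q₀ : ℂ) ^ 2 * I_sq
    rcases mul_eq_zero.1 h1 with h | h
    · exact hne.2.1 (sub_eq_zero.1 h)
    · exact hne.2.2 (eq_neg_of_add_eq_zero_left h)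
  · rw [lam_im q₀ hne.1]
    rcases hS with h | h <;> simp [h]

lemma adm_of_plus (h : z ∈ Dplus q₀ ∪ SigmaReg q₀) : z ∈ adm q₀ :=
  h.elim (fun h => Dplus_subset_adm q₀ h) fun h => SigmaReg_subset_adm q₀ h

lemma adm_of_minus (h : z ∈ Dminus q₀ ∪ SigmaReg q₀) : -z ∈ adm q₀ :=
  adm_of_plus (h.imp neg_mem_Dplus_iff.2 neg_mem_SigmaReg_iff.2)

lemma mem_SigmaReg_of_norm_ne (hz : z ∈ Sigma q₀) (h0 : z ≠ 0) (hn : ‖z‖ ≠ |q₀|) :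
    z ∈ SigmaReg q₀ := by
  refine ⟨hz, ?_⟩
  simp only [Set.mem_insert_iff, Set.mem_singleton_iff, not_or]
  refine ⟨h0, ?_, ?_⟩ <;> rintro rfl <;> simp at hn

lemma kz_neg (q₀ : ℝ) (z : ℂ) : kz q₀ (-z) = -kz q₀ z := by
  simp only [kz, div_neg]; ring

lemma lam_neg (q₀ : ℝ) (z : ℂ) : lam q₀ (-z) = -lam q₀ z := by
  simp only [lam, div_neg]; ring

lemma gam_neg (q₀ : ℝ) (z : ℂ) : gam q₀ (-z) = gam q₀ z := by
  simp only [gam, neg_sq]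

lemma kz_div (hq₀ : q₀ ≠ 0) (hz : z ≠ 0) : kz q₀ ((q₀ : ℂ) ^ 2 / z) = -kz q₀ z := by
  have : (q₀ : ℂ) ≠ 0 := by exact_mod_cast hq₀
  rw [kz, kz]; field_simp; ring

lemma lam_div (hq₀ : q₀ ≠ 0) (hz : z ≠ 0) : lam q₀ ((q₀ : ℂ) ^ 2 / z) = lam q₀ z := by
  have : (q₀ : ℂ) ≠ 0 := by exact_mod_cast hq₀
  rw [lam, lam]; field_simp; ring

lemma gam_div (hq₀ : q₀ ≠ 0) (hz : z ≠ 0) :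
    gam q₀ ((q₀ : ℂ) ^ 2 / z) = z ^ 2 / (q₀ : ℂ) ^ 2 * gam q₀ z := by
  have : (q₀ : ℂ) ≠ 0 := by exact_mod_cast hq₀
  rw [gam, gam]; field_simp; ring

lemma div_mem_adm (hq₀ : q₀ ≠ 0) (hz : z ∈ adm q₀) : (q₀ : ℂ) ^ 2 / z ∈ adm q₀ := by
  have h : (q₀ : ℂ) ≠ 0 := by exact_mod_cast hq₀
  refine ⟨div_ne_zero (pow_ne_zero 2 h) hz.1, ?_, ?_⟩
  · rw [gam_div hq₀ hz.1]
    exact mul_ne_zero (div_ne_zero (pow_ne_zero 2 hz.1) (pow_ne_zero 2 h)) hz.2.1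
  · rw [lam_div hq₀ hz.1]
    exact hz.2.2

end Regions

/-! ### Symmetries of the Jost columns -/

lemma IsPotential.conj {q₀ : ℝ} {u u' : ℝ → ℂ} {w : ℂ} (h : IsPotential q₀ u u' w) :
    IsPotential q₀ (fun x => conj (u x)) (fun x => conj (u' x)) (conj w) where
  pos := h.pos
  norm_eq := by rw [RCLike.norm_conj, h.norm_eq]
  hasDerivAt x := IsSolution.hasDerivAt_conj (h.hasDerivAt x)
  cont_deriv := Complex.continuous_conj.comp h.cont_deriv
  tendsto := (Complex.continuous_conj.tendsto _).comp h.tendsto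
  int a := by
    have h1 := Complex.continuous_conj.comp (h.continuous.sub (continuous_const (y := w)))
    refine Integrable.mono (h.int a) (?_ : Continuous _).aestronglyMeasurable
      (Eventually.of_forall fun x => ?_)
    · refine h1.congr fun x => ?_
      simp
    · rw [← map_sub, RCLike.norm_conj]
  int_deriv a := by
    refine Integrable.mono (h.int_deriv a)
      (Complex.continuous_conj.comp h.cont_deriv).aestronglyMeasurable
      (Eventually.of_forall fun x => ?_)
    rw [RCLike.norm_conj]

def swap (f : Fin 2 → ℂ) : Fin 2 → ℂ := ![f 1, f 0]

lemma continuous_swap : Continuous swap := by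
  refine continuous_pi fun i => ?_
  fin_cases i
  · exact continuous_apply 1
  · exact continuous_apply 0

/-- The symmetry `z ↦ q₀² / z`, for which `k ↦ -k` and `λ ↦ λ`. -/
lemma IsCol.inversion {q₀ : ℝ} (hq₀ : q₀ ≠ 0) {u : ℝ → ℂ} {w z : ℂ} (hw : ‖w‖ = q₀) (hz : z ≠ 0)
    {f : ℝ → Fin 2 → ℂ}
    (hf : IsCol q₀ (fun x => conj (u x)) (conj w) ((q₀ : ℂ) ^ 2 / z) f) :
    IsCol q₀ u w z fun x => (w / z) • swap (f x) := by
  have hw0 : w ≠ 0 := norm_ne_zero_iff.1 (hw ▸ hq₀)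
  have hq : (q₀ : ℂ) ^ 2 = w * conj w := by rw [Complex.mul_conj', hw]
  have hcw : conj w ≠ 0 := (map_ne_zero _).2 hw0
  constructor
  · intro x
    have h := hasDerivAt_pi.1 (hf.1 x)
    rw [kz_div hq₀ hz, lam_div hq₀ hz] at h
    refine hasDerivAt_pi.2 fun i => ?_
    fin_cases i
    · refine ((h 1).const_mul (w / z)).congr_deriv ?_
      simp [dotProduct, Fin.sum_univ_two, sigma3, Qmat, swap]
      ring
    · refine ((h 0).const_mul (w / z)).congr_deriv ?_
      simp [dotProduct, Fin.sum_univ_two, sigma3, Qmat, swap]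
      ring
  · have h := ((continuous_swap.tendsto _).comp hf.2).const_smul (w / z)
    have e : (w / z) • swap ![1, conj w / ((q₀ : ℂ) ^ 2 / z)] = ![1, w / z] := by
      funext i
      fin_cases i
      · simp [swap, hq]; field_simp
      · simp [swap]
    rw [e] at h
    exact h

lemma col_inversion {q₀ : ℝ} {u u' : ℝ → ℂ} {w z : ℂ} (h : IsPotential q₀ u u' w)
    (hz : z ∈ adm q₀) (x : ℝ) :
    col q₀ u w z x
      = (w / z) • swap (col q₀ (fun x => conj (u x)) (conj w) ((q₀ : ℂ) ^ 2 / z) x) :=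
  (congrFun (h.eq_col hz (IsCol.inversion h.pos.ne' h.norm_eq hz.1
    (h.conj.isCol_col (div_mem_adm h.pos.ne' hz)))) x).symm

/-! ### Reduction of the four Jost columns to the model column -/

section Columns

variable {q₀ : ℝ} {q : ℝ → ℝ → ℂ} {w z : ℂ} {t : ℝ} {f : ℝ → Fin 2 → ℂ}

lemma isJost_top_zero_iff :
    IsJost q₀ q atTop w t z 0 f ↔ IsCol q₀ (fun x => q x t) w z f := by
  have e : (fun i => Ymat w z i 0) = ![1, w / z] := by
    funext i
    fin_cases i
    · simp [Ymat, sigma3, Qmat]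
    · simp [Ymat, sigma3, Qmat]
      linear_combination (-w / z) * I_sq
  rw [IsJost, IsCol, e]
  simp [sigma3, laxX]

/-- Exchanging the two components replaces `σ₃` by `-σ₃` and `q` by `q*`; the sign is absorbed by `z
↦ -z`, which negates both `k` and `λ`. -/
lemma isJost_top_one_iff :
    IsJost q₀ q atTop w t z 1 f ↔
      IsCol q₀ (fun x => conj (q x t)) (conj w) (-z) fun x => swap (f x) := by
  have hY : (fun i => Ymat w z i 1) = ![conj w / -z, 1] := by
    funext i
    fin_cases i
    · simp [Ymat, sigma3, Qmat]
      linear_combination (conj w / z) * I_sq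
    · simp [Ymat, sigma3, Qmat]
  rw [IsJost, IsCol, hY]
  refine and_congr (forall_congr' fun x => ?_) ?_
  · rw [hasDerivAt_pi, hasDerivAt_pi, Fin.forall_fin_two, Fin.forall_fin_two, and_comm]
    simp [swap, dotProduct, Fin.sum_univ_two, sigma3, Qmat, laxX, kz_neg, lam_neg, add_comm,
      mul_comm]
  · rw [tendsto_pi_nhds, tendsto_pi_nhds, Fin.forall_fin_two, Fin.forall_fin_two, and_comm]
    simp [swap]

lemma hasDerivAt_comp_neg_iff {g : ℝ → ℂ} {g' : ℂ} {x : ℝ} :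
    HasDerivAt (fun y => g (-y)) g' x ↔ HasDerivAt g (-g') (-x) := by
  constructor
  · intro h
    have h1 : HasDerivAt (fun y => g (-y)) g' (- -x) := by rwa [neg_neg]
    have h2 := h1.scomp (-x) (hasDerivAt_neg (-x))
    simpa [Function.comp_def] using h2
  · intro h
    have h2 := h.scomp x (hasDerivAt_neg x)
    simpa [Function.comp_def] using h2

lemma hasDerivAt_neg_comp_neg_iff {g : ℝ → ℂ} {g' : ℂ} {x : ℝ} :
    HasDerivAt (fun y => -g (-y)) g' x ↔ HasDerivAt g g' (-x) := by
  have h := hasDerivAt_comp_neg_iff (g := fun y => -g y) (g' := g') (x := x)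
  refine h.trans ⟨fun h => ?_, fun h => h.neg⟩
  exact (h.neg.congr_deriv (neg_neg _)).congr_of_eventuallyEq
    (Eventually.of_forall fun y => (neg_neg (g y)).symm)

lemma tendsto_comp_neg_iff {g : ℝ → ℂ} {a : ℂ} :
    Tendsto (fun x => g (-x)) atTop (𝓝 a) ↔ Tendsto g atBot (𝓝 a) := by
  constructor
  · intro h
    simpa [Function.comp_def] using h.comp tendsto_neg_atBot_atTop
  · intro h
    exact h.comp tendsto_neg_atTop_atBot

/-- Reflecting `x` negates the coefficient matrix, and conjugation by `σ₃` restores the sign of `Q`;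
what remains is the negation of `k` and `λ`, that is `z ↦ -z`. -/
lemma isJost_bot_zero_iff :
    IsJost q₀ q atBot w t z 0 f ↔
      IsCol q₀ (fun x => q (-x) t) w (-z) fun x => ![f (-x) 0, -f (-x) 1] := by
  have hY : (fun i => Ymat w z i 0) = ![1, w / z] := by
    funext i
    fin_cases i
    · simp [Ymat, sigma3, Qmat]
    · simp [Ymat, sigma3, Qmat]
      linear_combination (-w / z) * I_sq
  rw [IsJost, IsCol, hY]
  refine and_congr ⟨fun h x => ?_, fun h x => ?_⟩ ?_
  · have h1 := hasDerivAt_pi.1 (h (-x))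
    refine hasDerivAt_pi.2 (Fin.forall_fin_two.2 ⟨?_, ?_⟩)
    · refine hasDerivAt_comp_neg_iff.2 ((h1 0).congr_deriv ?_)
      simp [dotProduct, Fin.sum_univ_two, sigma3, Qmat, laxX, kz_neg, lam_neg]
      ring
    · refine hasDerivAt_neg_comp_neg_iff.2 ((h1 1).congr_deriv ?_)
      simp [dotProduct, Fin.sum_univ_two, sigma3, Qmat, laxX, kz_neg, lam_neg]
      ring
  · have h1 := hasDerivAt_pi.1 (h (-x))
    refine hasDerivAt_pi.2 (Fin.forall_fin_two.2 ⟨?_, ?_⟩)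
    · have h2 := hasDerivAt_comp_neg_iff (g := fun y => f y 0) |>.1 (h1 0)
      rw [neg_neg] at h2
      refine h2.congr_deriv ?_
      simp [dotProduct, Fin.sum_univ_two, sigma3, Qmat, laxX, kz_neg, lam_neg]
      ring
    · have h2 := hasDerivAt_neg_comp_neg_iff (g := fun y => f y 1) |>.1 (h1 1)
      rw [neg_neg] at h2
      refine h2.congr_deriv ?_
      simp [dotProduct, Fin.sum_univ_two, sigma3, Qmat, laxX, kz_neg, lam_neg]
      ring
  · rw [tendsto_pi_nhds, tendsto_pi_nhds, Fin.forall_fin_two, Fin.forall_fin_two]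
    have e := tendsto_comp_neg_iff (g := fun x => f x 0) (a := 1)
    have e' := tendsto_comp_neg_iff (g := fun x => -f x 1) (a := w / -z)
    simp only [Matrix.cons_val_zero, Matrix.cons_val_one, e, e']
    rw [div_neg]
    exact and_congr_right fun _ => ⟨fun h => h.neg, fun h => by simpa using h.neg⟩

/-- Both reductions are combined: the exchange of components and the reflection each negate `z`, so
`z` itself returns. -/
lemma isJost_bot_one_iff :
    IsJost q₀ q atBot w t z 1 f ↔
      IsCol q₀ (fun x => conj (q (-x) t)) (conj w) z fun x => ![f (-x) 1, -f (-x) 0] := by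
  have hY : (fun i => Ymat w z i 1) = ![-(conj w / z), 1] := by
    funext i
    fin_cases i
    · simp [Ymat, sigma3, Qmat]
      linear_combination (conj w / z) * I_sq
    · simp [Ymat, sigma3, Qmat]
  rw [IsJost, IsCol, hY]
  refine and_congr ⟨fun h x => ?_, fun h x => ?_⟩ ?_
  · have h1 := hasDerivAt_pi.1 (h (-x))
    refine hasDerivAt_pi.2 (Fin.forall_fin_two.2 ⟨?_, ?_⟩)
    · refine hasDerivAt_comp_neg_iff.2 ((h1 1).congr_deriv ?_)
      simp [dotProduct, Fin.sum_univ_two, sigma3, Qmat, laxX]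
      ring
    · refine hasDerivAt_neg_comp_neg_iff.2 ((h1 0).congr_deriv ?_)
      simp [dotProduct, Fin.sum_univ_two, sigma3, Qmat, laxX]
      ring
  · have h1 := hasDerivAt_pi.1 (h (-x))
    refine hasDerivAt_pi.2 (Fin.forall_fin_two.2 ⟨?_, ?_⟩)
    · have h2 := hasDerivAt_neg_comp_neg_iff (g := fun y => f y 0) |>.1 (h1 1)
      rw [neg_neg] at h2
      refine h2.congr_deriv ?_
      simp [dotProduct, Fin.sum_univ_two, sigma3, Qmat, laxX]
      ring
    · have h2 := hasDerivAt_comp_neg_iff (g := fun y => f y 1) |>.1 (h1 0)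
      rw [neg_neg] at h2
      refine h2.congr_deriv ?_
      simp [dotProduct, Fin.sum_univ_two, sigma3, Qmat, laxX]
      ring
  · rw [tendsto_pi_nhds, tendsto_pi_nhds, Fin.forall_fin_two, Fin.forall_fin_two, and_comm]
    have e := tendsto_comp_neg_iff (g := fun x => f x 1) (a := 1)
    have e' := tendsto_comp_neg_iff (g := fun x => -f x 0) (a := conj w / z)
    simp only [Matrix.cons_val_zero, Matrix.cons_val_one, e, e']
    exact and_congr_right fun _ => ⟨fun h => by simpa using h.neg, fun h => by simpa using h.neg⟩

end Columns

/-! ### Jost columns of a solution -/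

lemma integrableOn_Ioi_of_continuous {f : ℝ → ℂ} (hf : Continuous f) {b : ℝ}
    (h : IntegrableOn f (Set.Ioi b)) (a : ℝ) : IntegrableOn f (Set.Ioi a) :=
  (IntegrableOn.union (hf.integrableOn_Icc (a := a) (b := b)) h).mono_set fun x hx =>
    (le_or_gt x b).imp (fun h => ⟨le_of_lt hx, h⟩) id

namespace IsSolution

variable {δ q₀ : ℝ} {qp qm : ℂ} {q : ℝ → ℝ → ℂ}

lemma tendsToConst_top (hq : IsSolution δ q₀ qp qm q) : TendsToConst q atTop qp := by
  intro n hn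
  rcases Nat.eq_zero_or_pos n with rfl | h
  · simpa [dx_zero, constJet] using hq.tendsto_top
  · simpa [constJet, h.ne'] using hq.tendsto_dx_top n h hn

lemma tendsToConst_bot (hq : IsSolution δ q₀ qp qm q) : TendsToConst q atBot qm := by
  intro n hn
  rcases Nat.eq_zero_or_pos n with rfl | h
  · simpa [dx_zero, constJet] using hq.tendsto_bot
  · simpa [constJet, h.ne'] using hq.tendsto_dx_bot n h hn

lemma continuous_slice (hq : IsSolution δ q₀ qp qm q) (t : ℝ) : Continuous fun x => q x t :=
  (hq.contDiff_x t).continuous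

lemma hasDerivAt_slice (hq : IsSolution δ q₀ qp qm q) (x t : ℝ) :
    HasDerivAt (fun x => q x t) (dx q 1 x t) x := by
  have h := hq.hasDerivAt_dx (n := 0) (by norm_num) x t
  simpa only [dx_zero] using h

lemma continuous_slice_dx (hq : IsSolution δ q₀ qp qm q) (t : ℝ) :
    Continuous fun x => dx q 1 x t :=
  (hq.continuous_dx 1 (by norm_num)).comp (continuous_id.prodMk continuous_const)

lemma isPotential_top (hq : IsSolution δ q₀ qp qm q) (t : ℝ) :
    IsPotential q₀ (fun x => q x t) (fun x => dx q 1 x t) qp where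
  pos := hq.q₀_pos
  norm_eq := hq.norm_qp
  hasDerivAt x := hq.hasDerivAt_slice x t
  cont_deriv := hq.continuous_slice_dx t
  tendsto := (tendstoLocallyUniformlyOn_univ.2 hq.tendsto_top).tendsto_at (Set.mem_univ t)
  int := integrableOn_Ioi_of_continuous
    ((hq.continuous_slice t).sub continuous_const)
    ((hq.integrable_top t).mono_set Set.Ioi_subset_Ici_self)
  int_deriv _ := (hq.integrable_dx t).integrableOn

lemma isPotential_bot (hq : IsSolution δ q₀ qp qm q) (t : ℝ) :
    IsPotential q₀ (fun x => q (-x) t) (fun x => -dx q 1 (-x) t) qm where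
  pos := hq.q₀_pos
  norm_eq := hq.norm_qm
  hasDerivAt x := by
    have h := (hq.hasDerivAt_slice (-x) t).scomp x (hasDerivAt_neg x)
    exact h.congr_deriv (by simp)
  cont_deriv := ((hq.continuous_slice_dx t).comp continuous_neg).neg
  tendsto := ((tendstoLocallyUniformlyOn_univ.2 hq.tendsto_bot).tendsto_at
      (Set.mem_univ t)).comp tendsto_neg_atTop_atBot
  int := by
    refine integrableOn_Ioi_of_continuous (b := 0)
      (((hq.continuous_slice t).comp continuous_neg).sub continuous_const) ?_
    have h := (Measure.measurePreserving_neg (volume : Measure ℝ)).integrableOn_comp_preimage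
      (MeasurableEquiv.neg ℝ).measurableEmbedding (f := fun x => q x t - qm) (s := Set.Iio 0)
    have e : (fun x : ℝ => -x) ⁻¹' Set.Iio 0 = Set.Ioi 0 := by
      ext x
      simp
    exact e ▸ h.2 ((hq.integrable_bot t).mono_set Set.Iio_subset_Iic_self)
  int_deriv _ := (hq.integrable_dx t).comp_neg.neg.integrableOn

end IsSolution

lemma existsUnique_of_iff {α β : Type*} {P : α → Prop} {Q : β → Prop} {Φ : α → β} {Ψ : β → α}
    (hPQ : ∀ f, P f ↔ Q (Φ f)) (h₁ : ∀ g, Φ (Ψ g) = g) (h₂ : ∀ f, Ψ (Φ f) = f)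
    (h : ∃! g, Q g) : ∃! f, P f := by
  obtain ⟨g, hg, hu⟩ := h
  refine ⟨Ψ g, (hPQ _).2 ((h₁ g).symm ▸ hg), fun f hf => ?_⟩
  rw [← hu _ ((hPQ f).1 hf), h₂]

section Jost

variable {q₀ : ℝ} {q : ℝ → ℝ → ℂ} {l : Filter ℝ} {w z : ℂ} {t : ℝ} {j : Fin 2}

lemma isJost_jost (h : ∃! f, IsJost q₀ q l w t z j f) :
    IsJost q₀ q l w t z j (jost q₀ q l w t z j) := by
  rw [jost, dif_pos h.exists]
  exact h.exists.choose_spec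

lemma jost_eq (h : ∃! f, IsJost q₀ q l w t z j f) {f : ℝ → Fin 2 → ℂ}
    (hf : IsJost q₀ q l w t z j f) : jost q₀ q l w t z j = f :=
  h.unique (isJost_jost h) hf

end Jost

namespace IsSolution

variable {δ q₀ : ℝ} {qp qm : ℂ} {q : ℝ → ℝ → ℂ} {z : ℂ}

lemma swap_swap (f : Fin 2 → ℂ) : swap (swap f) = f := by
  funext i; fin_cases i <;> rfl

lemma existsUnique_top_zero (hq : IsSolution δ q₀ qp qm q) (hz : z ∈ adm q₀) (t : ℝ) :
    ∃! f, IsJost q₀ q atTop qp t z 0 f :=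
  existsUnique_of_iff (Φ := id) (Ψ := id) (fun _ => isJost_top_zero_iff) (fun _ => rfl)
    (fun _ => rfl) ((hq.isPotential_top t).existsUnique_isCol hz)

lemma existsUnique_top_one (hq : IsSolution δ q₀ qp qm q) (hz : -z ∈ adm q₀) (t : ℝ) :
    ∃! f, IsJost q₀ q atTop qp t z 1 f :=
  existsUnique_of_iff (Φ := fun f x => swap (f x)) (Ψ := fun f x => swap (f x))
    (fun _ => isJost_top_one_iff) (fun f => funext fun x => swap_swap (f x))
    (fun f => funext fun x => swap_swap (f x)) ((hq.isPotential_top t).conj.existsUnique_isCol hz)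

lemma existsUnique_bot_zero (hq : IsSolution δ q₀ qp qm q) (hz : -z ∈ adm q₀) (t : ℝ) :
    ∃! f, IsJost q₀ q atBot qm t z 0 f := by
  refine existsUnique_of_iff (Φ := fun f x => ![f (-x) 0, -f (-x) 1])
    (Ψ := fun f x => ![f (-x) 0, -f (-x) 1])
    (fun _ => isJost_bot_zero_iff) ?_ ?_ ((hq.isPotential_bot t).existsUnique_isCol hz) <;>
  · intro f
    funext x i
    fin_cases i <;> simp

lemma existsUnique_bot_one (hq : IsSolution δ q₀ qp qm q) (hz : z ∈ adm q₀) (t : ℝ) :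
    ∃! f, IsJost q₀ q atBot qm t z 1 f := by
  refine existsUnique_of_iff (Φ := fun f x => ![f (-x) 1, -f (-x) 0])
    (Ψ := fun f x => ![-f (-x) 1, f (-x) 0])
    (fun _ => isJost_bot_one_iff) ?_ ?_ ((hq.isPotential_bot t).conj.existsUnique_isCol hz) <;>
  · intro f
    funext x i
    fin_cases i <;> simp

lemma jost_top_zero (hq : IsSolution δ q₀ qp qm q) (hz : z ∈ adm q₀) (x t : ℝ) :
    jost q₀ q atTop qp t z 0 x = col q₀ (fun x => q x t) qp z x :=
  congrFun (jost_eq (hq.existsUnique_top_zero hz t)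
    (isJost_top_zero_iff.2 ((hq.isPotential_top t).isCol_col hz))) x

lemma jost_top_one (hq : IsSolution δ q₀ qp qm q) (hz : -z ∈ adm q₀) (x t : ℝ) :
    jost q₀ q atTop qp t z 1 x
      = swap (col q₀ (fun x => conj (q x t)) (conj qp) (-z) x) := by
  refine congrFun (jost_eq (hq.existsUnique_top_one hz t)
    (f := fun x => swap (col q₀ (fun x => conj (q x t)) (conj qp) (-z) x))
    (isJost_top_one_iff.2 ?_)) x
  simp only [swap_swap]
  exact (hq.isPotential_top t).conj.isCol_col hz

lemma jost_bot_zero (hq : IsSolution δ q₀ qp qm q) (hz : -z ∈ adm q₀) (x t : ℝ) :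
    jost q₀ q atBot qm t z 0 x
      = ![col q₀ (fun x => q (-x) t) qm (-z) (-x) 0,
          -col q₀ (fun x => q (-x) t) qm (-z) (-x) 1] := by
  refine congrFun (jost_eq (hq.existsUnique_bot_zero hz t)
    (f := fun x => ![col q₀ (fun x => q (-x) t) qm (-z) (-x) 0,
          -col q₀ (fun x => q (-x) t) qm (-z) (-x) 1]) (isJost_bot_zero_iff.2 ?_)) x
  have h := (hq.isPotential_bot t).isCol_col hz
  have e : (fun x => ![col q₀ (fun x => q (-x) t) qm (-z) x 0,
      col q₀ (fun x => q (-x) t) qm (-z) x 1]) = col q₀ (fun x => q (-x) t) qm (-z) := by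
    funext x i
    fin_cases i <;> rfl
  simpa [e] using h

lemma jost_bot_one (hq : IsSolution δ q₀ qp qm q) (hz : z ∈ adm q₀) (x t : ℝ) :
    jost q₀ q atBot qm t z 1 x
      = ![-col q₀ (fun x => conj (q (-x) t)) (conj qm) z (-x) 1,
          col q₀ (fun x => conj (q (-x) t)) (conj qm) z (-x) 0] := by
  refine congrFun (jost_eq (hq.existsUnique_bot_one hz t)
    (f := fun x => ![-col q₀ (fun x => conj (q (-x) t)) (conj qm) z (-x) 1,
          col q₀ (fun x => conj (q (-x) t)) (conj qm) z (-x) 0]) (isJost_bot_one_iff.2 ?_)) x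
  have h := (hq.isPotential_bot t).conj.isCol_col hz
  have e : (fun x => ![col q₀ (fun x => conj (q (-x) t)) (conj qm) z x 0,
      col q₀ (fun x => conj (q (-x) t)) (conj qm) z x 1])
        = col q₀ (fun x => conj (q (-x) t)) (conj qm) z := by
    funext x i
    fin_cases i <;> rfl
  simpa [e] using h

end IsSolution

/-! ### Time evolution -/

/-- The columns of `Y` are eigenvectors of the limiting coefficient matrix. -/
lemma mulVec_Ymat {q₀ : ℝ} {w z : ℂ} (hw : ‖w‖ = q₀) (hz : z ≠ 0) (j : Fin 2) :
    ((I * kz q₀ z) • sigma3 + Qmat w) *ᵥ (fun i => Ymat w z i j)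
      = (I * lam q₀ z * sigma3 j j) • fun i => Ymat w z i j := by
  have h : w * conj w = (q₀ : ℂ) ^ 2 := by rw [Complex.mul_conj', hw]
  rw [kz, lam, ← h]
  funext i
  fin_cases j <;> fin_cases i <;>
    simp [dotProduct, Fin.sum_univ_two, Ymat, sigma3, Qmat] <;> field_simp <;> ring_nf <;>
    simp <;> ring

section Evolution

variable {δ q₀ : ℝ} {qp qm : ℂ} {q : ℝ → ℝ → ℂ} {l : Filter ℝ} {w z : ℂ} {j : Fin 2}

lemma theta_eq (δ q₀ : ℝ) (x t : ℝ) (z : ℂ) :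
    theta δ q₀ x t z = lam q₀ z * (x + omega δ q₀ (kz q₀ z) * t) := rfl

/-- Subtracting the scalar `c = ±iλ` from `X` and `c ω` from `T` makes the column of `Y` stationary
for both limiting systems, as the general evolution result requires. -/
lemma hasDerivAt_jost_t (hq : IsSolution δ q₀ qp qm q) (hl : TendsToConst q l w) (hw : ‖w‖ = q₀)
    (hz : z ≠ 0) (hJ : ∀ t, ∃! f, IsJost q₀ q l w t z j f) (x t : ℝ) :
    HasDerivAt (fun τ => jost q₀ q l w τ z j x)
      (laxT δ q₀ q (kz q₀ z) x t *ᵥ jost q₀ q l w t z j x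
        - (I * lam q₀ z * sigma3 j j * omega δ q₀ (kz q₀ z)) • jost q₀ q l w t z j x) t := by
  set c := I * lam q₀ z * sigma3 j j with hc
  set Ω := omega δ q₀ (kz q₀ z) with hΩ
  have hX : ∀ (x t : ℝ) (v : Fin 2 → ℂ),
      (laxX q (kz q₀ z) x t - c • (1 : Matrix (Fin 2) (Fin 2) ℂ)) *ᵥ v
        = laxX q (kz q₀ z) x t *ᵥ v - c • v := fun x t v => by
    rw [Matrix.sub_mulVec, Matrix.smul_mulVec, Matrix.one_mulVec]
  have h := ZeroCurvature.hasDerivAt_t (hq.zeroCurvature (kz q₀ z) c (c * Ω)) (l := l)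
    (Tinf := Ω • ((I * kz q₀ z) • sigma3 + Qmat w) - (c * Ω) • (1 : Matrix (Fin 2) (Fin 2) ℂ))
    (y := fun i => Ymat w z i j) (f := fun x t => jost q₀ q l w t z j x) ?_ ?_ ?_ ?_ ?_ x t
  · refine h.congr_deriv ?_
    rw [Matrix.sub_mulVec, Matrix.smul_mulVec, Matrix.one_mulVec]
  · intro i j K hK ε hε
    filter_upwards [hl.eventually_laxT (δ := δ) hw (kz q₀ z) i j hK hε] with x hx t ht
    simp only [Matrix.sub_apply, sub_sub_sub_cancel_right]
    exact hx t ht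
  · rw [Matrix.sub_mulVec, Matrix.smul_mulVec, Matrix.smul_mulVec, Matrix.one_mulVec,
      mulVec_Ymat hw hz, smul_smul, mul_comm Ω, sub_self]
  · intro x t
    rw [hX]
    exact (isJost_jost (hJ t)).1 x
  · exact fun t => (isJost_jost (hJ t)).2
  · intro t f₁ f₂ h1 h1' h2 h2'
    simp only [hX] at h1 h2
    exact (hJ t).unique ⟨h1, h1'⟩ ⟨h2, h2'⟩

lemma psi_apply (x t : ℝ) (z : ℂ) (i j : Fin 2) :
    psi δ q₀ q l w x t z i j
      = exp (I * theta δ q₀ x t z * sigma3 j j) * jost q₀ q l w t z j x i := by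
  rw [psi, Matrix.mul_diagonal]
  fin_cases j <;> simp [mu, sigma3, mul_comm]

/-- The exponential factor restores the scalars subtracted for `μ`, because `θ_x = λ` and `θ_t = λ
ω`. -/
lemma jostWellDefined (hq : IsSolution δ q₀ qp qm q) (hl : TendsToConst q l w) (hw : ‖w‖ = q₀)
    (hz : z ≠ 0) (hJ : ∀ t, ∃! f, IsJost q₀ q l w t z j f) :
    JostWellDefined δ q₀ q l w j z := by
  refine ⟨hJ, fun x t => ?_⟩
  have hψ : ∀ x t, (fun i => psi δ q₀ q l w x t z i j)
      = exp (I * theta δ q₀ x t z * sigma3 j j) • jost q₀ q l w t z j x := fun x t => by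
    funext i
    rw [psi_apply]; rfl
  simp only [hψ]
  have hx : HasDerivAt (fun y : ℝ => exp (I * theta δ q₀ y t z * sigma3 j j))
      (exp (I * theta δ q₀ x t z * sigma3 j j) * (I * lam q₀ z * sigma3 j j)) x := by
    have h1 : HasDerivAt (fun y : ℝ => I * theta δ q₀ y t z * sigma3 j j)
        (I * (lam q₀ z * 1) * sigma3 j j) x := by
      simp only [theta_eq]
      exact ((((Complex.ofRealCLM.hasDerivAt (x := x)).add_const _).const_mul _).const_mul
        _).mul_const _
    exact h1.cexp.congr_deriv (by ring)
  have ht : HasDerivAt (fun τ : ℝ => exp (I * theta δ q₀ x τ z * sigma3 j j))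
      (exp (I * theta δ q₀ x t z * sigma3 j j)
        * (I * lam q₀ z * sigma3 j j * omega δ q₀ (kz q₀ z))) t := by
    have h1 : HasDerivAt (fun τ : ℝ => I * theta δ q₀ x τ z * sigma3 j j)
        (I * (lam q₀ z * (omega δ q₀ (kz q₀ z) * 1)) * sigma3 j j) t := by
      simp only [theta_eq]
      exact (((((Complex.ofRealCLM.hasDerivAt (x := t)).const_mul _).const_add _).const_mul
        _).const_mul _).mul_const _
    exact h1.cexp.congr_deriv (by ring)
  constructor
  · refine (hx.smul ((isJost_jost (hJ t)).1 x)).congr_deriv ?_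
    rw [Matrix.mulVec_smul]
    funext i
    simp only [Pi.add_apply, Pi.smul_apply, Pi.sub_apply, smul_eq_mul]
    ring
  · refine (ht.smul (hasDerivAt_jost_t hq hl hw hz hJ x t)).congr_deriv ?_
    rw [Matrix.mulVec_smul]
    funext i
    simp only [Pi.add_apply, Pi.smul_apply, Pi.sub_apply, smul_eq_mul]
    ring

end Evolution

namespace IsSolution

variable {δ q₀ : ℝ} {qp qm : ℂ} {q : ℝ → ℝ → ℂ} {z : ℂ}

lemma ne_zero_of_neg_mem_adm (hz : -z ∈ adm q₀) : z ≠ 0 := neg_ne_zero.1 hz.1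

lemma jostWellDefined_top_zero (hq : IsSolution δ q₀ qp qm q) (hz : z ∈ adm q₀) :
    JostWellDefined δ q₀ q atTop qp 0 z :=
  jostWellDefined hq hq.tendsToConst_top hq.norm_qp hz.1 (hq.existsUnique_top_zero hz)

lemma jostWellDefined_top_one (hq : IsSolution δ q₀ qp qm q) (hz : -z ∈ adm q₀) :
    JostWellDefined δ q₀ q atTop qp 1 z :=
  jostWellDefined hq hq.tendsToConst_top hq.norm_qp (ne_zero_of_neg_mem_adm hz)
    (hq.existsUnique_top_one hz)

lemma jostWellDefined_bot_zero (hq : IsSolution δ q₀ qp qm q) (hz : -z ∈ adm q₀) :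
    JostWellDefined δ q₀ q atBot qm 0 z :=
  jostWellDefined hq hq.tendsToConst_bot hq.norm_qm (ne_zero_of_neg_mem_adm hz)
    (hq.existsUnique_bot_zero hz)

lemma jostWellDefined_bot_one (hq : IsSolution δ q₀ qp qm q) (hz : z ∈ adm q₀) :
    JostWellDefined δ q₀ q atBot qm 1 z :=
  jostWellDefined hq hq.tendsToConst_bot hq.norm_qm hz.1 (hq.existsUnique_bot_one hz)

end IsSolution

/-! ### Scattering data -/

/-- Abel's formula: the derivative of the Wronskian is the trace of `A` times the Wronskian. -/
lemma hasDerivAt_wronskian {A : Matrix (Fin 2) (Fin 2) ℂ} (hA : A 0 0 + A 1 1 = 0)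
    {f g : ℝ → Fin 2 → ℂ} {x : ℝ} (hf : HasDerivAt f (A *ᵥ f x) x)
    (hg : HasDerivAt g (A *ᵥ g x) x) : HasDerivAt (fun y => wronskian (f y) (g y)) 0 x := by
  have hf' := hasDerivAt_pi.1 hf
  have hg' := hasDerivAt_pi.1 hg
  refine (((hf' 0).mul (hg' 1)).sub ((hf' 1).mul (hg' 0))).congr_deriv ?_
  simp only [Matrix.mulVec, dotProduct, Fin.sum_univ_two]
  linear_combination (f x 0 * g x 1 - f x 1 * g x 0) * hA

lemma eq_of_hasDerivAt_zero {f : ℝ → ℂ} (h : ∀ x, HasDerivAt f 0 x) (x y : ℝ) : f x = f y :=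
  is_const_of_deriv_eq_zero (fun x => (h x).differentiableAt) (fun x => (h x).deriv) x y

lemma SolvesLax.wronskian_eq {δ q₀ : ℝ} {q : ℝ → ℝ → ℂ} {z : ℂ} {φ χ : ℝ → ℝ → Fin 2 → ℂ}
    (hφ : SolvesLax δ q₀ q z φ) (hχ : SolvesLax δ q₀ q z χ) (x t x' t' : ℝ) :
    wronskian (φ x t) (χ x t) = wronskian (φ x' t') (χ x' t') := by
  refine (eq_of_hasDerivAt_zero (f := fun y => wronskian (φ y t) (χ y t))
    (fun y => hasDerivAt_wronskian ?_ (hφ y t).1 (hχ y t).1) x x').trans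
    (eq_of_hasDerivAt_zero (f := fun s => wronskian (φ x' s) (χ x' s))
    (fun s => hasDerivAt_wronskian ?_ (hφ x' s).2 (hχ x' s).2) t t')
  · simp [laxX, sigma3, Qmat]
  · simp [laxT]

/-- The exponential factors of two different columns are reciprocal, so the phases drop out. -/
lemma wronskian_psi (δ q₀ : ℝ) (q : ℝ → ℝ → ℂ) (l l' : Filter ℝ) (w w' : ℂ) (x t : ℝ) (z : ℂ)
    {i j : Fin 2} (hij : i ≠ j) :
    wronskian (fun r => psi δ q₀ q l w x t z r i) (fun r => psi δ q₀ q l' w' x t z r j)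
      = wronskian (jost q₀ q l w t z i x) (jost q₀ q l' w' t z j x) := by
  have h : exp (I * theta δ q₀ x t z * sigma3 i i) * exp (I * theta δ q₀ x t z * sigma3 j j)
      = 1 := by
    rw [← Complex.exp_add, Complex.exp_eq_one_iff]
    refine ⟨0, ?_⟩
    fin_cases i <;> fin_cases j <;> simp [sigma3] at hij ⊢
  simp only [wronskian, psi_apply]
  linear_combination (jost q₀ q l w t z i x 0 * jost q₀ q l' w' t z j x 1
    - jost q₀ q l w t z i x 1 * jost q₀ q l' w' t z j x 0) * h

lemma wronskian_Ymat {q₀ : ℝ} {w : ℂ} (hw : ‖w‖ = q₀) (z : ℂ) :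
    wronskian (fun i => Ymat w z i 0) (fun i => Ymat w z i 1) = gam q₀ z := by
  have h : w * conj w = (q₀ : ℂ) ^ 2 := by rw [Complex.mul_conj', hw]
  simp [wronskian, Ymat, sigma3, Qmat, gam, ← h]
  linear_combination (w * conj w / z ^ 2) * (I ^ 2 - 1) * I_sq

/-- The Wronskian is constant in `x`, so it equals its limit `det Y` at the end where both columns
are normalized. -/
lemma wronskian_jost_zero_one {q₀ : ℝ} {q : ℝ → ℝ → ℂ} {l : Filter ℝ} [l.NeBot] {w z : ℂ} {t : ℝ}
    (hw : ‖w‖ = q₀) (h₀ : ∃! f, IsJost q₀ q l w t z 0 f) (h₁ : ∃! f, IsJost q₀ q l w t z 1 f)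
    (x : ℝ) :
    wronskian (jost q₀ q l w t z 0 x) (jost q₀ q l w t z 1 x) = gam q₀ z := by
  have h0 := isJost_jost h₀
  have h1 := isJost_jost h₁
  have hd : ∀ x, HasDerivAt
      (fun x => wronskian (jost q₀ q l w t z 0 x) (jost q₀ q l w t z 1 x)) 0 x := fun x => by
    have h0' := hasDerivAt_pi.1 (h0.1 x)
    have h1' := hasDerivAt_pi.1 (h1.1 x)
    refine (((h0' 0).mul (h1' 1)).sub ((h0' 1).mul (h1' 0))).congr_deriv ?_
    simp [dotProduct, Fin.sum_univ_two, laxX, sigma3, Qmat]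
    ring
  have hlim : Tendsto (fun x => wronskian (jost q₀ q l w t z 0 x) (jost q₀ q l w t z 1 x)) l
      (𝓝 (gam q₀ z)) := by
    have h0' := tendsto_pi_nhds.1 h0.2
    have h1' := tendsto_pi_nhds.1 h1.2
    rw [← wronskian_Ymat hw z]
    exact ((h0' 0).mul (h1' 1)).sub ((h0' 1).mul (h1' 0))
  exact tendsto_nhds_unique
    (tendsto_const_nhds.congr fun y => eq_of_hasDerivAt_zero hd x y) hlim

section Scattering

variable {δ q₀ : ℝ} {qp qm : ℂ} {q : ℝ → ℝ → ℂ} {z : ℂ}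

namespace IsSolution

lemma scatAt_zero_zero (hq : IsSolution δ q₀ qp qm q) (hz : z ∈ adm q₀) (x t : ℝ) :
    scatAt δ q₀ qp qm q x t z 0 0 = scat δ q₀ qp qm q z 0 0 :=
  congrArg (· / gam q₀ z) ((hq.jostWellDefined_top_zero hz).2.wronskian_eq
    (hq.jostWellDefined_bot_one hz).2 x t 0 0)

lemma scatAt_one_one (hq : IsSolution δ q₀ qp qm q) (hz : -z ∈ adm q₀) (x t : ℝ) :
    scatAt δ q₀ qp qm q x t z 1 1 = scat δ q₀ qp qm q z 1 1 :=
  congrArg (· / gam q₀ z) ((hq.jostWellDefined_bot_zero hz).2.wronskian_eq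
    (hq.jostWellDefined_top_one hz).2 x t 0 0)

lemma scatAt_eq (hq : IsSolution δ q₀ qp qm q) (hz : z ∈ adm q₀) (hz' : -z ∈ adm q₀) (x t : ℝ) :
    scatAt δ q₀ qp qm q x t z = scat δ q₀ qp qm q z := by
  ext i j
  fin_cases i <;> fin_cases j
  · exact hq.scatAt_zero_zero hz x t
  · exact congrArg (· / gam q₀ z) ((hq.jostWellDefined_top_one hz').2.wronskian_eq
      (hq.jostWellDefined_bot_one hz).2 x t 0 0)
  · exact congrArg (· / gam q₀ z) ((hq.jostWellDefined_bot_zero hz').2.wronskian_eq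
      (hq.jostWellDefined_top_zero hz).2 x t 0 0)
  · exact hq.scatAt_one_one hz' x t

lemma scat_zero_zero (hq : IsSolution δ q₀ qp qm q) (hz : z ∈ adm q₀) (x t : ℝ) :
    scat δ q₀ qp qm q z 0 0
      = wronskian (jost q₀ q atTop qp t z 0 x) (jost q₀ q atBot qm t z 1 x) / gam q₀ z := by
  rw [← hq.scatAt_zero_zero hz x t, ← wronskian_psi δ q₀ q _ _ _ _ x t z zero_ne_one]
  rfl

lemma scat_one_one (hq : IsSolution δ q₀ qp qm q) (hz : -z ∈ adm q₀) (x t : ℝ) :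
    scat δ q₀ qp qm q z 1 1
      = wronskian (jost q₀ q atBot qm t z 0 x) (jost q₀ q atTop qp t z 1 x) / gam q₀ z := by
  rw [← hq.scatAt_one_one hz x t, ← wronskian_psi δ q₀ q _ _ _ _ x t z zero_ne_one]
  rfl

/-- `ψ₊ = ψ₋ S`. -/
lemma psi_eq_mul_scat (hq : IsSolution δ q₀ qp qm q) (hz : z ∈ adm q₀) (hz' : -z ∈ adm q₀)
    (x t : ℝ) :
    psi δ q₀ q atTop qp x t z = psi δ q₀ q atBot qm x t z * scat δ q₀ qp qm q z := by
  have hW : wronskian (fun r => psi δ q₀ q atBot qm x t z r 0)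
      (fun r => psi δ q₀ q atBot qm x t z r 1) = gam q₀ z := by
    rw [wronskian_psi δ q₀ q _ _ _ _ x t z zero_ne_one]
    exact wronskian_jost_zero_one hq.norm_qm (hq.existsUnique_bot_zero hz' t)
      (hq.existsUnique_bot_one hz t) x
  rw [← hq.scatAt_eq hz hz' x t]
  have hγ := hz.2.1
  ext i j
  rw [Matrix.mul_apply, Fin.sum_univ_two, scatAt]
  simp only [wronskian] at hW ⊢
  -- Cramer's rule: the entries of `S` are the coefficients of the columns of `ψ₊` in the basis
  -- `ψ₋`, whose determinant is `γ`.
  fin_cases i <;> fin_cases j <;> simp <;> field_simp <;> rw [← hW] <;> ring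

/-- The jump condition. -/
lemma Mminus_eq (hq : IsSolution δ q₀ qp qm q) (hz : z ∈ adm q₀) (hz' : -z ∈ adm q₀)
    (h₁ : scat δ q₀ qp qm q z 0 0 ≠ 0) (h₂ : scat δ q₀ qp qm q z 1 1 ≠ 0) (x t : ℝ) :
    Mminus δ q₀ qp qm q x t z
      = Mplus δ q₀ qp qm q x t z * (1 - Gmat δ q₀ qp qm q x t z) := by
  have hψ := hq.psi_eq_mul_scat hz hz' x t
  have hE : exp (I * theta δ q₀ x t z) * exp (-(I * theta δ q₀ x t z)) = 1 := by
    rw [← Complex.exp_add, add_neg_cancel, Complex.exp_zero]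
  have hE2 : exp (2 * I * theta δ q₀ x t z) = exp (I * theta δ q₀ x t z) ^ 2 := by
    rw [← Complex.exp_nat_mul]; push_cast; ring_nf
  have hE2' : exp (-(2 * I * theta δ q₀ x t z)) = exp (-(I * theta δ q₀ x t z)) ^ 2 := by
    rw [← Complex.exp_nat_mul]; push_cast; ring_nf
  have h0 : ∀ i, exp (I * theta δ q₀ x t z) * mu q₀ q atTop qp x t z i 0
      = exp (I * theta δ q₀ x t z) * mu q₀ q atBot qm x t z i 0 * scat δ q₀ qp qm q z 0 0
        + exp (-(I * theta δ q₀ x t z)) * mu q₀ q atBot qm x t z i 1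
          * scat δ q₀ qp qm q z 1 0 := fun i => by
    have := congrFun (congrFun hψ i) 0
    rw [Matrix.mul_apply, Fin.sum_univ_two] at this
    simp only [psi, Matrix.mul_diagonal, Matrix.cons_val_zero, Matrix.cons_val_one] at this
    linear_combination this
  have h1 : ∀ i, exp (-(I * theta δ q₀ x t z)) * mu q₀ q atTop qp x t z i 1
      = exp (I * theta δ q₀ x t z) * mu q₀ q atBot qm x t z i 0 * scat δ q₀ qp qm q z 0 1
        + exp (-(I * theta δ q₀ x t z)) * mu q₀ q atBot qm x t z i 1
          * scat δ q₀ qp qm q z 1 1 := fun i => by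
    have := congrFun (congrFun hψ i) 1
    rw [Matrix.mul_apply, Fin.sum_univ_two] at this
    simp only [psi, Matrix.mul_diagonal, Matrix.cons_val_zero, Matrix.cons_val_one] at this
    linear_combination this
  ext i j
  rw [Matrix.mul_apply, Fin.sum_univ_two]
  simp only [Mminus, Mplus, Gmat, rho, rhoT, hE2, hE2']
  generalize exp (I * theta δ q₀ x t z) = E at *
  generalize exp (-(I * theta δ q₀ x t z)) = E' at *
  have h0i := h0 i
  have h1i := h1 i
  -- The expansion of `ψ₊` rewritten for `μ`: after division by the phase of the column, phases
  -- survive only at the off-diagonal entries of `S`.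
  have e0 : mu q₀ q atTop qp x t z i 0 = mu q₀ q atBot qm x t z i 0 * scat δ q₀ qp qm q z 0 0
      + E' ^ 2 * mu q₀ q atBot qm x t z i 1 * scat δ q₀ qp qm q z 1 0 := by
    linear_combination E' * h0i - (mu q₀ q atTop qp x t z i 0
      - mu q₀ q atBot qm x t z i 0 * scat δ q₀ qp qm q z 0 0) * hE
  have e1 : mu q₀ q atTop qp x t z i 1 = E ^ 2 * mu q₀ q atBot qm x t z i 0
      * scat δ q₀ qp qm q z 0 1 + mu q₀ q atBot qm x t z i 1 * scat δ q₀ qp qm q z 1 1 := by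
    linear_combination E * h1i - (mu q₀ q atTop qp x t z i 1
      - mu q₀ q atBot qm x t z i 1 * scat δ q₀ qp qm q z 1 1) * hE
  have hEE : E ^ 2 * E' ^ 2 = 1 := by rw [← mul_pow, hE, one_pow]
  fin_cases j
  · simp [e0]
    field_simp
    ring
  · simp [e0, e1]
    field_simp
    linear_combination (-(mu q₀ q atBot qm x t z i 1 * scat δ q₀ qp qm q z 1 0
      * scat δ q₀ qp qm q z 0 1)) * hEE

end IsSolution

end Scattering

/-! ### Analyticity and boundary values -/

section Analyticity

variable {δ q₀ : ℝ} {qp qm : ℂ} {q : ℝ → ℝ → ℂ}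

namespace IsSolution

lemma continuousOn_top_zero (hq : IsSolution δ q₀ qp qm q) (x t : ℝ) (i : Fin 2) :
    ContinuousOn (fun z => jost q₀ q atTop qp t z 0 x i) (adm q₀) :=
  ((hq.isPotential_top t).continuousOn_col x i).congr fun _ hz =>
    congrFun (hq.jost_top_zero hz x t) i

lemma continuousOn_bot_one (hq : IsSolution δ q₀ qp qm q) (x t : ℝ) (i : Fin 2) :
    ContinuousOn (fun z => jost q₀ q atBot qm t z 1 x i) (adm q₀) := by
  have h := (hq.isPotential_bot t).conj.continuousOn_col (-x)
  fin_cases i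
  · exact (h 1).neg.congr fun _ hz => congrFun (hq.jost_bot_one hz x t) 0
  · exact (h 0).congr fun _ hz => congrFun (hq.jost_bot_one hz x t) 1

lemma continuousOn_top_one (hq : IsSolution δ q₀ qp qm q) (x t : ℝ) (i : Fin 2) :
    ContinuousOn (fun z => jost q₀ q atTop qp t z 1 x i) {z | -z ∈ adm q₀} := by
  have h := fun i => ((hq.isPotential_top t).conj.continuousOn_col x i).comp
    (continuous_neg.continuousOn (s := {z | -z ∈ adm q₀})) fun _ hz => hz
  fin_cases i
  · exact (h 1).congr fun _ hz => congrFun (hq.jost_top_one hz x t) 0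
  · exact (h 0).congr fun _ hz => congrFun (hq.jost_top_one hz x t) 1

lemma continuousOn_bot_zero (hq : IsSolution δ q₀ qp qm q) (x t : ℝ) (i : Fin 2) :
    ContinuousOn (fun z => jost q₀ q atBot qm t z 0 x i) {z | -z ∈ adm q₀} := by
  have h := fun i => ((hq.isPotential_bot t).continuousOn_col (-x) i).comp
    (continuous_neg.continuousOn (s := {z | -z ∈ adm q₀})) fun _ hz => hz
  fin_cases i
  · exact (h 0).congr fun _ hz => congrFun (hq.jost_bot_zero hz x t) 0
  · exact (h 1).neg.congr fun _ hz => congrFun (hq.jost_bot_zero hz x t) 1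

lemma differentiableOn_top_zero (hq : IsSolution δ q₀ qp qm q) (x t : ℝ) (i : Fin 2) :
    DifferentiableOn ℂ (fun z => jost q₀ q atTop qp t z 0 x i) (Dplus q₀) :=
  ((hq.isPotential_top t).differentiableOn_col (isOpen_Dplus q₀) (Dplus_subset_adm q₀) x i).congr
    fun _ hz => congrFun (hq.jost_top_zero (Dplus_subset_adm q₀ hz) x t) i

lemma differentiableOn_bot_one (hq : IsSolution δ q₀ qp qm q) (x t : ℝ) (i : Fin 2) :
    DifferentiableOn ℂ (fun z => jost q₀ q atBot qm t z 1 x i) (Dplus q₀) := by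
  have h := (hq.isPotential_bot t).conj.differentiableOn_col (isOpen_Dplus q₀)
    (Dplus_subset_adm q₀) (-x)
  fin_cases i
  · exact (h 1).neg.congr fun _ hz =>
      congrFun (hq.jost_bot_one (Dplus_subset_adm q₀ hz) x t) 0
  · exact (h 0).congr fun _ hz => congrFun (hq.jost_bot_one (Dplus_subset_adm q₀ hz) x t) 1

lemma neg_mem_adm_of_mem_Dminus {z : ℂ} (hz : z ∈ Dminus q₀) : -z ∈ adm q₀ :=
  adm_of_minus (Or.inl hz)

lemma differentiableOn_top_one (hq : IsSolution δ q₀ qp qm q) (x t : ℝ) (i : Fin 2) :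
    DifferentiableOn ℂ (fun z => jost q₀ q atTop qp t z 1 x i) (Dminus q₀) := by
  have h := fun i => ((hq.isPotential_top t).conj.differentiableOn_col (isOpen_Dplus q₀)
    (Dplus_subset_adm q₀) x i).comp (differentiable_neg.differentiableOn (s := Dminus q₀))
    fun _ hz => neg_mem_Dplus_iff.2 hz
  fin_cases i
  · exact (h 1).congr fun _ hz => congrFun (hq.jost_top_one (neg_mem_adm_of_mem_Dminus hz) x t) 0
  · exact (h 0).congr fun _ hz => congrFun (hq.jost_top_one (neg_mem_adm_of_mem_Dminus hz) x t) 1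

lemma differentiableOn_bot_zero (hq : IsSolution δ q₀ qp qm q) (x t : ℝ) (i : Fin 2) :
    DifferentiableOn ℂ (fun z => jost q₀ q atBot qm t z 0 x i) (Dminus q₀) := by
  have h := fun i => ((hq.isPotential_bot t).differentiableOn_col (isOpen_Dplus q₀)
    (Dplus_subset_adm q₀) (-x) i).comp (differentiable_neg.differentiableOn (s := Dminus q₀))
    fun _ hz => neg_mem_Dplus_iff.2 hz
  fin_cases i
  · exact (h 0).congr fun _ hz => congrFun (hq.jost_bot_zero (neg_mem_adm_of_mem_Dminus hz) x t) 0
  · exact (h 1).neg.congr fun _ hz =>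
      congrFun (hq.jost_bot_zero (neg_mem_adm_of_mem_Dminus hz) x t) 1

lemma continuousOn_scat_zero_zero (hq : IsSolution δ q₀ qp qm q) :
    ContinuousOn (fun z => scat δ q₀ qp qm q z 0 0) (adm q₀) := by
  refine ContinuousOn.congr (f := fun z => wronskian (jost q₀ q atTop qp 0 z 0 0)
    (jost q₀ q atBot qm 0 z 1 0) / gam q₀ z) ?_ fun z hz => hq.scat_zero_zero hz 0 0
  exact (((hq.continuousOn_top_zero 0 0 0).mul (hq.continuousOn_bot_one 0 0 1)).sub
    ((hq.continuousOn_top_zero 0 0 1).mul (hq.continuousOn_bot_one 0 0 0))).div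
    (fun z hz => (continuousAt_gam hz.1).continuousWithinAt) fun z hz => hz.2.1

lemma continuousOn_scat_one_one (hq : IsSolution δ q₀ qp qm q) :
    ContinuousOn (fun z => scat δ q₀ qp qm q z 1 1) {z | -z ∈ adm q₀} := by
  refine ContinuousOn.congr (f := fun z => wronskian (jost q₀ q atBot qm 0 z 0 0)
    (jost q₀ q atTop qp 0 z 1 0) / gam q₀ z) ?_ fun z hz => hq.scat_one_one hz 0 0
  exact (((hq.continuousOn_bot_zero 0 0 0).mul (hq.continuousOn_top_one 0 0 1)).sub
    ((hq.continuousOn_bot_zero 0 0 1).mul (hq.continuousOn_top_one 0 0 0))).div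
    (fun z hz => (continuousAt_gam (ne_zero_of_neg_mem_adm hz)).continuousWithinAt)
    fun z hz => gam_neg q₀ z ▸ hz.2.1

lemma differentiableOn_scat_zero_zero (hq : IsSolution δ q₀ qp qm q) :
    DifferentiableOn ℂ (fun z => scat δ q₀ qp qm q z 0 0) (Dplus q₀) := by
  refine DifferentiableOn.congr (f := fun z => wronskian (jost q₀ q atTop qp 0 z 0 0)
    (jost q₀ q atBot qm 0 z 1 0) / gam q₀ z) ?_
    fun z hz => hq.scat_zero_zero (Dplus_subset_adm q₀ hz) 0 0
  exact (((hq.differentiableOn_top_zero 0 0 0).mul (hq.differentiableOn_bot_one 0 0 1)).sub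
    ((hq.differentiableOn_top_zero 0 0 1).mul (hq.differentiableOn_bot_one 0 0 0))).div
    (fun z hz => (differentiableAt_gam (Dplus_subset_adm q₀ hz).1).differentiableWithinAt)
    fun z hz => (Dplus_subset_adm q₀ hz).2.1

lemma differentiableOn_scat_one_one (hq : IsSolution δ q₀ qp qm q) :
    DifferentiableOn ℂ (fun z => scat δ q₀ qp qm q z 1 1) (Dminus q₀) := by
  refine DifferentiableOn.congr (f := fun z => wronskian (jost q₀ q atBot qm 0 z 0 0)
    (jost q₀ q atTop qp 0 z 1 0) / gam q₀ z) ?_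
    fun z hz => hq.scat_one_one (neg_mem_adm_of_mem_Dminus hz) 0 0
  exact (((hq.differentiableOn_bot_zero 0 0 0).mul (hq.differentiableOn_top_one 0 0 1)).sub
    ((hq.differentiableOn_bot_zero 0 0 1).mul (hq.differentiableOn_top_one 0 0 0))).div
    (fun z hz => (differentiableAt_gam
      (ne_zero_of_neg_mem_adm (neg_mem_adm_of_mem_Dminus hz))).differentiableWithinAt)
    fun z hz => gam_neg q₀ z ▸ (neg_mem_adm_of_mem_Dminus hz).2.1

/-- Each entry is locally holomorphic or a quotient of holomorphic functions, so poles can come only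
from zeros of `s₁₁` and `s₂₂`. -/
lemma meromorphicOn_Mmat (hq : IsSolution δ q₀ qp qm q) (x t : ℝ) (i j : Fin 2) :
    MeromorphicOn (fun z => Mmat δ q₀ qp qm q x t z i j) (Sigma q₀)ᶜ := by
  intro z hz
  rcases mem_compl_Sigma hq.q₀_pos hz with h | h
  · have hU := (isOpen_Dplus q₀).mem_nhds h
    have hm : MeromorphicAt (fun z => Mplus δ q₀ qp qm q x t z i j) z := by
      fin_cases j
      · exact ((hq.differentiableOn_top_zero x t i).analyticAt hU).meromorphicAt.div
          (hq.differentiableOn_scat_zero_zero.analyticAt hU).meromorphicAt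
      · exact ((hq.differentiableOn_bot_one x t i).analyticAt hU).meromorphicAt
    refine hm.congr (mem_nhdsWithin_of_mem_nhds (mem_of_superset hU fun y hy => ?_))
    simp [Mmat, hy]
  · have hU := (isOpen_Dminus q₀).mem_nhds h
    have hm : MeromorphicAt (fun z => Mminus δ q₀ qp qm q x t z i j) z := by
      fin_cases j
      · exact ((hq.differentiableOn_bot_zero x t i).analyticAt hU).meromorphicAt
      · exact ((hq.differentiableOn_top_one x t i).analyticAt hU).meromorphicAt.div
          (hq.differentiableOn_scat_one_one.analyticAt hU).meromorphicAt
    refine hm.congr (mem_nhdsWithin_of_mem_nhds (mem_of_superset hU fun y hy => ?_))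
    have hy' : y ∉ Dplus q₀ := fun h => not_mem_Dminus_of_mem_Dplus h hy
    simp [Mmat, hy']

lemma tendsto_Mmat_plus (hq : IsSolution δ q₀ qp qm q) {z : ℂ} (hz : z ∈ SigmaReg q₀)
    (hs : scat δ q₀ qp qm q z 0 0 ≠ 0) (x t : ℝ) :
    Tendsto (Mmat δ q₀ qp qm q x t) (𝓝[Dplus q₀] z) (𝓝 (Mplus δ q₀ qp qm q x t z)) := by
  have hza := SigmaReg_subset_adm q₀ hz
  have hM : Tendsto (Mplus δ q₀ qp qm q x t) (𝓝[Dplus q₀] z)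
      (𝓝 (Mplus δ q₀ qp qm q x t z)) := by
    refine tendsto_pi_nhds.2 fun i => tendsto_pi_nhds.2 fun j => ?_
    fin_cases j
    · exact ((hq.continuousOn_top_zero x t i z hza).mono (Dplus_subset_adm q₀)).div
        ((hq.continuousOn_scat_zero_zero z hza).mono (Dplus_subset_adm q₀)) hs
    · exact (hq.continuousOn_bot_one x t i z hza).mono (Dplus_subset_adm q₀)
  refine hM.congr' (eventually_nhdsWithin_of_forall fun y hy => ?_)
  simp [Mmat, hy]

lemma tendsto_Mmat_minus (hq : IsSolution δ q₀ qp qm q) {z : ℂ} (hz : z ∈ SigmaReg q₀)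
    (hs : scat δ q₀ qp qm q z 1 1 ≠ 0) (x t : ℝ) :
    Tendsto (Mmat δ q₀ qp qm q x t) (𝓝[Dminus q₀] z) (𝓝 (Mminus δ q₀ qp qm q x t z)) := by
  have hza : z ∈ {z | -z ∈ adm q₀} := adm_of_minus (Or.inr hz)
  have hsub : Dminus q₀ ⊆ {z | -z ∈ adm q₀} := fun _ => neg_mem_adm_of_mem_Dminus
  have hM : Tendsto (Mminus δ q₀ qp qm q x t) (𝓝[Dminus q₀] z)
      (𝓝 (Mminus δ q₀ qp qm q x t z)) := by
    refine tendsto_pi_nhds.2 fun i => tendsto_pi_nhds.2 fun j => ?_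
    fin_cases j
    · exact (hq.continuousOn_bot_zero x t i z hza).mono hsub
    · exact ((hq.continuousOn_top_one x t i z hza).mono hsub).div
        ((hq.continuousOn_scat_one_one z hza).mono hsub) hs
  refine hM.congr' (eventually_nhdsWithin_of_forall fun y hy => ?_)
  have hy' : y ∉ Dplus q₀ := fun h => not_mem_Dminus_of_mem_Dplus h hy
  simp [Mmat, hy']

end IsSolution

end Analyticity

/-! ### Asymptotics at infinity -/

/-! ### Arithmetic of functions of the form `1 + O(ε)` -/

section BigO

variable {L : Filter ℂ} {f g ε : ℂ → ℂ}

lemma isBigO_mul_of_sub_one (hε : Tendsto ε L (𝓝 0)) (hf : f =O[L] ε)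
    (hg : (fun z => g z - 1) =O[L] ε) : (fun z => f z * g z) =O[L] ε := by
  have h1 : g =O[L] fun _ => (1 : ℂ) := by
    have := (hg.trans (hε.isBigO_one ℂ)).add (isBigO_refl (fun _ => (1 : ℂ)) L)
    simpa using this
  simpa using hf.mul h1

lemma isBigO_mul_sub_one (hε : Tendsto ε L (𝓝 0)) (hf : (fun z => f z - 1) =O[L] ε)
    (hg : (fun z => g z - 1) =O[L] ε) : (fun z => f z * g z - 1) =O[L] ε :=
  ((isBigO_mul_of_sub_one hε hf hg).add hg).congr_left fun z => by ring

lemma isBigO_inv_sub_one (hε : Tendsto ε L (𝓝 0)) (hf : (fun z => f z - 1) =O[L] ε) :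
    (fun z => (f z)⁻¹ - 1) =O[L] ε := by
  have h1 : Tendsto f L (𝓝 1) := by
    have := (hf.trans_tendsto hε).add_const 1
    simpa using this
  have h2 : Tendsto (fun z => (f z)⁻¹) L (𝓝 1) := by simpa using h1.inv₀ one_ne_zero
  have h3 := hf.neg_left.mul (h2.isBigO_one ℂ)
  simp only [mul_one] at h3
  refine h3.congr' ?_ EventuallyEq.rfl
  filter_upwards [h1.eventually_ne one_ne_zero] with z hz
  field_simp
  ring

end BigO

lemma isBigO_col {q₀ : ℝ} {u u' : ℝ → ℂ} {w : ℂ} (h : IsPotential q₀ u u' w) (x : ℝ) {L : Filter ℂ}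
    (hL : L ≤ Bornology.cobounded ℂ) {g : ℂ → ℂ} (hg : ∀ z, ‖g z‖ = ‖z‖)
    (ha : ∀ᶠ z in L, g z ∈ adm q₀) :
    (fun z => col q₀ u w (g z) x 0 - 1) =O[L] (fun z => 1 / z) ∧
      (fun z => col q₀ u w (g z) x 1) =O[L] (fun z => 1 / z) := by
  obtain ⟨K, hK⟩ := h.exists_bound_col x
  have hl : ∀ᶠ z in L, 2 * q₀ + 1 ≤ ‖z‖ :=
    (tendsto_norm_cobounded_atTop.mono_left hL).eventually_ge_atTop _
  constructor <;> refine IsBigO.of_bound K ?_ <;> filter_upwards [ha, hl] with z hz hzl <;>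
    rw [norm_div, norm_one, mul_one_div, ← hg z]
  · exact (hK _ hz (by rwa [hg])).1
  · exact (hK _ hz (by rwa [hg])).2

lemma tendsto_one_div_of_le_cobounded {L : Filter ℂ} (hL : L ≤ Bornology.cobounded ℂ) :
    Tendsto (fun z : ℂ => 1 / z) L (𝓝 0) := by
  simpa using tendsto_inv₀_cobounded.mono_left hL

lemma isBigO_gam_inv (q₀ : ℝ) {L : Filter ℂ} (hL : L ≤ Bornology.cobounded ℂ) :
    (fun z => (gam q₀ z)⁻¹ - 1) =O[L] fun z => 1 / z := by
  have hε := tendsto_one_div_of_le_cobounded hL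
  refine isBigO_inv_sub_one hε ?_
  have h := (isBigO_refl (fun z : ℂ => 1 / z) L).mul (hε.isBigO_one ℂ)
  simp only [mul_one] at h
  refine (h.const_mul_left ((q₀ : ℂ) ^ 2)).congr_left fun z => ?_
  rw [gam]
  ring

section Infinity

variable {δ q₀ : ℝ} {qp qm : ℂ} {q : ℝ → ℝ → ℂ} {L : Filter ℂ}

namespace IsSolution

lemma isBigO_top_zero (hq : IsSolution δ q₀ qp qm q) (hL : L ≤ Bornology.cobounded ℂ)
    (ha : ∀ᶠ z in L, z ∈ adm q₀) (x t : ℝ) :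
    (fun z => jost q₀ q atTop qp t z 0 x 0 - 1) =O[L] (fun z => 1 / z) ∧
      (fun z => jost q₀ q atTop qp t z 0 x 1) =O[L] (fun z => 1 / z) := by
  have h := isBigO_col (hq.isPotential_top t) x hL (g := id) (fun _ => rfl) ha
  exact ⟨h.1.congr' (ha.mono fun z hz => by beta_reduce; rw [hq.jost_top_zero hz]; rfl)
      EventuallyEq.rfl,
    h.2.congr' (ha.mono fun z hz => by beta_reduce; rw [hq.jost_top_zero hz]; rfl) EventuallyEq.rfl⟩

lemma isBigO_bot_one (hq : IsSolution δ q₀ qp qm q) (hL : L ≤ Bornology.cobounded ℂ)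
    (ha : ∀ᶠ z in L, z ∈ adm q₀) (x t : ℝ) :
    (fun z => jost q₀ q atBot qm t z 1 x 0) =O[L] (fun z => 1 / z) ∧
      (fun z => jost q₀ q atBot qm t z 1 x 1 - 1) =O[L] (fun z => 1 / z) := by
  have h := isBigO_col (hq.isPotential_bot t).conj (-x) hL (g := id) (fun _ => rfl) ha
  exact ⟨h.2.neg_left.congr' (ha.mono fun z hz => by beta_reduce; rw [hq.jost_bot_one hz]; rfl)
    EventuallyEq.rfl,
    h.1.congr' (ha.mono fun z hz => by beta_reduce; rw [hq.jost_bot_one hz]; rfl) EventuallyEq.rfl⟩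

lemma isBigO_top_one (hq : IsSolution δ q₀ qp qm q) (hL : L ≤ Bornology.cobounded ℂ)
    (ha : ∀ᶠ z in L, -z ∈ adm q₀) (x t : ℝ) :
    (fun z => jost q₀ q atTop qp t z 1 x 0) =O[L] (fun z => 1 / z) ∧
      (fun z => jost q₀ q atTop qp t z 1 x 1 - 1) =O[L] (fun z => 1 / z) := by
  have h := isBigO_col (hq.isPotential_top t).conj x hL (g := fun z => -z) norm_neg ha
  exact ⟨h.2.congr' (ha.mono fun z hz => by beta_reduce; rw [hq.jost_top_one hz]; rfl)
      EventuallyEq.rfl,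
    h.1.congr' (ha.mono fun z hz => by beta_reduce; rw [hq.jost_top_one hz]; rfl) EventuallyEq.rfl⟩

lemma isBigO_bot_zero (hq : IsSolution δ q₀ qp qm q) (hL : L ≤ Bornology.cobounded ℂ)
    (ha : ∀ᶠ z in L, -z ∈ adm q₀) (x t : ℝ) :
    (fun z => jost q₀ q atBot qm t z 0 x 0 - 1) =O[L] (fun z => 1 / z) ∧
      (fun z => jost q₀ q atBot qm t z 0 x 1) =O[L] (fun z => 1 / z) := by
  have h := isBigO_col (hq.isPotential_bot t) (-x) hL (g := fun z => -z) norm_neg ha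
  exact ⟨h.1.congr' (ha.mono fun z hz => by beta_reduce; rw [hq.jost_bot_zero hz]; rfl)
      EventuallyEq.rfl,
    h.2.neg_left.congr' (ha.mono fun z hz => by beta_reduce; rw [hq.jost_bot_zero hz]; rfl)
      EventuallyEq.rfl⟩

/-- The diagonal product is `1 + O(1/z)`, the other product is `O(1/z)`, and `γ` is `1 + O(1/z)`. -/
lemma isBigO_wronskian {f g : ℂ → Fin 2 → ℂ} (hL : L ≤ Bornology.cobounded ℂ)
    (hf₀ : (fun z => f z 0 - 1) =O[L] fun z => 1 / z) (hf₁ : (fun z => f z 1) =O[L] fun z => 1 / z)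
    (hg₀ : (fun z => g z 0) =O[L] fun z => 1 / z)
    (hg₁ : (fun z => g z 1 - 1) =O[L] fun z => 1 / z) :
    (fun z => wronskian (f z) (g z) / gam q₀ z - 1) =O[L] fun z => 1 / z := by
  have hε := tendsto_one_div_of_le_cobounded hL
  have h1 := hf₁.mul ((hg₀.trans (hε.isBigO_one ℂ)))
  simp only [mul_one] at h1
  have h2 := ((isBigO_mul_sub_one hε hf₀ hg₁).sub h1).congr_left
    (f₂ := fun z => wronskian (f z) (g z) - 1) fun z => by simp only [wronskian]; ring
  simpa only [div_eq_mul_inv] using isBigO_mul_sub_one hε h2 (isBigO_gam_inv q₀ hL)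

lemma isBigO_scat_zero_zero (hq : IsSolution δ q₀ qp qm q) (hL : L ≤ Bornology.cobounded ℂ)
    (ha : ∀ᶠ z in L, z ∈ adm q₀) :
    (fun z => scat δ q₀ qp qm q z 0 0 - 1) =O[L] fun z => 1 / z :=
  (isBigO_wronskian (q₀ := q₀) hL (hq.isBigO_top_zero hL ha 0 0).1
    (hq.isBigO_top_zero hL ha 0 0).2 (hq.isBigO_bot_one hL ha 0 0).1
    (hq.isBigO_bot_one hL ha 0 0).2).congr'
    (ha.mono fun z hz => by beta_reduce; rw [hq.scat_zero_zero hz 0 0]) EventuallyEq.rfl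

lemma isBigO_scat_one_one (hq : IsSolution δ q₀ qp qm q) (hL : L ≤ Bornology.cobounded ℂ)
    (ha : ∀ᶠ z in L, -z ∈ adm q₀) :
    (fun z => scat δ q₀ qp qm q z 1 1 - 1) =O[L] fun z => 1 / z :=
  (isBigO_wronskian (q₀ := q₀) hL (hq.isBigO_bot_zero hL ha 0 0).1
    (hq.isBigO_bot_zero hL ha 0 0).2 (hq.isBigO_top_one hL ha 0 0).1
    (hq.isBigO_top_one hL ha 0 0).2).congr'
    (ha.mono fun z hz => by beta_reduce; rw [hq.scat_one_one hz 0 0]) EventuallyEq.rfl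

lemma isBigO_Mplus (hq : IsSolution δ q₀ qp qm q) (hL : L ≤ Bornology.cobounded ℂ)
    (ha : ∀ᶠ z in L, z ∈ adm q₀) (x t : ℝ) (i j : Fin 2) :
    (fun z => (Mplus δ q₀ qp qm q x t z - 1) i j) =O[L] fun z => 1 / z := by
  have hε := tendsto_one_div_of_le_cobounded hL
  have hs := isBigO_inv_sub_one hε (hq.isBigO_scat_zero_zero hL ha)
  have hp := hq.isBigO_top_zero hL ha x t
  have hm := hq.isBigO_bot_one hL ha x t
  fin_cases i <;> fin_cases j
  · exact isBigO_mul_sub_one hε hp.1 hs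
  · exact hm.1.congr_left fun z => by simp [Mplus, mu]
  · exact (isBigO_mul_of_sub_one hε hp.2 hs).congr_left fun z => by
      simp [Mplus, mu, div_eq_mul_inv]
  · exact hm.2

lemma isBigO_Mminus (hq : IsSolution δ q₀ qp qm q) (hL : L ≤ Bornology.cobounded ℂ)
    (ha : ∀ᶠ z in L, -z ∈ adm q₀) (x t : ℝ) (i j : Fin 2) :
    (fun z => (Mminus δ q₀ qp qm q x t z - 1) i j) =O[L] fun z => 1 / z := by
  have hε := tendsto_one_div_of_le_cobounded hL
  have hs := isBigO_inv_sub_one hε (hq.isBigO_scat_one_one hL ha)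
  have hp := hq.isBigO_top_one hL ha x t
  have hm := hq.isBigO_bot_zero hL ha x t
  fin_cases i <;> fin_cases j
  · exact hm.1
  · exact (isBigO_mul_of_sub_one hε hp.1 hs).congr_left fun z => by
      simp [Mminus, mu, div_eq_mul_inv]
  · exact hm.2.congr_left fun z => by simp [Mminus, mu]
  · exact isBigO_mul_sub_one hε hp.2 hs

end IsSolution

lemma mem_adm_of_mem_closure_Dplus {z : ℂ} (hz : z ∈ Dplus q₀ ∪ Sigma q₀) (h0 : z ≠ 0)
    (hn : ‖z‖ ≠ |q₀|) : z ∈ adm q₀ :=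
  adm_of_plus (hz.imp_right fun h => mem_SigmaReg_of_norm_ne h h0 hn)

lemma neg_mem_adm_of_mem_closure_Dminus {z : ℂ} (hz : z ∈ Dminus q₀ ∪ Sigma q₀) (h0 : z ≠ 0)
    (hn : ‖z‖ ≠ |q₀|) : -z ∈ adm q₀ :=
  adm_of_minus (hz.imp_right fun h => mem_SigmaReg_of_norm_ne h h0 hn)

lemma eventually_cobounded_ne (q₀ : ℝ) : ∀ᶠ z in Bornology.cobounded ℂ, z ≠ 0 ∧ ‖z‖ ≠ |q₀| := by
  filter_upwards [tendsto_norm_cobounded_atTop.eventually_gt_atTop |q₀|] with z hz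
  exact ⟨norm_pos_iff.1 ((abs_nonneg q₀).trans_lt hz), hz.ne'⟩

lemma eventually_mem_adm_infinity (q₀ : ℝ) :
    ∀ᶠ z in Bornology.cobounded ℂ ⊓ 𝓟 (Dplus q₀ ∪ Sigma q₀), z ∈ adm q₀ :=
  eventually_inf_principal.2 ((eventually_cobounded_ne q₀).mono fun _ h hz =>
    mem_adm_of_mem_closure_Dplus hz h.1 h.2)

lemma eventually_neg_mem_adm_infinity (q₀ : ℝ) :
    ∀ᶠ z in Bornology.cobounded ℂ ⊓ 𝓟 (Dminus q₀ ∪ Sigma q₀), -z ∈ adm q₀ :=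
  eventually_inf_principal.2 ((eventually_cobounded_ne q₀).mono fun _ h hz =>
    neg_mem_adm_of_mem_closure_Dminus hz h.1 h.2)

end Infinity

/-! ### Asymptotics at the origin -/

section Origin

variable {δ q₀ : ℝ} {qp qm : ℂ} {q : ℝ → ℝ → ℂ} {z : ℂ}

/-- The involution `z ↦ -q₀² / z`. -/
def antipode (q₀ : ℝ) (z : ℂ) : ℂ := -((q₀ : ℂ) ^ 2 / z)

lemma antipode_antipode (hq₀ : q₀ ≠ 0) (hz : z ≠ 0) : antipode q₀ (antipode q₀ z) = z := by
  have : (q₀ : ℂ) ≠ 0 := by exact_mod_cast hq₀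
  simp only [antipode]
  field_simp

lemma norm_antipode (q₀ : ℝ) (z : ℂ) : ‖antipode q₀ z‖ = q₀ ^ 2 / ‖z‖ := by
  simp [antipode]

lemma im_antipode (q₀ : ℝ) (z : ℂ) : (antipode q₀ z).im = q₀ ^ 2 * z.im / ‖z‖ ^ 2 := by
  have h2 : (q₀ : ℂ) ^ 2 = ((q₀ ^ 2 : ℝ) : ℂ) := by push_cast; rfl
  rw [antipode, h2, Complex.neg_im, Complex.div_im, ← Complex.normSq_eq_norm_sq]
  simp only [Complex.ofReal_im, Complex.ofReal_re]
  ring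

/-- The involution multiplies the product defining `D⁺` and `D⁻` by a negative factor, so it
exchanges the two regions. -/
lemma antipode_discriminant (q₀ : ℝ) (hz : z ≠ 0) :
    (‖antipode q₀ z‖ ^ 2 - q₀ ^ 2) * (antipode q₀ z).im
      = -(q₀ ^ 4 / ‖z‖ ^ 4 * ((‖z‖ ^ 2 - q₀ ^ 2) * z.im)) := by
  have h : ‖z‖ ≠ 0 := norm_ne_zero_iff.2 hz
  rw [norm_antipode, im_antipode]
  field_simp
  ring

lemma antipode_mem_Dminus (hq₀ : 0 < q₀) (hz : z ∈ Dplus q₀) : antipode q₀ z ∈ Dminus q₀ := by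
  have h0 := (Dplus_subset_adm q₀ hz).1
  have h : 0 < ‖z‖ := norm_pos_iff.2 h0
  change (‖antipode q₀ z‖ ^ 2 - q₀ ^ 2) * (antipode q₀ z).im < 0
  rw [antipode_discriminant q₀ h0]
  have hz' : 0 < (‖z‖ ^ 2 - q₀ ^ 2) * z.im := hz
  exact neg_neg_of_pos (by positivity)

lemma antipode_mem_Dplus (hq₀ : 0 < q₀) (hz : z ∈ Dminus q₀) : antipode q₀ z ∈ Dplus q₀ := by
  have h := antipode_mem_Dminus hq₀ (neg_mem_Dplus_iff.2 hz)
  rw [antipode, div_neg, neg_neg, ← neg_mem_Dplus_iff] at h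
  exact h

lemma antipode_mem_Sigma (hq₀ : 0 < q₀) (hz : z ∈ Sigma q₀) : antipode q₀ z ∈ Sigma q₀ := by
  rcases hz with h | h
  · exact Or.inl (by rw [im_antipode, h]; simp)
  · exact Or.inr (by rw [norm_antipode, h]; field_simp)

lemma neg_antipode_mem_adm (hq₀ : q₀ ≠ 0) (hz : z ∈ adm q₀) : -antipode q₀ z ∈ adm q₀ := by
  rw [antipode, neg_neg]
  exact div_mem_adm hq₀ hz

namespace IsSolution

/-- By `col_inversion` the first column at `z` is an exchanged model column for the conjugate
potential at `q₀² / z`, and this is how the second column at `-q₀² / z` is represented. -/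
lemma jost_top_zero_antipode (hq : IsSolution δ q₀ qp qm q) (hz : z ∈ adm q₀) (x t : ℝ) :
    jost q₀ q atTop qp t z 0 x = (qp / z) • jost q₀ q atTop qp t (antipode q₀ z) 1 x := by
  rw [hq.jost_top_zero hz, hq.jost_top_one (neg_antipode_mem_adm hq.q₀_pos.ne' hz),
    col_inversion (hq.isPotential_top t) hz, antipode, neg_neg]

lemma jost_bot_one_antipode (hq : IsSolution δ q₀ qp qm q) (hz : z ∈ adm q₀) (x t : ℝ) :
    jost q₀ q atBot qm t z 1 x
      = -(conj qm / z) • jost q₀ q atBot qm t (antipode q₀ z) 0 x := by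
  rw [hq.jost_bot_one hz, hq.jost_bot_zero (neg_antipode_mem_adm hq.q₀_pos.ne' hz),
    col_inversion (hq.isPotential_bot t).conj hz, antipode, neg_neg]
  simp only [Complex.conj_conj]
  funext i
  fin_cases i <;> simp [swap]

/-- The factors `qp / z` and `-conj qm / z` of the two columns contribute `1 / z²`, which the
transformation rule of `γ` compensates; the minus sign is that of reversing the Wronskian. -/
lemma scat_zero_zero_antipode (hq : IsSolution δ q₀ qp qm q) (hz : z ∈ adm q₀) :
    scat δ q₀ qp qm q z 0 0
      = qp * conj qm / (q₀ : ℂ) ^ 2 * scat δ q₀ qp qm q (antipode q₀ z) 1 1 := by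
  have hq₀ : (q₀ : ℂ) ≠ 0 := by exact_mod_cast hq.q₀_pos.ne'
  have hz0 := hz.1
  have hγ := hz.2.1
  rw [hq.scat_zero_zero hz 0 0, hq.scat_one_one (neg_antipode_mem_adm hq.q₀_pos.ne' hz) 0 0,
    hq.jost_top_zero_antipode hz, hq.jost_bot_one_antipode hz, antipode, gam_neg,
    gam_div hq.q₀_pos.ne' hz.1]
  simp only [wronskian, Pi.smul_apply, smul_eq_mul]
  field_simp
  ring

/-- `M⁺` and `M⁻` are exchanged by `z ↦ -q₀² / z`. -/
lemma Mplus_eq_antipode (hq : IsSolution δ q₀ qp qm q) (hz : z ∈ adm q₀) (x t : ℝ) :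
    Mplus δ q₀ qp qm q x t z
      = Mminus δ q₀ qp qm q x t (antipode q₀ z) * ((I / z) • (sigma3 * Qmat qm)) := by
  have hq₀ : (q₀ : ℂ) ≠ 0 := by exact_mod_cast hq.q₀_pos.ne'
  have hp0 : qp ≠ 0 := norm_ne_zero_iff.1 (hq.norm_qp ▸ hq.q₀_pos.ne')
  have hm0 : qm ≠ 0 := norm_ne_zero_iff.1 (hq.norm_qm ▸ hq.q₀_pos.ne')
  have hm0' : conj qm ≠ 0 := (map_ne_zero _).2 hm0
  have h : (q₀ : ℂ) ^ 2 = qm * conj qm := by rw [Complex.mul_conj', hq.norm_qm]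
  have hz0 := hz.1
  -- Division by `s₁₁` turns the boundary value `qp` into `qm`; this is why `Q₋` alone appears at
  -- the origin.
  have e : qp / z / (qp * conj qm / (q₀ : ℂ) ^ 2) = qm / z := by
    rw [h]; field_simp
  ext i j
  rw [Matrix.mul_apply, Fin.sum_univ_two]
  fin_cases j
  · simp [Mplus, Mminus, mu, hq.jost_top_zero_antipode hz, hq.scat_zero_zero_antipode hz, sigma3,
      Qmat, mul_div_mul_comm, e]
    linear_combination (jost q₀ q atTop qp t (antipode q₀ z) 1 x i
      / scat δ q₀ qp qm q (antipode q₀ z) 1 1 * (qm / z)) * I_sq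
  · simp [Mplus, Mminus, mu, hq.jost_bot_one_antipode hz, sigma3, Qmat]
    linear_combination (-(jost q₀ q atBot qm t (antipode q₀ z) 0 x i) * (conj qm / z)) * I_sq

/-- The relation for `M⁺` is used at `-q₀² / z`; the two factors `(i / z) σ₃ Q₋` taken at `z` and at
its image multiply to the identity. -/
lemma Mminus_eq_antipode (hq : IsSolution δ q₀ qp qm q) (hz : -z ∈ adm q₀) (x t : ℝ) :
    Mminus δ q₀ qp qm q x t z
      = Mplus δ q₀ qp qm q x t (antipode q₀ z) * ((I / z) • (sigma3 * Qmat qm)) := by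
  have hq₀ : (q₀ : ℂ) ≠ 0 := by exact_mod_cast hq.q₀_pos.ne'
  have hz0 := ne_zero_of_neg_mem_adm hz
  have hz' : antipode q₀ z ∈ adm q₀ := by
    rw [antipode, ← div_neg]
    exact div_mem_adm hq.q₀_pos.ne' hz
  have h : (q₀ : ℂ) ^ 2 = qm * conj qm := by rw [Complex.mul_conj', hq.norm_qm]
  have hm0 : qm ≠ 0 := norm_ne_zero_iff.1 (hq.norm_qm ▸ hq.q₀_pos.ne')
  have hm0' : conj qm ≠ 0 := (map_ne_zero _).2 hm0
  have e : ((I / antipode q₀ z) • (sigma3 * Qmat qm)) * ((I / z) • (sigma3 * Qmat qm)) = 1 := by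
    rw [antipode, h]
    have hI : I ^ 4 = 1 := Complex.I_pow_four
    ext i j
    fin_cases i <;> fin_cases j <;> simp [Matrix.mul_apply, Fin.sum_univ_two, sigma3, Qmat] <;>
      field_simp <;> simp [hI]
  rw [hq.Mplus_eq_antipode hz', antipode_antipode hq.q₀_pos.ne' hz0, Matrix.mul_assoc, e,
    Matrix.mul_one]

end IsSolution

lemma tendsto_antipode (hq₀ : q₀ ≠ 0) {s s' : Set ℂ} (hs : ∀ z ∈ s \ {0}, antipode q₀ z ∈ s') :
    Tendsto (antipode q₀) (𝓝[s \ {0}] 0) (Bornology.cobounded ℂ ⊓ 𝓟 s') := by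
  refine tendsto_inf.2 ⟨?_, tendsto_principal.2 (eventually_nhdsWithin_of_forall hs)⟩
  rw [← tendsto_norm_atTop_iff_cobounded]
  have h : Tendsto (fun z : ℂ => ‖z‖) (𝓝[s \ {0}] 0) (𝓝[>] 0) := by
    refine tendsto_nhdsWithin_iff.2 ⟨?_, eventually_nhdsWithin_of_forall fun z hz =>
      norm_pos_iff.2 hz.2⟩
    have := (continuous_norm (E := ℂ)).tendsto 0
    rw [norm_zero] at this
    exact this.mono_left nhdsWithin_le_nhds
  have h2 := (tendsto_inv_nhdsGT_zero.comp h).const_mul_atTop (show 0 < q₀ ^ 2 by positivity)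
  refine h2.congr fun z => ?_
  rw [norm_antipode, div_eq_mul_inv]
  rfl

/-- A quantity that is `O(1/ẑ)` with `ẑ = -q₀² / z` is `O(z)`, which cancels the factor `1 / z`. -/
lemma isBigO_mul_antipode (hq₀ : q₀ ≠ 0) {L : Filter ℂ} (h0 : ∀ᶠ z in L, z ≠ 0)
    {A : ℂ → Matrix (Fin 2) (Fin 2) ℂ} (B : Matrix (Fin 2) (Fin 2) ℂ)
    (hA : ∀ i j, (fun z => A z i j) =O[L] fun z => 1 / antipode q₀ z) (i j : Fin 2) :
    (fun z => (A z * ((I / z) • B)) i j) =O[L] fun _ => (1 : ℂ) := by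
  have hq₀' : (q₀ : ℂ) ≠ 0 := by exact_mod_cast hq₀
  have h : ∀ k, (fun z => A z i k * ((I / z) • B) k j) =O[L] fun _ => (1 : ℂ) := fun k => by
    have h1 : (fun z => ((I / z) • B) k j) =O[L] fun z => 1 / z :=
      ((isBigO_refl (fun z : ℂ => 1 / z) L).const_mul_left (I * B k j)).congr_left fun z => by
        simp only [Matrix.smul_apply, smul_eq_mul]; ring
    refine ((hA i k).mul h1).trans (IsBigO.of_bound (‖(-1 / (q₀ : ℂ) ^ 2)‖) ?_)
    filter_upwards [h0] with z hz
    rw [norm_one, mul_one]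
    refine le_of_eq (congrArg _ ?_)
    rw [antipode]
    field_simp
  simp only [Matrix.mul_apply, Fin.sum_univ_two]
  exact (h 0).add (h 1)

lemma eventually_origin_ne (hq₀ : 0 < q₀) (s : Set ℂ) :
    ∀ᶠ z in 𝓝[s \ {0}] 0, z ∈ s ∧ z ≠ 0 ∧ ‖z‖ ≠ |q₀| := by
  filter_upwards [self_mem_nhdsWithin, mem_nhdsWithin_of_mem_nhds (Metric.ball_mem_nhds 0 hq₀)]
    with z hz hb
  rw [mem_ball_zero_iff] at hb
  exact ⟨hz.1, hz.2, fun h => by rw [h, abs_of_pos hq₀] at hb; exact lt_irrefl _ hb⟩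

namespace IsSolution

lemma isBigO_Mplus_origin (hq : IsSolution δ q₀ qp qm q) (x t : ℝ) (i j : Fin 2) :
    (fun z => (Mplus δ q₀ qp qm q x t z - (I / z) • (sigma3 * Qmat qm)) i j)
      =O[𝓝[(Dplus q₀ ∪ Sigma q₀) \ {0}] 0] fun _ => (1 : ℂ) := by
  have hne := eventually_origin_ne hq.q₀_pos (Dplus q₀ ∪ Sigma q₀)
  have hT := tendsto_antipode (s := Dplus q₀ ∪ Sigma q₀) (s' := Dminus q₀ ∪ Sigma q₀)
    hq.q₀_pos.ne' fun z hz => hz.1.imp (antipode_mem_Dminus hq.q₀_pos)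
      (antipode_mem_Sigma hq.q₀_pos)
  refine (isBigO_mul_antipode hq.q₀_pos.ne' (hne.mono fun z hz => hz.2.1) (sigma3 * Qmat qm)
    (A := fun z => Mminus δ q₀ qp qm q x t (antipode q₀ z) - 1)
    (fun i j => (hq.isBigO_Mminus inf_le_left (eventually_neg_mem_adm_infinity q₀) x t i
      j).comp_tendsto hT) i j).congr' (hne.mono fun z hz => ?_) EventuallyEq.rfl
  beta_reduce
  rw [hq.Mplus_eq_antipode (mem_adm_of_mem_closure_Dplus hz.1 hz.2.1 hz.2.2) x t, sub_mul, one_mul]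

lemma isBigO_Mminus_origin (hq : IsSolution δ q₀ qp qm q) (x t : ℝ) (i j : Fin 2) :
    (fun z => (Mminus δ q₀ qp qm q x t z - (I / z) • (sigma3 * Qmat qm)) i j)
      =O[𝓝[(Dminus q₀ ∪ Sigma q₀) \ {0}] 0] fun _ => (1 : ℂ) := by
  have hne := eventually_origin_ne hq.q₀_pos (Dminus q₀ ∪ Sigma q₀)
  have hT := tendsto_antipode (s := Dminus q₀ ∪ Sigma q₀) (s' := Dplus q₀ ∪ Sigma q₀)
    hq.q₀_pos.ne' fun z hz => hz.1.imp (antipode_mem_Dplus hq.q₀_pos)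
      (antipode_mem_Sigma hq.q₀_pos)
  refine (isBigO_mul_antipode hq.q₀_pos.ne' (hne.mono fun z hz => hz.2.1) (sigma3 * Qmat qm)
    (A := fun z => Mplus δ q₀ qp qm q x t (antipode q₀ z) - 1)
    (fun i j => (hq.isBigO_Mplus inf_le_left (eventually_mem_adm_infinity q₀) x t i
      j).comp_tendsto hT) i j).congr' (hne.mono fun z hz => ?_) EventuallyEq.rfl
  beta_reduce
  rw [hq.Mminus_eq_antipode (neg_mem_adm_of_mem_closure_Dminus hz.1 hz.2.1 hz.2.2) x t, sub_mul,
    one_mul]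

end IsSolution

end Origin

end

end SexticNLS

/-! ### The Riemann–Hilbert problem -/

theorem mainTheorem3 (δ q₀ : ℝ) (qp qm : ℂ) (q : ℝ → ℝ → ℂ)
    (hq : SexticNLS.IsSolution δ q₀ qp qm q) :
    -- the Jost columns that enter the construction exist, are unique, and solve the Lax pair
    (∀ z ∈ SexticNLS.Dplus q₀ ∪ SexticNLS.SigmaReg q₀,
      SexticNLS.JostWellDefined δ q₀ q atTop qp 0 z ∧
      SexticNLS.JostWellDefined δ q₀ q atBot qm 1 z) ∧
    (∀ z ∈ SexticNLS.Dminus q₀ ∪ SexticNLS.SigmaReg q₀,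
      SexticNLS.JostWellDefined δ q₀ q atBot qm 0 z ∧
      SexticNLS.JostWellDefined δ q₀ q atTop qp 1 z) ∧
    -- the scattering data do not depend on `x` and `t`, and `ψ₊ = ψ₋ S` on the contour
    (∀ z ∈ SexticNLS.Dplus q₀ ∪ SexticNLS.SigmaReg q₀, ∀ x t,
      SexticNLS.scatAt δ q₀ qp qm q x t z 0 0 = SexticNLS.scat δ q₀ qp qm q z 0 0) ∧
    (∀ z ∈ SexticNLS.Dminus q₀ ∪ SexticNLS.SigmaReg q₀, ∀ x t,
      SexticNLS.scatAt δ q₀ qp qm q x t z 1 1 = SexticNLS.scat δ q₀ qp qm q z 1 1) ∧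
    (∀ z ∈ SexticNLS.SigmaReg q₀, ∀ x t,
      SexticNLS.scatAt δ q₀ qp qm q x t z = SexticNLS.scat δ q₀ qp qm q z ∧
      SexticNLS.psi δ q₀ q atTop qp x t z =
        SexticNLS.psi δ q₀ q atBot qm x t z * SexticNLS.scat δ q₀ qp qm q z) ∧
    ∀ x t : ℝ,
      -- `M` is meromorphic off the contour
      (∀ i j, MeromorphicOn (fun z => SexticNLS.Mmat δ q₀ qp qm q x t z i j)
        (SexticNLS.Sigma q₀)ᶜ) ∧
      -- `M⁺` and `M⁻` are the boundary values of `M` on the contour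
      (∀ z ∈ SexticNLS.SigmaReg q₀, SexticNLS.scat δ q₀ qp qm q z 0 0 ≠ 0 →
        Tendsto (SexticNLS.Mmat δ q₀ qp qm q x t) (𝓝[SexticNLS.Dplus q₀] z)
          (𝓝 (SexticNLS.Mplus δ q₀ qp qm q x t z))) ∧
      (∀ z ∈ SexticNLS.SigmaReg q₀, SexticNLS.scat δ q₀ qp qm q z 1 1 ≠ 0 →
        Tendsto (SexticNLS.Mmat δ q₀ qp qm q x t) (𝓝[SexticNLS.Dminus q₀] z)
          (𝓝 (SexticNLS.Mminus δ q₀ qp qm q x t z))) ∧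
      -- the jump condition
      (∀ z ∈ SexticNLS.SigmaReg q₀, SexticNLS.scat δ q₀ qp qm q z 0 0 ≠ 0 →
        SexticNLS.scat δ q₀ qp qm q z 1 1 ≠ 0 →
        SexticNLS.Mminus δ q₀ qp qm q x t z =
          SexticNLS.Mplus δ q₀ qp qm q x t z * (1 - SexticNLS.Gmat δ q₀ qp qm q x t z)) ∧
      -- `M^± = I + O(1/z)` as `z → ∞`
      (∀ i j, (fun z => (SexticNLS.Mplus δ q₀ qp qm q x t z - 1) i j)
        =O[Bornology.cobounded ℂ ⊓ 𝓟 (SexticNLS.Dplus q₀ ∪ SexticNLS.Sigma q₀)]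
          (fun z => 1 / z)) ∧
      (∀ i j, (fun z => (SexticNLS.Mminus δ q₀ qp qm q x t z - 1) i j)
        =O[Bornology.cobounded ℂ ⊓ 𝓟 (SexticNLS.Dminus q₀ ∪ SexticNLS.Sigma q₀)]
          (fun z => 1 / z)) ∧
      -- `M^± = (i/z) σ₃ Q₋ + O(1)` as `z → 0`
      (∀ i j, (fun z => (SexticNLS.Mplus δ q₀ qp qm q x t z
          - (I / z) • (SexticNLS.sigma3 * SexticNLS.Qmat qm)) i j)
        =O[𝓝[(SexticNLS.Dplus q₀ ∪ SexticNLS.Sigma q₀) \ {0}] 0] (fun _ => (1 : ℂ))) ∧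
      (∀ i j, (fun z => (SexticNLS.Mminus δ q₀ qp qm q x t z
          - (I / z) • (SexticNLS.sigma3 * SexticNLS.Qmat qm)) i j)
        =O[𝓝[(SexticNLS.Dminus q₀ ∪ SexticNLS.Sigma q₀) \ {0}] 0] (fun _ => (1 : ℂ))) := by
  open SexticNLS in
  refine ⟨fun z hz => ⟨hq.jostWellDefined_top_zero (adm_of_plus hz),
      hq.jostWellDefined_bot_one (adm_of_plus hz)⟩,
    fun z hz => ⟨hq.jostWellDefined_bot_zero (adm_of_minus hz),
      hq.jostWellDefined_top_one (adm_of_minus hz)⟩,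
    fun z hz => hq.scatAt_zero_zero (adm_of_plus hz),
    fun z hz => hq.scatAt_one_one (adm_of_minus hz),
    fun z hz x t => ⟨hq.scatAt_eq (adm_of_plus (Or.inr hz)) (adm_of_minus (Or.inr hz)) x t,
      hq.psi_eq_mul_scat (adm_of_plus (Or.inr hz)) (adm_of_minus (Or.inr hz)) x t⟩,
    fun x t => ⟨hq.meromorphicOn_Mmat x t, fun z hz hs => hq.tendsto_Mmat_plus hz hs x t,
      fun z hz hs => hq.tendsto_Mmat_minus hz hs x t,
      fun z hz h₁ h₂ => hq.Mminus_eq (adm_of_plus (Or.inr hz)) (adm_of_minus (Or.inr hz)) h₁ h₂ x t,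
      hq.isBigO_Mplus inf_le_left (eventually_mem_adm_infinity q₀) x t,
      hq.isBigO_Mminus inf_le_left (eventually_neg_mem_adm_infinity q₀) x t,
      hq.isBigO_Mplus_origin x t, hq.isBigO_Mminus_origin x t⟩⟩
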